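/- **Setting.** Let $\mathbb Y_n$ be the finite set of Young diagrams with $n$ boxes; write $|\mu|$ for the number of boxes of $\mu$, and $\mu\nearrow\nu$ if $\mu\subset\nu$ and $|\nu|=|\mu|+1$. Let $\dim\nu$ be the number of chains $\varnothing\nearrow\dots\nearrow\nu$. For $z\in\mathbb C$ put $(z)_{\nu/\mu}=\prod_{(i,j)\in\nu/\mu}(z+j-i)$ (product over boxes, row $i$, column $j$), $(z)_\nu=(z)_{\nu/\varnothing}$, and $(t)_n=t(t+1)\cdots(t+n-1)$. Let $(z,z')$ belong to the principal series ($z,z'$ nonreal and $z'=\bar z$) or to the complementary series ($z,z'$ real and both in one interval $(N,N+1)$, $N\in\mathbb Z$). Put $$M_n(\mu)=\frac{(z)_\mu(z')_\mu}{(zz')_n}\frac{(\dim\mu)^2}{n!}\quad(\mu\in\mathbb Y_n),\qquad p^{\downarrow}(\nu,\mu)=\begin{cases}\dim\mu/\dim\nu,&\mu\nearrow\nu,\\0,&\text{otherwise,}\end{cases}\qquad p^{\uparrow}(\mu,\nu)=\frac{M_{n+1}(\nu)}{M_n(\mu)}\,p^{\downarrow}(\nu,\mu)\quad(\mu\in\mathbb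 Y_n,\ \nu\in\mathbb Y_{n+1}).$$ Let $T_n$ be the operator on the space $C(\mathbb Y_n)$ of real functions on $\mathbb Y_n$ with matrix $T_n(\mu,\tilde\mu)=\sum_{\nu\in\mathbb Y_{n+1}}p^{\uparrow}(\mu,\nu)p^{\downarrow}(\nu,\tilde\mu)$. Let $\Omega$ be the Thoma simplex: the compact space of pairs $(\alpha,\beta)$ of nonincreasing sequences of nonnegative reals with $\sum_i(\alpha_i+\beta_i)\le1$, with the topology of coordinatewise convergence. Let $\pi_n:C(\Omega)\to C(\mathbb Y_n)$ be $(\pi_nf)(\mu)=f(a_1/n,a_2/n,\dots;b_1/n,b_2/n,\dots)$, where, for $1\le i\le d$ and $d$ the number of diagonal boxes of $\mu$, $a_i$ (resp. $b_i$) is $\tfrac12$ plus the number of boxes of the $i$th row to the right of the diagonal (resp. of the $i$th column below the diagonal), and $a_i=b_i=0$ for $i>d$. Let $\Lambda=\mathbb R[p_1,p_2,\dots]$ be the algebra of symmetric functions ($p_k$ the power sums, of degree $k$; $s_\mu$ the Schur functions), $\Lambda^\circ=\Lambda/(p_1-1)$, $f^\circ$ the image of $f\in\Lambda$, and $F^m\subset\Lambda^\circ$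 the image of the elements of degree $\le m$. Map $\Lambda^\circ$ to $C(\Omega)$ by the algebra morphism $p_1^\circ\mapsto1$, $p_k^\circ\mapsto\sum_i\alpha_i^k+(-1)^{k-1}\sum_i\beta_i^k$ ($k\ge2$). **Lemma 5.4.** There is a linear operator $A_{z,z'}:\Lambda^\circ\to\Lambda^\circ$ which is the limit of the operators $n^2(T_n-1)$ as $n\to\infty$ in the following sense. For every $m$, $A_{z,z'}F^m\subset F^m$; for all sufficiently large $n$ the map $\pi_n$ is injective on $F^m$ and $\pi_n(F^m)$ is invariant under $T_n$, so that $T_n$ becomes an operator on $F^m\cong\pi_n(F^m)$; and for every $f\in F^m$ one has $n^2(T_n-1)f\to A_{z,z'}f$ in $F^m$ (equivalently, in the supremum norm on $\Omega$). Moreover, for every Young diagram $\mu$, with $m=|\mu|$, $$A_{z,z'}s^\circ_\mu=-m(m-1+zz')\,s^\circ_\mu+\sum_{\mu_\bullet\nearrow\mu}(z)_{\mu/\mu_\bullet}(z')_{\mu/\mu_\bullet}\,s^\circ_{\mu_\bullet}.$$ -/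

import Mathlib

open Filter Topology

noncomputable section

namespace ZMeasures

/-! ### Young diagrams -/

/-- `Y n` is the set of Young diagrams with `n` boxes. -/
abbrev Y (n : ℕ) : Type := {μ : YoungDiagram // μ.card = n}

/-- `Covers μ ν` is the relation `μ ↗ ν`: the diagram `ν` is obtained from `μ` by adding a box. -/
def Covers (μ ν : YoungDiagram) : Prop := μ ≤ ν ∧ ν.card = μ.card + 1

theorem cells_subset_range (μ : YoungDiagram) :
    μ.cells ⊆ Finset.range μ.card ×ˢ Finset.range μ.card := by
  rintro ⟨i, j⟩ h
  have hm : (i, j) ∈ μ := by simpa using h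
  have h1 : j < μ.rowLen i := YoungDiagram.mem_iff_lt_rowLen.1 hm
  have h2 : i < μ.colLen j := YoungDiagram.mem_iff_lt_colLen.1 hm
  have h3 : μ.rowLen i ≤ μ.card := by
    rw [YoungDiagram.rowLen_eq_card]
    exact Finset.card_le_card (Finset.filter_subset _ _)
  have h4 : μ.colLen j ≤ μ.card := by
    rw [YoungDiagram.colLen_eq_card]
    exact Finset.card_le_card (Finset.filter_subset _ _)
  simp only [Finset.mem_product, Finset.mem_range]
  omega

instance instFiniteY (n : ℕ) : Finite (Y n) := by
  let F : Y n → (Finset.range n ×ˢ Finset.range n).powerset := fun μ =>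
    ⟨μ.1.cells, by
      have h := cells_subset_range μ.1
      rw [μ.2] at h
      exact Finset.mem_powerset.2 h⟩
  refine Finite.of_injective F ?_
  intro μ ν h
  apply Subtype.ext
  apply YoungDiagram.ext
  exact congrArg Subtype.val h

instance instFintypeY (n : ℕ) : Fintype (Y n) := Fintype.ofFinite _

theorem finite_lower (μ : YoungDiagram) : {ν : YoungDiagram | Covers ν μ}.Finite := by
  refine Set.Finite.subset (Set.finite_range (fun ν : Y (μ.card - 1) => ν.1)) ?_
  intro ν hν
  have h : ν.card = μ.card - 1 := by
    have := hν.2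
    omega
  exact ⟨⟨ν, h⟩, rfl⟩

/-- The finite set of all diagrams `ν` with `ν ↗ μ`. -/
def lower (μ : YoungDiagram) : Finset YoungDiagram := (finite_lower μ).toFinset

theorem mem_lower {μ ν : YoungDiagram} : ν ∈ lower μ ↔ Covers ν μ := by
  simp [lower]

open Classical in
/-- The number of chains `∅ ↗ ⋯ ↗ ν` (equivalently, of standard tableaux of shape `ν`) for a
diagram `ν` with `n` boxes, computed by splitting the chains according to their last step. -/
def dim : (n : ℕ) → Y n → ℕ
  | 0, _ => 1
  | n + 1, ν => ∑ μ : Y n, if Covers μ.1 ν.1 then dim n μ else 0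

/-- The coordinate `a_{i+1}` of a diagram (rows, columns and boxes are numbered from `0` here):
`1/2` plus the number of boxes of row `i` to the right of the diagonal, if `(i, i)` is a box
of the diagram, and `0` if it is not. -/
def frobA (μ : YoungDiagram) (i : ℕ) : ℝ :=
  if (i, i) ∈ μ then (μ.rowLen i : ℝ) - i - 1 / 2 else 0

/-- The coordinate `b_{i+1}` of a diagram: `1/2` plus the number of boxes of column `i` below the
diagonal, if `(i, i)` is a box of the diagram, and `0` if it is not. -/
def frobB (μ : YoungDiagram) (i : ℕ) : ℝ :=
  if (i, i) ∈ μ then (μ.colLen i : ℝ) - i - 1 / 2 else 0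

theorem frobA_nonneg (μ : YoungDiagram) (i : ℕ) : 0 ≤ frobA μ i := by
  unfold frobA
  split_ifs with h
  · have h1 : (i : ℝ) + 1 ≤ μ.rowLen i := by
      exact_mod_cast YoungDiagram.mem_iff_lt_rowLen.1 h
    linarith
  · exact le_rfl

theorem frobB_nonneg (μ : YoungDiagram) (i : ℕ) : 0 ≤ frobB μ i := by
  unfold frobB
  split_ifs with h
  · have h1 : (i : ℝ) + 1 ≤ μ.colLen i := by
      exact_mod_cast YoungDiagram.mem_iff_lt_colLen.1 h
    linarith
  · exact le_rfl

theorem frobA_antitone (μ : YoungDiagram) : Antitone (frobA μ) := by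
  intro i j hij
  by_cases hj : (j, j) ∈ μ
  · have hi : (i, i) ∈ μ := μ.up_left_mem hij hij hj
    have h1 : (μ.rowLen j : ℝ) ≤ μ.rowLen i := by exact_mod_cast μ.rowLen_anti i j hij
    have h2 : (i : ℝ) ≤ j := by exact_mod_cast hij
    simp only [frobA, hi, hj, if_true]
    linarith
  · have : frobA μ j = 0 := by simp [frobA, hj]
    rw [this]
    exact frobA_nonneg μ i

theorem frobB_antitone (μ : YoungDiagram) : Antitone (frobB μ) := by
  intro i j hij
  by_cases hj : (j, j) ∈ μ
  · have hi : (i, i) ∈ μ := μ.up_left_mem hij hij hj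
    have h1 : (μ.colLen j : ℝ) ≤ μ.colLen i := by exact_mod_cast μ.colLen_anti i j hij
    have h2 : (i : ℝ) ≤ j := by exact_mod_cast hij
    simp only [frobB, hi, hj, if_true]
    linarith
  · have : frobB μ j = 0 := by simp [frobB, hj]
    rw [this]
    exact frobB_nonneg μ i

/-- `a_{i+1} + b_{i+1}` is the number of boxes of the hook with corner `(i, i)`. -/
theorem frob_add_le (μ : YoungDiagram) (i : ℕ) :
    frobA μ i + frobB μ i ≤ ((μ.cells.filter fun c => min c.1 c.2 = i).card : ℝ) := by
  by_cases h : (i, i) ∈ μ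
  · have hr : i < μ.rowLen i := YoungDiagram.mem_iff_lt_rowLen.1 h
    have hc : i < μ.colLen i := YoungDiagram.mem_iff_lt_colLen.1 h
    have hsub : ({i} ×ˢ Finset.Ico i (μ.rowLen i)) ∪ (Finset.Ico (i + 1) (μ.colLen i) ×ˢ {i}) ⊆
        μ.cells.filter fun c => min c.1 c.2 = i := by
      rintro ⟨a, b⟩ hab
      simp only [Finset.mem_union, Finset.mem_product, Finset.mem_singleton,
        Finset.mem_Ico] at hab
      simp only [Finset.mem_filter, YoungDiagram.mem_cells]
      rcases hab with ⟨rfl, h1, h2⟩ | ⟨⟨h1, h2⟩, rfl⟩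
      · exact ⟨YoungDiagram.mem_iff_lt_rowLen.2 h2, by omega⟩
      · exact ⟨YoungDiagram.mem_iff_lt_colLen.2 h2, by omega⟩
    have hdisj : Disjoint ({i} ×ˢ Finset.Ico i (μ.rowLen i))
        (Finset.Ico (i + 1) (μ.colLen i) ×ˢ {i}) := by
      rw [Finset.disjoint_left]
      rintro ⟨a, b⟩ h1 h2
      simp only [Finset.mem_product, Finset.mem_singleton, Finset.mem_Ico] at h1 h2
      omega
    have hcard := Finset.card_le_card hsub
    rw [Finset.card_union_of_disjoint hdisj] at hcard
    simp only [Finset.card_product, Finset.card_singleton, Nat.card_Ico, one_mul,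
      mul_one] at hcard
    have h3 : μ.rowLen i + μ.colLen i ≤
        (μ.cells.filter fun c => min c.1 c.2 = i).card + 2 * i + 1 := by omega
    have h4 : (μ.rowLen i : ℝ) + μ.colLen i ≤
        ((μ.cells.filter fun c => min c.1 c.2 = i).card : ℝ) + 2 * i + 1 := by exact_mod_cast h3
    simp only [frobA, frobB, h, if_true]
    linarith
  · simp [frobA, frobB, h]

theorem sum_frob_le (μ : YoungDiagram) (N : ℕ) :
    ∑ i ∈ Finset.range N, (frobA μ i + frobB μ i) ≤ (μ.card : ℝ) := by
  calc ∑ i ∈ Finset.range N, (frobA μ i + frobB μ i)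
      ≤ ∑ i ∈ Finset.range N, ((μ.cells.filter fun c => min c.1 c.2 = i).card : ℝ) :=
        Finset.sum_le_sum fun i _ => frob_add_le μ i
    _ ≤ (μ.card : ℝ) := by
        have h : ∑ i ∈ Finset.range N, (μ.cells.filter fun c => min c.1 c.2 = i).card ≤
            μ.cells.card := by
          rw [← Finset.card_biUnion]
          · exact Finset.card_le_card (Finset.biUnion_subset.2 fun i _ => Finset.filter_subset _ _)
          · intro i _ j _ hij
            rw [Function.onFun, Finset.disjoint_left]
            intro c h1 h2
            exact hij ((Finset.mem_filter.1 h1).2.symm.trans (Finset.mem_filter.1 h2).2)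
        exact_mod_cast h

/-! ### The Thoma simplex -/

/-- The Thoma simplex: pairs of nonincreasing sequences of nonnegative numbers with
`∑ (α_i + β_i) ≤ 1` (the terms being nonnegative, this is a bound on all partial sums). -/
def thoma : Set ((ℕ → ℝ) × (ℕ → ℝ)) :=
  {ω | Antitone ω.1 ∧ Antitone ω.2 ∧ (∀ i, 0 ≤ ω.1 i) ∧ (∀ i, 0 ≤ ω.2 i) ∧
    ∀ N, ∑ i ∈ Finset.range N, (ω.1 i + ω.2 i) ≤ 1}

/-- The Thoma simplex `Ω` as a topological space (with the topology of coordinatewise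
convergence). -/
abbrev Omega : Type := thoma

theorem thoma_bound (ω : Omega) (i : ℕ) :
    ω.1.1 i ≤ 1 / ((i : ℝ) + 1) ∧ ω.1.2 i ≤ 1 / ((i : ℝ) + 1) := by
  obtain ⟨ha, hb, ha0, hb0, hs⟩ := ω.2
  have hpos : (0 : ℝ) < (i : ℝ) + 1 := by positivity
  have h := hs (i + 1)
  constructor
  · rw [le_div_iff₀ hpos]
    have h1 : ∑ _k ∈ Finset.range (i + 1), ω.1.1 i ≤
        ∑ k ∈ Finset.range (i + 1), (ω.1.1 k + ω.1.2 k) := by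
      apply Finset.sum_le_sum
      intro k hk
      have h2 : k ≤ i := by
        have := Finset.mem_range.1 hk
        omega
      have h3 := ha h2
      have h4 := hb0 k
      linarith
    simp only [Finset.sum_const, Finset.card_range, nsmul_eq_mul] at h1
    push_cast at h1
    linarith
  · rw [le_div_iff₀ hpos]
    have h1 : ∑ _k ∈ Finset.range (i + 1), ω.1.2 i ≤
        ∑ k ∈ Finset.range (i + 1), (ω.1.1 k + ω.1.2 k) := by
      apply Finset.sum_le_sum
      intro k hk
      have h2 : k ≤ i := by
        have := Finset.mem_range.1 hk
        omega
      have h3 := hb h2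
      have h4 := ha0 k
      linarith
    simp only [Finset.sum_const, Finset.card_range, nsmul_eq_mul] at h1
    push_cast at h1
    linarith

theorem isClosed_thoma : IsClosed thoma := by
  have e : thoma = (⋂ i, ⋂ j, ⋂ (_ : i ≤ j), {ω : (ℕ → ℝ) × (ℕ → ℝ) | ω.1 j ≤ ω.1 i}) ∩
      ((⋂ i, ⋂ j, ⋂ (_ : i ≤ j), {ω : (ℕ → ℝ) × (ℕ → ℝ) | ω.2 j ≤ ω.2 i}) ∩
      ((⋂ i, {ω : (ℕ → ℝ) × (ℕ → ℝ) | 0 ≤ ω.1 i}) ∩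
      ((⋂ i, {ω : (ℕ → ℝ) × (ℕ → ℝ) | 0 ≤ ω.2 i}) ∩
      (⋂ N, {ω : (ℕ → ℝ) × (ℕ → ℝ) |
        ∑ i ∈ Finset.range N, (ω.1 i + ω.2 i) ≤ 1})))) := by
    ext ω
    simp only [thoma, Set.mem_ofPred_eq, Set.mem_inter_iff, Set.mem_iInter, Antitone]
  rw [e]
  refine IsClosed.inter ?_ (IsClosed.inter ?_ (IsClosed.inter ?_ (IsClosed.inter ?_ ?_)))
  · exact isClosed_iInter fun i => isClosed_iInter fun j => isClosed_iInter fun _ =>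
      isClosed_le (by fun_prop) (by fun_prop)
  · exact isClosed_iInter fun i => isClosed_iInter fun j => isClosed_iInter fun _ =>
      isClosed_le (by fun_prop) (by fun_prop)
  · exact isClosed_iInter fun i => isClosed_le (by fun_prop) (by fun_prop)
  · exact isClosed_iInter fun i => isClosed_le (by fun_prop) (by fun_prop)
  · exact isClosed_iInter fun N => isClosed_le (by fun_prop) (by fun_prop)

/-- `Ω` is compact; hence the topology of `C(Ω, ℝ)` is given by the supremum norm. -/
instance instCompactOmega : CompactSpace Omega := by
  apply isCompact_iff_compactSpace.1
  have hK : IsCompact ((Set.univ.pi fun _ : ℕ => Set.Icc (0 : ℝ) 1) ×ˢ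
      (Set.univ.pi fun _ : ℕ => Set.Icc (0 : ℝ) 1)) :=
    (isCompact_univ_pi fun _ => isCompact_Icc).prod (isCompact_univ_pi fun _ => isCompact_Icc)
  refine hK.of_isClosed_subset isClosed_thoma ?_
  intro ω hω
  have hb := thoma_bound ⟨ω, hω⟩
  have h1 : ∀ i : ℕ, 1 / ((i : ℝ) + 1) ≤ 1 := by
    intro i
    rw [div_le_one (by positivity)]
    have : (0 : ℝ) ≤ i := by positivity
    linarith
  exact ⟨fun i _ => ⟨hω.2.2.1 i, (hb i).1.trans (h1 i)⟩,
    fun i _ => ⟨hω.2.2.2.1 i, (hb i).2.trans (h1 i)⟩⟩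

/-- The embedding `ι_n` of `Y n` into `Ω`: `α_i = a_i / n`, `β_i = b_i / n`. -/
def iota (n : ℕ) (μ : Y n) : Omega :=
  ⟨(fun i => frobA μ.1 i / n, fun i => frobB μ.1 i / n), by
    have hn : (0 : ℝ) ≤ n := by positivity
    refine ⟨?_, ?_, ?_, ?_, ?_⟩
    · intro i j hij
      exact div_le_div_of_nonneg_right (frobA_antitone μ.1 hij) hn
    · intro i j hij
      exact div_le_div_of_nonneg_right (frobB_antitone μ.1 hij) hn
    · intro i
      exact div_nonneg (frobA_nonneg μ.1 i) hn
    · intro i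
      exact div_nonneg (frobB_nonneg μ.1 i) hn
    · intro N
      have h := sum_frob_le μ.1 N
      rw [μ.2] at h
      have e : ∑ i ∈ Finset.range N, (frobA μ.1 i / (n : ℝ) + frobB μ.1 i / n) =
          (∑ i ∈ Finset.range N, (frobA μ.1 i + frobB μ.1 i)) / n := by
        rw [Finset.sum_div]
        exact Finset.sum_congr rfl fun i _ => by rw [add_div]
      rw [e]
      exact div_le_one_of_le₀ h hn⟩

/-- The map `π_n : C(Ω) → C(Y n)`, `(π_n f)(μ) = f (ι_n μ)`. -/
def proj (n : ℕ) : C(Omega, ℝ) →ₗ[ℝ] (Y n → ℝ) where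
  toFun f := fun μ => f (iota n μ)
  map_add' _ _ := rfl
  map_smul' _ _ := rfl

/-! ### Symmetric functions -/

/-- The algebra of symmetric functions over `ℝ`, as the commutative algebra freely generated by
the Newton power sums `p_1, p_2, …`. -/
abbrev Sym : Type := MvPolynomial ℕ+ ℝ

/-- The Newton power sum `p_k`, `k ≥ 1`. -/
def psum (k : ℕ+) : Sym := MvPolynomial.X k

/-- The complete homogeneous symmetric functions `h_n`: `h_0 = 1` and, by Newton's identities,
`(n + 1) h_{n+1} = ∑_{k=0}^{n} p_{k+1} h_{n-k}`. -/
def hsym : ℕ → Sym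
  | 0 => 1
  | n + 1 => (1 / ((n : ℝ) + 1)) •
      ∑ k : Fin (n + 1), psum ⟨k.1 + 1, Nat.succ_pos _⟩ * hsym (n - k.1)
decreasing_by omega

/-- The Schur function `s_μ = det [h_{μ_i - i + j}]`, where `i, j` run over the rows of `μ` and
`h_r = 0` for `r < 0`. -/
def schur (μ : YoungDiagram) : Sym :=
  Matrix.det (Matrix.of fun i j : Fin (μ.colLen 0) =>
    if i.1 ≤ μ.rowLen i.1 + j.1 then hsym (μ.rowLen i.1 + j.1 - i.1) else 0)

/-- The quotient `Λ° = Λ / (p_1 - 1)`. -/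
abbrev SymQ : Type := Sym ⧸ Ideal.span {psum 1 - 1}

/-- The element `s°_μ` of `Λ°`. -/
def schurQ (μ : YoungDiagram) : SymQ := Ideal.Quotient.mk _ (schur μ)

/-- The elements of degree at most `m` in `Λ`, where `p_k` has degree `k`. -/
def symFilt (m : ℕ) : Submodule ℝ Sym :=
  MvPolynomial.restrictSupport ℝ {d | Finsupp.weight (fun k : ℕ+ => (k : ℕ)) d ≤ m}

/-- The filtration of `Λ°` inherited from `Λ`: images of the elements of degree at most `m`. -/
def filt (m : ℕ) : Submodule ℝ SymQ :=
  (symFilt m).map (Ideal.Quotient.mkₐ ℝ (Ideal.span {psum 1 - 1})).toLinearMap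

theorem continuous_moment (c : Omega → ℕ → ℝ) (hc : ∀ i, Continuous fun ω => c ω i)
    (h0 : ∀ ω i, 0 ≤ c ω i) (h1 : ∀ ω (i : ℕ), c ω i ≤ 1 / ((i : ℝ) + 1)) (k : ℕ) (hk : 2 ≤ k) :
    Continuous fun ω => ∑' i, c ω i ^ k := by
  have hsum : Summable fun i : ℕ => (1 / ((i : ℝ) + 1)) ^ k := by
    have h := (summable_nat_add_iff 1).2 (Real.summable_one_div_nat_pow.2 (by omega : 1 < k))
    refine h.congr fun i => ?_
    rw [div_pow, one_pow]
    push_cast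
    rfl
  refine continuous_tsum (fun i => (hc i).pow k) hsum fun i ω => ?_
  rw [Real.norm_of_nonneg (pow_nonneg (h0 ω i) k)]
  exact pow_le_pow_left₀ (h0 ω i) (h1 ω i) k

open Classical in
/-- The continuous function `p°_k` on `Ω`: `p°_1 = 1`, and
`p°_k(α, β) = ∑ α_i ^ k + (-1) ^ (k - 1) ∑ β_i ^ k` for `k ≥ 2`. -/
def psumFun (k : ℕ+) : C(Omega, ℝ) where
  toFun ω := if k = 1 then 1 else
    ∑' i, ω.1.1 i ^ (k : ℕ) + (-1) ^ ((k : ℕ) - 1) * ∑' i, ω.1.2 i ^ (k : ℕ)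
  continuous_toFun := by
    by_cases hk : k = 1
    · simp only [hk, if_true]
      exact continuous_const
    · simp only [hk, if_false]
      have hk2 : 2 ≤ (k : ℕ) := by
        have h1 : (k : ℕ) ≠ 1 := fun h => hk (PNat.coe_eq_one_iff.1 h)
        have h2 := k.pos
        omega
      refine Continuous.add ?_ (continuous_const.mul ?_)
      · exact continuous_moment (fun ω i => ω.1.1 i) (fun i => by fun_prop)
          (fun ω i => ω.2.2.2.1 i) (fun ω i => (thoma_bound ω i).1) k hk2
      · exact continuous_moment (fun ω i => ω.1.2 i) (fun i => by fun_prop)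
          (fun ω i => ω.2.2.2.2.1 i) (fun ω i => (thoma_bound ω i).2) k hk2

/-- The algebra morphism `Λ° → C(Ω)`, `f° ↦ f°(ω)`, given on the generators by `psumFun`. -/
def evalQ : SymQ →ₐ[ℝ] C(Omega, ℝ) :=
  Ideal.Quotient.liftₐ (Ideal.span {psum 1 - 1}) (MvPolynomial.aeval psumFun) (by
    intro a ha
    have h : Ideal.span {psum 1 - 1} ≤ RingHom.ker (MvPolynomial.aeval (R := ℝ) psumFun) := by
      rw [Ideal.span_le, Set.singleton_subset_iff]
      simp only [SetLike.mem_coe, RingHom.mem_ker, map_sub, map_one, psum,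
        MvPolynomial.aeval_X]
      ext ω
      simp [psumFun]
    exact h ha)

/-! ### z-measures and the up-down chains -/

/-- The couple `(z, z')` belongs to the principal series (nonreal and conjugate to each other) or
to the complementary series (real and in the same open interval `(N, N + 1)`, `N ∈ ℤ`). -/
def Admissible (z z' : ℂ) : Prop :=
  (z.im ≠ 0 ∧ z' = starRingEnd ℂ z) ∨
  (z.im = 0 ∧ z'.im = 0 ∧ ∃ N : ℤ,
    (N : ℝ) < z.re ∧ z.re < N + 1 ∧ (N : ℝ) < z'.re ∧ z'.re < N + 1)

/-- `(z)_S = ∏_{(i,j) ∈ S} (z + j - i)` for a finite set `S` of boxes. -/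
def poch (z : ℂ) (S : Finset (ℕ × ℕ)) : ℂ := ∏ c ∈ S, (z + (c.2 : ℂ) - (c.1 : ℂ))

/-- The number `(z)_{μ/ν} (z')_{μ/ν}`; it is real for admissible `(z, z')`, see
`poch_mul_poch_im`, and is regarded as a real number. -/
def boxWeight (z z' : ℂ) (ν μ : YoungDiagram) : ℝ :=
  (poch z (μ.cells \ ν.cells) * poch z' (μ.cells \ ν.cells)).re

theorem mul_im {z z' : ℂ} (h : Admissible z z') : (z * z').im = 0 := by
  rcases h with ⟨_, rfl⟩ | ⟨h1, h2, _⟩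
  · simp [Complex.mul_im, mul_comm]
  · simp [Complex.mul_im, h1, h2]

theorem poch_mul_poch_im {z z' : ℂ} (h : Admissible z z') (S : Finset (ℕ × ℕ)) :
    (poch z S * poch z' S).im = 0 := by
  unfold poch
  rw [← Finset.prod_mul_distrib]
  refine Finset.prod_induction _ (fun w : ℂ => w.im = 0) ?_ (by simp) ?_
  · intro a b ha hb
    simp [Complex.mul_im, ha, hb]
  · intro c _
    rcases h with ⟨_, rfl⟩ | ⟨h1, h2, _⟩
    · simp [Complex.mul_im]
      ring
    · simp [Complex.mul_im, h1, h2]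

/-- The weight of `μ ∈ Y n` for the z-measure,
`(z)_μ (z')_μ / (z z')_n * (dim μ)^2 / n!` with `(t)_n = t (t + 1) ⋯ (t + n - 1)`; it is real for
admissible `(z, z')`, and is regarded as a real number. -/
def zMeasure (z z' : ℂ) (n : ℕ) (μ : Y n) : ℝ :=
  (poch z μ.1.cells * poch z' μ.1.cells / (∏ k ∈ Finset.range n, (z * z' + (k : ℂ))) *
    ((dim n μ : ℂ) ^ 2 / (n.factorial : ℂ))).re

open Classical in
/-- The "down" transition matrix from `Y (n + 1)` to `Y n`. -/
def pDown (n : ℕ) : Matrix (Y (n + 1)) (Y n) ℝ :=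
  Matrix.of fun ν μ => if Covers μ.1 ν.1 then (dim n μ : ℝ) / (dim (n + 1) ν : ℝ) else 0

/-- The "up" transition matrix from `Y n` to `Y (n + 1)` of the coherent system of z-measures:
`p↑(μ, ν) = M_{n+1}(ν) / M_n(μ) * p↓(ν, μ)`. -/
def pUp (z z' : ℂ) (n : ℕ) : Matrix (Y n) (Y (n + 1)) ℝ :=
  Matrix.of fun μ ν => zMeasure z z' (n + 1) ν / zMeasure z z' n μ * pDown n ν μ

/-- The Markov operator `T_n` of the up-down chain on `Y n`, acting on functions: its matrix is
`T_n(μ, μ') = ∑_ν p↑(μ, ν) p↓(ν, μ')`. -/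
def T (z z' : ℂ) (n : ℕ) : (Y n → ℝ) →ₗ[ℝ] (Y n → ℝ) :=
  (pUp z z' n * pDown n).mulVecLin

end ZMeasures

end

noncomputable section

namespace ZMeasures

/-! ### Young diagrams described by their rows -/

/-! For fixed μ with m boxes, consider on `Y n` the function λ ↦ dim(μ,λ)/dim λ, where dim(μ,λ)
counts the chains from μ to λ. On these functions T_n acts explicitly. Let D sum a function over the
diagrams just below, and let U sum over the diagrams just above with weight (z+c)(z'+c), c being the
content of the added box. In UD − DU everything off the diagonal cancels, because the two sides of a
diamond μ∩κ, μ, κ, μ∪κ add the same box; the diagonal part is zz' + 2|μ| (`sum_upper_lower`,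
`sum_upper_zWeight_sub`). Moving U through a power of D gives `sum_upper_chains`, hence `T_chains`:
T_n maps the function of μ to a combination of itself and of the functions of the diagrams just
below μ.

These functions must be recognized as symmetric functions. A determinant of inverse factorials
counts the chains (`descFactorial_mul_chains`), and factoring it yields a Jacobi-Trudi formula whose
entries are complete symmetric functions of the modified Frobenius coordinates, corrected by
universal constants (`relDim_eq_det`). Rescaling by n turns the right side into an element
`schurDeform μ n` of F^m which is a polynomial in 1/n with constant term s°_μ (`schurDeform_eq`) and
whose restriction to `Y n` is n^{-m} `relDim μ` (`proj_schurDeform`). For n ≥ m, n ≠ 0, its elements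
with |μ| = m span F^m and have linearly independent restrictions, since D is injective; this gives
injectivity of π_n on F^m and, for n > m, invariance.

The exact formula `T_restr_schurDeform` makes n²(T_n − 1) on `schurDeform μ n` converge to the
required expression. The difference between s°_μ and `schurDeform μ n` consists of elements of lower
filtration with coefficients O(1/n), so induction on the filtration degree removes it. Limits are
unique, which makes the limit operator well defined and linear. -/

theorem rowLen_injective : Function.Injective YoungDiagram.rowLen := by
  intro μ ν h
  refine SetLike.ext ?_
  rintro ⟨i, j⟩
  rw [YoungDiagram.mem_iff_lt_rowLen, YoungDiagram.mem_iff_lt_rowLen, h]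

theorem le_iff_rowLen {μ ν : YoungDiagram} : μ ≤ ν ↔ ∀ i, μ.rowLen i ≤ ν.rowLen i := by
  constructor
  · intro h i
    by_contra! hlt
    have h1 : (i, ν.rowLen i) ∈ μ := YoungDiagram.mem_iff_lt_rowLen.2 hlt
    exact lt_irrefl _ (YoungDiagram.mem_iff_lt_rowLen.1 (h h1))
  · rintro h ⟨i, j⟩ hc
    exact YoungDiagram.mem_iff_lt_rowLen.2 ((YoungDiagram.mem_iff_lt_rowLen.1 hc).trans_le (h i))

theorem rowLen_eq_zero {μ : YoungDiagram} {i : ℕ} : μ.rowLen i = 0 ↔ μ.colLen 0 ≤ i := by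
  have := (YoungDiagram.mem_iff_lt_rowLen (μ := μ) (i := i) (j := 0)).symm.trans
    YoungDiagram.mem_iff_lt_colLen
  omega

theorem rowLen_antitone (μ : YoungDiagram) : Antitone μ.rowLen := fun i j h => μ.rowLen_anti i j h

theorem sum_cells {M : Type*} [AddCommMonoid M] (μ : YoungDiagram) {N : ℕ}
    (hN : μ.colLen 0 ≤ N) (φ : ℕ × ℕ → M) :
    ∑ c ∈ μ.cells, φ c = ∑ i ∈ Finset.range N, ∑ j ∈ Finset.range (μ.rowLen i), φ (i, j) := by
  rw [Finset.sum_sigma']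
  symm
  refine Finset.sum_bij (fun x _ => (x.1, x.2)) ?_ ?_ ?_ ?_
  · rintro ⟨i, j⟩ h
    simp only [Finset.mem_sigma, Finset.mem_range] at h
    exact YoungDiagram.mem_iff_lt_rowLen.2 h.2
  · rintro ⟨i, j⟩ _ ⟨i', j'⟩ _ h
    simp only [Prod.mk.injEq] at h
    obtain ⟨rfl, rfl⟩ := h
    rfl
  · rintro ⟨i, j⟩ h
    have h1 : j < μ.rowLen i := YoungDiagram.mem_iff_lt_rowLen.1 h
    refine ⟨⟨i, j⟩, ?_, rfl⟩
    simp only [Finset.mem_sigma, Finset.mem_range]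
    refine ⟨?_, h1⟩
    by_contra! h2
    have := rowLen_eq_zero.2 (hN.trans h2)
    omega
  · intros
    rfl

theorem card_eq_sum_rowLen (μ : YoungDiagram) {N : ℕ} (hN : μ.colLen 0 ≤ N) :
    μ.card = ∑ i ∈ Finset.range N, μ.rowLen i := by
  have h := sum_cells μ hN (fun _ => 1)
  simpa using h

theorem colLen_le_card (μ : YoungDiagram) : μ.colLen 0 ≤ μ.card := by
  rw [YoungDiagram.colLen_eq_card]
  exact Finset.card_le_card (Finset.filter_subset _ _)

theorem eq_of_le_of_card_le {μ ν : YoungDiagram} (h : μ ≤ ν) (hc : ν.card ≤ μ.card) : μ = ν :=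
  YoungDiagram.ext (Finset.eq_of_subset_of_card_le (YoungDiagram.cells_subset_iff.2 h) hc)

theorem card_sup_add_card_inf (μ ν : YoungDiagram) :
    (μ ⊔ ν).card + (μ ⊓ ν).card = μ.card + ν.card := by
  have := Finset.card_union_add_card_inter μ.cells ν.cells
  simpa [YoungDiagram.card, YoungDiagram.cells_sup, YoungDiagram.cells_inf] using this

/-- The diagram with rows of lengths `f 0 ≥ f 1 ≥ ⋯`. -/
def ofFun (f : ℕ → ℕ) (hf : Antitone f) (N : ℕ) (_hN : f N = 0) : YoungDiagram where
  cells := (Finset.range N ×ˢ Finset.range (f 0)).filter fun c => c.2 < f c.1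
  isLowerSet := by
    rintro ⟨i, j⟩ ⟨i', j'⟩ ⟨h1, h2⟩ h
    have h1 : i' ≤ i := h1
    have h2 : j' ≤ j := h2
    simp only [Finset.coe_filter, Finset.mem_product, Finset.mem_range,
      Set.mem_ofPred_eq] at h ⊢
    have := hf h1
    omega

theorem rowLen_ofFun (f : ℕ → ℕ) (hf : Antitone f) (N : ℕ) (hN : f N = 0) :
    (ofFun f hf N hN).rowLen = f := by
  have key : ∀ i j, (i, j) ∈ ofFun f hf N hN ↔ j < f i := by
    intro i j
    change (i, j) ∈ (Finset.range N ×ˢ Finset.range (f 0)).filter (fun c => c.2 < f c.1) ↔ _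
    simp only [Finset.mem_filter, Finset.mem_product, Finset.mem_range]
    constructor
    · exact fun h => h.2
    · intro h
      refine ⟨⟨?_, h.trans_le (hf (Nat.zero_le i))⟩, h⟩
      by_contra! h2
      have := hf h2
      omega
  funext i
  refine le_antisymm ?_ ?_
  · by_contra! h
    have := (key i (f i)).1 (YoungDiagram.mem_iff_lt_rowLen.2 h)
    omega
  · by_contra! h
    have := YoungDiagram.mem_iff_lt_rowLen.1 ((key i _).2 h)
    omega

theorem antitone_update_succ {f : ℕ → ℕ} (hf : Antitone f) {i : ℕ} (h : i = 0 ∨ f i < f (i - 1)) :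
    Antitone (Function.update f i (f i + 1)) := by
  refine antitone_nat_of_succ_le fun k => ?_
  have h1 := hf (Nat.le_succ k)
  simp only [Function.update_apply]
  split_ifs with h2 h3 h3
  · omega
  · subst h2
    simp only [Nat.add_sub_cancel] at h
    omega
  · subst h3
    simp only [Nat.succ_eq_add_one] at h1
    omega
  · exact h1

theorem antitone_update_pred {f : ℕ → ℕ} (hf : Antitone f) {i : ℕ} (h : f (i + 1) < f i) :
    Antitone (Function.update f i (f i - 1)) := by
  refine antitone_nat_of_succ_le fun k => ?_
  have h1 := hf (Nat.le_succ k)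
  simp only [Function.update_apply]
  split_ifs with h2 h3 h3
  · omega
  · subst h2
    simp only [Nat.succ_eq_add_one] at h1
    omega
  · subst h3
    omega
  · exact h1

/-- A box can be added to the row `i` of `μ`. -/
def Addable (μ : YoungDiagram) (i : ℕ) : Prop := i = 0 ∨ μ.rowLen i < μ.rowLen (i - 1)

/-- A box can be removed from the row `i` of `μ`. -/
def Removable (μ : YoungDiagram) (i : ℕ) : Prop := μ.rowLen (i + 1) < μ.rowLen i

open Classical in
/-- The diagram `μ` with a box added to the row `i`, if this is possible. -/
def addBox (μ : YoungDiagram) (i : ℕ) : YoungDiagram :=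
  if h : Addable μ i then
    ofFun (Function.update μ.rowLen i (μ.rowLen i + 1))
      -- The box may open a new row, so the bound on the nonempty rows has to exceed i as well.
      (antitone_update_succ (rowLen_antitone μ) h) (max (μ.colLen 0) (i + 1)) (by
        have h1 : max (μ.colLen 0) (i + 1) ≠ i := by
          have := le_max_right (μ.colLen 0) (i + 1)
          omega
        rw [Function.update_of_ne h1, rowLen_eq_zero]
        exact le_max_left _ _)
  else μ

open Classical in
/-- The diagram `μ` with a box removed from the row `i`, if this is possible. -/
def removeBox (μ : YoungDiagram) (i : ℕ) : YoungDiagram :=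
  if h : Removable μ i then
    ofFun (Function.update μ.rowLen i (μ.rowLen i - 1))
      (antitone_update_pred (rowLen_antitone μ) h) (max (μ.colLen 0) (i + 1)) (by
        have h1 : max (μ.colLen 0) (i + 1) ≠ i := by
          have := le_max_right (μ.colLen 0) (i + 1)
          omega
        rw [Function.update_of_ne h1, rowLen_eq_zero]
        exact le_max_left _ _)
  else μ

theorem rowLen_addBox {μ : YoungDiagram} {i : ℕ} (h : Addable μ i) :
    (addBox μ i).rowLen = Function.update μ.rowLen i (μ.rowLen i + 1) := by
  rw [addBox, dif_pos h, rowLen_ofFun]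

theorem rowLen_removeBox {μ : YoungDiagram} {i : ℕ} (h : Removable μ i) :
    (removeBox μ i).rowLen = Function.update μ.rowLen i (μ.rowLen i - 1) := by
  rw [removeBox, dif_pos h, rowLen_ofFun]

/-- The increments of the row lengths are nonnegative integers with sum 1, so exactly one of them is
1. -/
theorem covers_iff_rowLen {μ ν : YoungDiagram} :
    Covers μ ν ↔ ∃ i, ν.rowLen = Function.update μ.rowLen i (μ.rowLen i + 1) := by
  set N := max (μ.colLen 0) (ν.colLen 0) with hN
  have h1 := card_eq_sum_rowLen μ (le_max_left (μ.colLen 0) (ν.colLen 0))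
  have h2 := card_eq_sum_rowLen ν (le_max_right (μ.colLen 0) (ν.colLen 0))
  rw [← hN] at h1 h2
  constructor
  · rintro ⟨hle, hc⟩
    rw [le_iff_rowLen] at hle
    have hs : ∑ i ∈ Finset.range N, (ν.rowLen i - μ.rowLen i) = 1 := by
      have h3 : ∑ i ∈ Finset.range N, (ν.rowLen i - μ.rowLen i) +
          ∑ i ∈ Finset.range N, μ.rowLen i = ∑ i ∈ Finset.range N, ν.rowLen i := by
        rw [← Finset.sum_add_distrib]
        exact Finset.sum_congr rfl fun i _ => Nat.sub_add_cancel (hle i)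
      omega
    obtain ⟨i, hi, hne⟩ : ∃ i ∈ Finset.range N, ν.rowLen i - μ.rowLen i ≠ 0 := by
      by_contra! hcon
      rw [Finset.sum_eq_zero hcon] at hs
      omega
    rw [← Finset.add_sum_erase _ _ hi] at hs
    have h4 : ∑ x ∈ (Finset.range N).erase i, (ν.rowLen x - μ.rowLen x) = 0 := by omega
    rw [Finset.sum_eq_zero_iff] at h4
    refine ⟨i, funext fun r => ?_⟩
    rw [Function.update_apply]
    split_ifs with h5
    · subst h5
      have := hle r
      omega
    · by_cases h6 : r < N
      · have := h4 r (Finset.mem_erase.2 ⟨h5, Finset.mem_range.2 h6⟩)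
        have := hle r
        omega
      · rw [rowLen_eq_zero.2 ((le_max_left _ _).trans (not_lt.1 h6)),
          rowLen_eq_zero.2 ((le_max_right _ _).trans (not_lt.1 h6))]
  · rintro ⟨i, hi⟩
    have hr : ∀ r, ν.rowLen r = μ.rowLen r + if r = i then 1 else 0 := by
      intro r
      rw [hi, Function.update_apply]
      split_ifs with h <;> simp [h]
    have hiN : i < N := by
      by_contra! h
      have := rowLen_eq_zero.2 ((le_max_right _ _).trans h)
      rw [hr] at this
      simp at this
    refine ⟨le_iff_rowLen.2 fun r => by rw [hr]; omega, ?_⟩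
    rw [h2, h1, Finset.sum_congr rfl fun r _ => hr r, Finset.sum_add_distrib]
    simp [hiN]

theorem covers_iff_addBox {μ ν : YoungDiagram} :
    Covers μ ν ↔ ∃ i, Addable μ i ∧ ν = addBox μ i := by
  rw [covers_iff_rowLen]
  refine exists_congr fun i => ⟨fun h => ?_, ?_⟩
  · have ha : Addable μ i := by
      rcases Nat.eq_zero_or_pos i with h0 | h0
      · exact Or.inl h0
      · right
        have := ν.rowLen_anti (i - 1) i (by omega)
        rw [h, Function.update_self, Function.update_of_ne (by omega)] at this
        omega
    exact ⟨ha, rowLen_injective (h.trans (rowLen_addBox ha).symm)⟩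
  · rintro ⟨ha, rfl⟩
    exact rowLen_addBox ha

theorem covers_iff_removeBox {μ ν : YoungDiagram} :
    Covers μ ν ↔ ∃ i, Removable ν i ∧ μ = removeBox ν i := by
  rw [covers_iff_rowLen]
  refine exists_congr fun i => ⟨fun h => ?_, ?_⟩
  · have ha : Removable ν i := by
      have := μ.rowLen_anti i (i + 1) (by omega)
      rw [Removable, h, Function.update_self, Function.update_of_ne (by omega)]
      omega
    refine ⟨ha, rowLen_injective ?_⟩
    rw [rowLen_removeBox ha, h]
    simp
  · rintro ⟨ha, rfl⟩
    rw [rowLen_removeBox ha]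
    have : 0 < ν.rowLen i := (Nat.zero_le _).trans_lt ha
    have h2 : ν.rowLen i - 1 + 1 = ν.rowLen i := by omega
    simp [h2]

theorem addBox_injOn (μ : YoungDiagram) : Set.InjOn (addBox μ) {i | Addable μ i} := by
  intro i hi j hj h
  by_contra hne
  have h1 := congrFun (congrArg YoungDiagram.rowLen h) i
  rw [rowLen_addBox hi, rowLen_addBox hj, Function.update_self, Function.update_of_ne hne] at h1
  omega

theorem removeBox_injOn (μ : YoungDiagram) : Set.InjOn (removeBox μ) {i | Removable μ i} := by
  intro i hi j hj h
  by_contra hne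
  have h1 := congrFun (congrArg YoungDiagram.rowLen h) i
  rw [rowLen_removeBox hi, rowLen_removeBox hj, Function.update_self,
    Function.update_of_ne hne] at h1
  have : 0 < μ.rowLen i := (Nat.zero_le _).trans_lt hi
  omega

theorem cells_sdiff_of_rowLen {μ ν : YoungDiagram} {i : ℕ}
    (h : ν.rowLen = Function.update μ.rowLen i (μ.rowLen i + 1)) :
    ν.cells \ μ.cells = {(i, μ.rowLen i)} := by
  ext ⟨a, b⟩
  simp only [Finset.mem_sdiff, YoungDiagram.mem_cells, YoungDiagram.mem_iff_lt_rowLen, h,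
    Finset.mem_singleton, Prod.mk.injEq, Function.update_apply]
  split_ifs with h1
  · subst h1
    simp only [true_and]
    omega
  · simp only [h1, false_and, iff_false]
    omega

theorem cells_addBox_sdiff {μ : YoungDiagram} {i : ℕ} (h : Addable μ i) :
    (addBox μ i).cells \ μ.cells = {(i, μ.rowLen i)} :=
  cells_sdiff_of_rowLen (rowLen_addBox h)

theorem cells_sdiff_removeBox {μ : YoungDiagram} {i : ℕ} (h : Removable μ i) :
    μ.cells \ (removeBox μ i).cells = {(i, μ.rowLen i - 1)} := by
  have hp : 0 < μ.rowLen i := (Nat.zero_le _).trans_lt h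
  have h2 : μ.rowLen i - 1 + 1 = μ.rowLen i := by omega
  have h1 : μ.rowLen = Function.update (removeBox μ i).rowLen i ((removeBox μ i).rowLen i + 1) := by
    rw [rowLen_removeBox h]
    simp [h2]
  have h3 := cells_sdiff_of_rowLen h1
  rw [rowLen_removeBox h, Function.update_self] at h3
  rw [h3]

theorem Addable.le_colLen {μ : YoungDiagram} {i : ℕ} (h : Addable μ i) : i ≤ μ.colLen 0 := by
  rcases h with h | h
  · omega
  · by_contra! h1
    have := (rowLen_eq_zero (μ := μ) (i := i - 1)).2 (by omega)
    omega

theorem Removable.lt_colLen {μ : YoungDiagram} {i : ℕ} (h : Removable μ i) : i < μ.colLen 0 := by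
  by_contra! h1
  have := rowLen_eq_zero.2 h1
  unfold Removable at h
  omega

open Classical in
/-- The finite set of all diagrams `ν` with `μ ↗ ν`. -/
def upper (μ : YoungDiagram) : Finset YoungDiagram :=
  ((Finset.range (μ.colLen 0 + 1)).filter (Addable μ)).image (addBox μ)

theorem mem_upper {μ ν : YoungDiagram} : ν ∈ upper μ ↔ Covers μ ν := by
  rw [covers_iff_addBox, upper]
  simp only [Finset.mem_image, Finset.mem_filter, Finset.mem_range]
  constructor
  · rintro ⟨i, ⟨_, h⟩, rfl⟩
    exact ⟨i, h, rfl⟩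
  · rintro ⟨i, h, rfl⟩
    exact ⟨i, ⟨Nat.lt_succ_of_le h.le_colLen, h⟩, rfl⟩

-- The range has N + 1 terms because a box can open a row below the last one; for removals N terms
-- suffice. A free N allows both sums to be compared.
open Classical in
theorem sum_upper {M : Type*} [AddCommMonoid M] (μ : YoungDiagram) {N : ℕ} (hN : μ.colLen 0 ≤ N)
    (F : YoungDiagram → M) :
    ∑ ν ∈ upper μ, F ν =
      ∑ i ∈ Finset.range (N + 1), if Addable μ i then F (addBox μ i) else 0 := by
  have h : upper μ = ((Finset.range (N + 1)).filter (Addable μ)).image (addBox μ) := by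
    ext ν
    rw [mem_upper, covers_iff_addBox]
    simp only [Finset.mem_image, Finset.mem_filter, Finset.mem_range]
    constructor
    · rintro ⟨i, h, rfl⟩
      exact ⟨i, ⟨Nat.lt_succ_of_le (h.le_colLen.trans hN), h⟩, rfl⟩
    · rintro ⟨i, ⟨_, h⟩, rfl⟩
      exact ⟨i, h, rfl⟩
  rw [h, Finset.sum_image, Finset.sum_filter]
  intro i hi j hj
  exact addBox_injOn μ (Finset.mem_filter.1 hi).2 (Finset.mem_filter.1 hj).2

open Classical in
theorem sum_lower {M : Type*} [AddCommMonoid M] (μ : YoungDiagram) {N : ℕ} (hN : μ.colLen 0 ≤ N)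
    (F : YoungDiagram → M) :
    ∑ ν ∈ lower μ, F ν =
      ∑ i ∈ Finset.range N, if Removable μ i then F (removeBox μ i) else 0 := by
  have h : lower μ = ((Finset.range N).filter (Removable μ)).image (removeBox μ) := by
    ext ν
    rw [mem_lower, covers_iff_removeBox]
    simp only [Finset.mem_image, Finset.mem_filter, Finset.mem_range]
    constructor
    · rintro ⟨i, h, rfl⟩
      exact ⟨i, ⟨h.lt_colLen.trans_le hN, h⟩, rfl⟩
    · rintro ⟨i, ⟨_, h⟩, rfl⟩
      exact ⟨i, h, rfl⟩
  rw [h, Finset.sum_image, Finset.sum_filter]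
  intro i hi j hj
  exact removeBox_injOn μ (Finset.mem_filter.1 hi).2 (Finset.mem_filter.1 hj).2

theorem lower_nonempty {μ : YoungDiagram} (h : μ.card ≠ 0) : (lower μ).Nonempty := by
  have h0 : μ.colLen 0 ≠ 0 := by
    intro h0
    apply h
    rw [card_eq_sum_rowLen μ h0.le]
    simp
  refine ⟨removeBox μ (μ.colLen 0 - 1), mem_lower.2 (covers_iff_removeBox.2 ⟨_, ?_, rfl⟩)⟩
  have h1 : μ.rowLen (μ.colLen 0 - 1) ≠ 0 := by
    rw [Ne, rowLen_eq_zero]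
    omega
  have h2 : μ.rowLen (μ.colLen 0 - 1 + 1) = 0 := by
    rw [rowLen_eq_zero]
    omega
  unfold Removable
  omega

/-! ### Commutation of the operations of adding and removing a box -/

-- Paths up and then down that return to μ give the diagonal term. The others match the paths down
-- and then up by completing the diamond with the union or the intersection, and w takes the same
-- value since both paths add the same box.
open Classical in
theorem sum_upper_lower (w : Finset (ℕ × ℕ) → ℝ) (F : YoungDiagram → ℝ) (μ : YoungDiagram) :
    ∑ ν ∈ upper μ, w (ν.cells \ μ.cells) * ∑ κ ∈ lower ν, F κ =
      (∑ ν ∈ upper μ, w (ν.cells \ μ.cells) - ∑ κ ∈ lower μ, w (μ.cells \ κ.cells)) * F μ +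
        ∑ κ ∈ lower μ, ∑ ν ∈ upper κ, w (ν.cells \ κ.cells) * F ν := by
  have h1 : ∑ ν ∈ upper μ, w (ν.cells \ μ.cells) * ∑ κ ∈ lower ν, F κ =
      ∑ ν ∈ upper μ, w (ν.cells \ μ.cells) * F μ +
        ∑ ν ∈ upper μ, ∑ κ ∈ (lower ν).erase μ, w (ν.cells \ μ.cells) * F κ := by
    rw [← Finset.sum_add_distrib]
    refine Finset.sum_congr rfl fun ν hν => ?_
    rw [← Finset.add_sum_erase _ _ (mem_lower.2 (mem_upper.1 hν)), mul_add, Finset.mul_sum]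
  have h2 : ∑ κ ∈ lower μ, ∑ ν ∈ upper κ, w (ν.cells \ κ.cells) * F ν =
      ∑ κ ∈ lower μ, w (μ.cells \ κ.cells) * F μ +
        ∑ κ ∈ lower μ, ∑ ν ∈ (upper κ).erase μ, w (ν.cells \ κ.cells) * F ν := by
    rw [← Finset.sum_add_distrib]
    refine Finset.sum_congr rfl fun κ hκ => ?_
    rw [← Finset.add_sum_erase _ _ (mem_upper.2 (mem_lower.1 hκ))]
  have h3 : ∑ ν ∈ upper μ, ∑ κ ∈ (lower ν).erase μ, w (ν.cells \ μ.cells) * F κ =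
      ∑ κ ∈ lower μ, ∑ ν ∈ (upper κ).erase μ, w (ν.cells \ κ.cells) * F ν := by
    have hsup : ∀ ν κ : YoungDiagram, Covers μ ν → Covers κ ν → κ ≠ μ → μ ⊔ κ = ν := by
      intro ν κ hμ hκ hne
      refine eq_of_le_of_card_le (sup_le hμ.1 hκ.1) ?_
      by_contra! hlt
      have h4 : μ = μ ⊔ κ := eq_of_le_of_card_le le_sup_left (by have := hμ.2; omega)
      have h5 : κ ≤ μ := by rw [h4]; exact le_sup_right
      exact hne (eq_of_le_of_card_le h5 (by have := hμ.2; have := hκ.2; omega))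
    have hinf : ∀ ν κ : YoungDiagram, Covers κ μ → Covers κ ν → ν ≠ μ → μ ⊓ ν = κ := by
      intro ν κ hμ hν hne
      symm
      refine eq_of_le_of_card_le (le_inf hμ.1 hν.1) ?_
      by_contra! hlt
      have h4 : μ ⊓ ν = μ := eq_of_le_of_card_le inf_le_left (by have := hμ.2; omega)
      have h5 : μ ≤ ν := by rw [← h4]; exact inf_le_right
      exact hne (eq_of_le_of_card_le h5 (by have := hμ.2; have := hν.2; omega)).symm
    rw [Finset.sum_sigma', Finset.sum_sigma']
    refine Finset.sum_bij' (fun x _ => ⟨μ ⊓ x.2, x.2⟩) (fun x _ => ⟨μ ⊔ x.2, x.2⟩) ?_ ?_ ?_ ?_ ?_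
    · rintro ⟨ν, κ⟩ h
      simp only [Finset.mem_sigma, Finset.mem_erase, mem_upper, mem_lower] at h ⊢
      obtain ⟨hμ, hne, hκ⟩ := h
      have hs := hsup ν κ hμ hκ hne
      have hc := card_sup_add_card_inf μ κ
      rw [hs] at hc
      have e1 := hμ.2
      have e2 := hκ.2
      exact ⟨⟨inf_le_left, by omega⟩, hne, ⟨inf_le_right, by omega⟩⟩
    · rintro ⟨κ, ν⟩ h
      simp only [Finset.mem_sigma, Finset.mem_erase, mem_upper, mem_lower] at h ⊢
      obtain ⟨hμ, hne, hν⟩ := h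
      have hs := hinf ν κ hμ hν hne
      have hc := card_sup_add_card_inf μ ν
      rw [hs] at hc
      have e1 := hμ.2
      have e2 := hν.2
      exact ⟨⟨le_sup_left, by omega⟩, hne, ⟨le_sup_right, by omega⟩⟩
    · rintro ⟨ν, κ⟩ h
      simp only [Finset.mem_sigma, Finset.mem_erase, mem_upper, mem_lower] at h ⊢
      rw [hsup ν κ h.1 h.2.2 h.2.1]
    · rintro ⟨κ, ν⟩ h
      simp only [Finset.mem_sigma, Finset.mem_erase, mem_upper, mem_lower] at h ⊢
      rw [hinf ν κ h.1 h.2.2 h.2.1]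
    · rintro ⟨ν, κ⟩ h
      simp only [Finset.mem_sigma, Finset.mem_erase, mem_upper, mem_lower] at h ⊢
      rw [← hsup ν κ h.1 h.2.2 h.2.1, YoungDiagram.cells_sup, YoungDiagram.cells_inf,
        Finset.union_sdiff_left, Finset.sdiff_inter_self_right]
  rw [h1, h2, h3, ← Finset.sum_mul, ← Finset.sum_mul]
  ring

/-- The sums of a function of the content over the addable and over the removable boxes. -/
theorem sum_upper_sub_sum_lower (μ : YoungDiagram) {N : ℕ} (hN : μ.colLen 0 ≤ N)
    (w : Finset (ℕ × ℕ) → ℝ) (φ : ℤ → ℝ) (hw : ∀ i j : ℕ, w {(i, j)} = φ ((j : ℤ) - i)) :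
    ∑ ν ∈ upper μ, w (ν.cells \ μ.cells) - ∑ κ ∈ lower μ, w (μ.cells \ κ.cells) =
      φ (-N) + ∑ i ∈ Finset.range N,
        (φ ((μ.rowLen i : ℤ) - i) - φ ((μ.rowLen i : ℤ) - i - 1)) := by
  classical
  rw [sum_upper μ hN fun ν => w (ν.cells \ μ.cells), sum_lower μ hN fun κ => w (μ.cells \ κ.cells)]
  have h1 : ∀ i, (if Addable μ i then w ((addBox μ i).cells \ μ.cells) else 0) =
      if Addable μ i then φ ((μ.rowLen i : ℤ) - i) else 0 := by
    intro i
    split_ifs with h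
    · rw [cells_addBox_sdiff h, hw]
    · rfl
  have h2 : ∀ i, (if Removable μ i then w (μ.cells \ (removeBox μ i).cells) else 0) =
      if Removable μ i then φ ((μ.rowLen i : ℤ) - i - 1) else 0 := by
    intro i
    split_ifs with h
    · have hp : 1 ≤ μ.rowLen i := (Nat.zero_le _).trans_lt h
      rw [cells_sdiff_removeBox h, hw]
      congr 1
      push_cast [hp]
      ring
    · rfl
  -- Row i + 1 admits a box exactly when row i can lose one. Otherwise the two rows are equal and
  -- the two contents coincide, so both conditions may be dropped from the difference.
  have h3 : ∀ i, (if Addable μ (i + 1) then φ ((μ.rowLen (i + 1) : ℤ) - (i + 1 : ℕ)) else 0) -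
      (if Removable μ i then φ ((μ.rowLen i : ℤ) - i - 1) else 0) =
      φ ((μ.rowLen (i + 1) : ℤ) - (i + 1 : ℕ)) - φ ((μ.rowLen i : ℤ) - i - 1) := by
    intro i
    have h4 : Addable μ (i + 1) ↔ Removable μ i := by simp [Addable, Removable]
    by_cases h : Removable μ i
    · rw [if_pos h, if_pos (h4.2 h)]
    · rw [if_neg h, if_neg (fun h5 => h (h4.1 h5))]
      have h5 := μ.rowLen_anti i (i + 1) (by omega)
      have h6 : μ.rowLen (i + 1) = μ.rowLen i := by
        unfold Removable at h
        omega
      rw [h6]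
      push_cast
      rw [show (μ.rowLen i : ℤ) - ((i : ℤ) + 1) = (μ.rowLen i : ℤ) - i - 1 by ring]
      ring
  have h4 := Finset.sum_range_succ' (fun i : ℕ => φ ((μ.rowLen i : ℤ) - i)) N
  rw [Finset.sum_range_succ, rowLen_eq_zero.2 hN] at h4
  have h5 := Finset.sum_congr (rfl : Finset.range N = _) fun i _ => h3 i
  rw [Finset.sum_sub_distrib, Finset.sum_sub_distrib] at h5
  have h0 : Addable μ 0 := Or.inl rfl
  rw [Finset.sum_congr rfl fun i _ => h1 i, Finset.sum_congr rfl fun i _ => h2 i,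
    Finset.sum_range_succ', if_pos h0, Finset.sum_sub_distrib]
  simp only [Nat.cast_zero, zero_sub, sub_zero] at h4 ⊢
  linarith

/-! ### Chains of diagrams -/

open Classical in
/-- The number of chains `μ ↗ ⋯ ↗ ν` of length `k`. -/
def chains (μ : YoungDiagram) : ℕ → YoungDiagram → ℝ
  | 0, ν => if ν = μ then 1 else 0
  | k + 1, ν => ∑ κ ∈ lower ν, chains μ k κ

theorem sum_lower_chains (μ : YoungDiagram) (k : ℕ) (ν : YoungDiagram) :
    ∑ κ ∈ lower ν, chains μ k κ = chains μ (k + 1) ν := rfl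

/-- The action of a weighted sum over the diagrams `ν ↘ λ` on numbers of chains. -/
theorem sum_upper_chains (w : Finset (ℕ × ℕ) → ℝ) (t : ℝ)
    (hw : ∀ μ : YoungDiagram, ∑ ν ∈ upper μ, w (ν.cells \ μ.cells) -
      ∑ κ ∈ lower μ, w (μ.cells \ κ.cells) = t + 2 * μ.card) (μ : YoungDiagram) (k : ℕ)
    (la : YoungDiagram) :
    ∑ ν ∈ upper la, w (ν.cells \ la.cells) * chains μ (k + 1) ν =
      (k + 1) * (t + 2 * la.card - k) * chains μ k la +
        ∑ κ ∈ lower μ, w (μ.cells \ κ.cells) * chains κ (k + 1) la := by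
  classical
  -- Each exchange of U with D at level |la| − j contributes t + 2(|la| − j); the sum over j = 0, …,
  -- k is (k + 1)(t + 2|la| − k).
  induction k generalizing la with
  | zero =>
    have h := sum_upper_lower w (chains μ 0) la
    simp only [sum_lower_chains] at h
    rw [h, hw]
    have h1 : ∑ κ ∈ lower la, ∑ ν ∈ upper κ, w (ν.cells \ κ.cells) * chains μ 0 ν =
        ∑ κ ∈ lower μ, w (μ.cells \ κ.cells) * chains κ (0 + 1) la := by
      have h2 : ∀ κ, ∑ ν ∈ upper κ, w (ν.cells \ κ.cells) * chains μ 0 ν =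
          if Covers κ μ then w (μ.cells \ κ.cells) else 0 := by
        intro κ
        simp only [chains, mul_ite, mul_one, mul_zero, Finset.sum_ite_eq', mem_upper]
      have h3 : ∀ κ, chains κ (0 + 1) la = if Covers κ la then 1 else 0 := by
        intro κ
        simp only [chains, Finset.sum_ite_eq', mem_lower]
      rw [Finset.sum_congr rfl fun κ _ => h2 κ]
      simp only [h3, mul_ite, mul_one, mul_zero]
      rw [← Finset.sum_filter, ← Finset.sum_filter]
      refine Finset.sum_congr ?_ fun _ _ => rfl
      ext κ
      simp only [Finset.mem_filter, mem_lower, and_comm]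
    rw [h1]
    push_cast
    ring
  | succ k ih =>
    have h := sum_upper_lower w (chains μ (k + 1)) la
    simp only [sum_lower_chains] at h
    rw [h, hw]
    have h1 : ∑ κ ∈ lower la, ∑ ν ∈ upper κ, w (ν.cells \ κ.cells) * chains μ (k + 1) ν =
        (k + 1) * (t + 2 * (la.card - 1) - k) * chains μ (k + 1) la +
          ∑ κ ∈ lower μ, w (μ.cells \ κ.cells) * chains κ (k + 2) la := by
      have h2 : ∀ κ ∈ lower la, ∑ ν ∈ upper κ, w (ν.cells \ κ.cells) * chains μ (k + 1) ν =
          (k + 1) * (t + 2 * (la.card - 1) - k) * chains μ k κ +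
            ∑ η ∈ lower μ, w (μ.cells \ η.cells) * chains η (k + 1) κ := by
        intro κ hκ
        have h3 : (la.card : ℝ) = κ.card + 1 := by
          exact_mod_cast (mem_lower.1 hκ).2
        rw [ih κ, h3]
        ring
      rw [Finset.sum_congr rfl h2, Finset.sum_add_distrib, ← Finset.mul_sum, sum_lower_chains,
        Finset.sum_comm]
      simp only [← Finset.mul_sum, sum_lower_chains]
    rw [h1]
    push_cast
    ring

/-- With constant weight all row differences vanish and only the lowest addable position survives.
Thus the unweighted operators satisfy UD − DU = 1. -/
theorem sum_upper_one_sub (μ : YoungDiagram) :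
    ∑ _ν ∈ upper μ, (1 : ℝ) - ∑ _κ ∈ lower μ, (1 : ℝ) = 1 := by
  have h := sum_upper_sub_sum_lower μ le_rfl (fun _ => 1) (fun _ => 1) (fun _ _ => rfl)
  simpa using h

/-- The operation of summation over the diagrams `κ ↗ ν` is injective on functions of diagrams
with `n` boxes. -/
theorem eq_zero_of_sum_lower_eq_zero (n : ℕ) (F : YoungDiagram → ℝ)
    (h : ∀ ν : YoungDiagram, ν.card = n + 1 → ∑ κ ∈ lower ν, F κ = 0) (μ : YoungDiagram)
    (hμ : μ.card = n) : F μ = 0 := by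
  classical
  -- The unweighted U is adjoint to D. If DF = 0, then UD = 1 + DU gives F + DUF = 0, and pairing
  -- with F gives ‖F‖² + ‖UF‖² = 0.
  set U : YoungDiagram → ℝ := fun κ => ∑ ν ∈ upper κ, F ν with hU
  have h1 : ∀ la : YoungDiagram, la.card = n → F la + ∑ κ ∈ lower la, U κ = 0 := by
    intro la hla
    have h2 := sum_upper_lower (fun _ => 1) F la
    simp only [one_mul, sum_upper_one_sub] at h2
    rw [← h2]
    refine Finset.sum_eq_zero fun ν hν => h ν ?_
    rw [(mem_upper.1 hν).2, hla]
  have h2 : ∑ la : Y n, F la.1 * F la.1 + ∑ la : Y n, ∑ κ ∈ lower la.1, F la.1 * U κ = 0 := by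
    rw [← Finset.sum_add_distrib]
    refine Finset.sum_eq_zero fun la _ => ?_
    rw [← Finset.mul_sum, ← mul_add, h1 la.1 la.2, mul_zero]
  have h3 : 0 ≤ ∑ la : Y n, ∑ κ ∈ lower la.1, F la.1 * U κ := by
    cases n with
    | zero =>
      refine Finset.sum_nonneg fun la _ => ?_
      have : lower la.1 = ∅ := by
        ext κ
        simp only [mem_lower, Finset.notMem_empty, iff_false]
        intro hc
        have := hc.2
        have := la.2
        omega
      rw [this, Finset.sum_empty]
    | succ n =>
      have h4 : ∑ la : Y (n + 1), ∑ κ ∈ lower la.1, F la.1 * U κ = ∑ κ : Y n, U κ.1 * U κ.1 := by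
        rw [Finset.sum_sigma']
        have h5 : ∀ κ : Y n, U κ.1 * U κ.1 = ∑ ν ∈ upper κ.1, F ν * U κ.1 := by
          intro κ
          rw [← Finset.sum_mul]
        rw [Finset.sum_congr rfl fun κ _ => h5 κ, Finset.sum_sigma']
        refine Finset.sum_bij'
          (fun x hx => ⟨⟨x.2, by
            have := (mem_lower.1 (Finset.mem_sigma.1 hx).2).2
            have := x.1.2
            omega⟩, x.1.1⟩)
          (fun x hx => ⟨⟨x.2, by
            have := (mem_upper.1 (Finset.mem_sigma.1 hx).2).2
            have := x.1.2
            omega⟩, x.1.1⟩) ?_ ?_ ?_ ?_ ?_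
        · intro x hx
          simp only [Finset.mem_sigma, Finset.mem_univ, true_and] at hx ⊢
          exact mem_upper.2 (mem_lower.1 hx)
        · intro x hx
          simp only [Finset.mem_sigma, Finset.mem_univ, true_and] at hx ⊢
          exact mem_lower.2 (mem_upper.1 hx)
        · intros; rfl
        · intros; rfl
        · intros; rfl
      rw [h4]
      exact Finset.sum_nonneg fun κ _ => mul_self_nonneg _
  have h4 : ∑ la : Y n, F la.1 * F la.1 = 0 :=
    le_antisymm (by linarith) (Finset.sum_nonneg fun _ _ => mul_self_nonneg _)
  rw [Finset.sum_eq_zero_iff_of_nonneg fun _ _ => mul_self_nonneg _] at h4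
  exact mul_self_eq_zero.1 (h4 ⟨μ, hμ⟩ (Finset.mem_univ _))

/-- The sum is the k-th power of D applied to c, and each application of D is injective. -/
theorem chains_linearIndependent (m k : ℕ) (c : Y m → ℝ)
    (h : ∀ ν : YoungDiagram, ν.card = m + k → ∑ μ : Y m, c μ * chains μ.1 k ν = 0) : c = 0 := by
  classical
  induction k with
  | zero =>
    funext μ
    have h1 := h μ.1 μ.2
    simp only [chains, mul_ite, mul_one, mul_zero] at h1
    rw [Finset.sum_eq_single μ (fun η _ hne => if_neg fun e => hne (Subtype.ext e.symm))
      (fun h => absurd (Finset.mem_univ _) h)] at h1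
    simpa using h1
  | succ k ih =>
    refine ih fun ν hν => ?_
    refine eq_zero_of_sum_lower_eq_zero (m + k) (fun ν => ∑ μ : Y m, c μ * chains μ.1 k ν) ?_ ν hν
    intro ν hν
    rw [Finset.sum_comm]
    simp only [← Finset.mul_sum, sum_lower_chains]
    exact h ν hν

/-- The number of chains from `∅` to `ν`. -/
def fdim (ν : YoungDiagram) : ℝ := chains ⊥ ν.card ν

open Classical in
theorem sum_Y_eq_sum_lower (n : ℕ) (ν : YoungDiagram) (hν : ν.card = n + 1)
    (F : YoungDiagram → ℝ) :
    ∑ κ : Y n, (if Covers κ.1 ν then F κ.1 else 0) = ∑ κ ∈ lower ν, F κ := by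
  rw [← Finset.sum_filter]
  refine Finset.sum_bij (fun κ _ => κ.1) ?_ ?_ ?_ ?_
  · intro κ hκ
    exact mem_lower.2 (Finset.mem_filter.1 hκ).2
  · intro κ _ κ' _ h
    exact Subtype.ext h
  · intro κ hκ
    have hc := mem_lower.1 hκ
    exact ⟨⟨κ, by have := hc.2; omega⟩, Finset.mem_filter.2 ⟨Finset.mem_univ _, hc⟩, rfl⟩
  · intros
    rfl

open Classical in
theorem sum_Y_eq_sum_upper (n : ℕ) (μ : YoungDiagram) (hμ : μ.card = n)
    (F : YoungDiagram → ℝ) :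
    ∑ ν : Y (n + 1), (if Covers μ ν.1 then F ν.1 else 0) = ∑ ν ∈ upper μ, F ν := by
  rw [← Finset.sum_filter]
  refine Finset.sum_bij (fun κ _ => κ.1) ?_ ?_ ?_ ?_
  · intro κ hκ
    exact mem_upper.2 (Finset.mem_filter.1 hκ).2
  · intro κ _ κ' _ h
    exact Subtype.ext h
  · intro κ hκ
    have hc := mem_upper.1 hκ
    exact ⟨⟨κ, by have := hc.2; omega⟩, Finset.mem_filter.2 ⟨Finset.mem_univ _, hc⟩, rfl⟩
  · intros
    rfl

theorem card_bot : (⊥ : YoungDiagram).card = 0 := by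
  simp [YoungDiagram.card]

theorem eq_bot_of_card {μ : YoungDiagram} (h : μ.card = 0) : μ = ⊥ :=
  (eq_of_le_of_card_le bot_le (by rw [h]; exact Nat.zero_le _)).symm

theorem dim_eq_fdim (n : ℕ) (ν : Y n) : (dim n ν : ℝ) = fdim ν.1 := by
  classical
  induction n with
  | zero =>
    rw [fdim, ν.2, dim, chains, if_pos (eq_bot_of_card ν.2), Nat.cast_one]
  | succ n ih =>
    rw [fdim, ν.2, dim, chains, ← sum_Y_eq_sum_lower n ν.1 ν.2]
    push_cast
    refine Finset.sum_congr rfl fun κ _ => ?_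
    split_ifs
    · rw [ih κ, fdim, κ.2]
    · rfl

theorem fdim_pos (ν : YoungDiagram) : 0 < fdim ν := by
  obtain ⟨n, hn⟩ : ∃ n, ν.card = n := ⟨_, rfl⟩
  induction n generalizing ν with
  | zero => rw [fdim, hn, chains, if_pos (eq_bot_of_card hn)]; norm_num
  | succ n ih =>
    rw [fdim, hn, chains]
    refine Finset.sum_pos (fun κ hκ => ?_) (lower_nonempty (by omega))
    have hc : κ.card = n := by have := (mem_lower.1 hκ).2; omega
    have := ih κ hc
    rwa [fdim, hc] at this

/-! ### The determinantal formula for numbers of chains -/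

/-- In the Leibniz expansion the i-th summand multiplies the term of σ by a i − b (σ⁻¹ i); summed
over i this no longer depends on σ. -/
theorem sum_det_updateRow {N : ℕ} (M : Matrix (Fin N) (Fin N) ℝ) (a b : Fin N → ℝ) :
    ∑ i, (M.updateRow i fun j => (a i - b j) * M i j).det = (∑ i, a i - ∑ j, b j) * M.det := by
  simp only [Matrix.det_apply]
  rw [Finset.sum_comm, Finset.mul_sum]
  refine Finset.sum_congr rfl fun σ _ => ?_
  have h1 : ∀ i, ∏ k, (M.updateRow i fun j => (a i - b j) * M i j) (σ k) k =
      (a i - b (σ.symm i)) * ∏ k, M (σ k) k := by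
    intro i
    rw [← Finset.mul_prod_erase _ _ (Finset.mem_univ (σ.symm i)),
      ← Finset.mul_prod_erase _ (fun k => M (σ k) k) (Finset.mem_univ (σ.symm i)), ← mul_assoc]
    congr 1
    · simp
    · refine Finset.prod_congr rfl fun k hk => ?_
      rw [Matrix.updateRow_ne]
      intro h
      exact (Finset.mem_erase.1 hk).1 (by rw [← h, Equiv.symm_apply_apply])
  simp only [h1, ← Finset.smul_sum, ← Finset.sum_mul, Finset.sum_sub_distrib]
  rw [Equiv.sum_comp σ.symm b, mul_smul_comm]

/-- The determinant of the matrix with entries `1 / (l_i - m_j)!`. -/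
def invFactDet {N : ℕ} (l m : Fin N → ℕ) : ℝ :=
  (Matrix.of fun i j => ((l i).descFactorial (m j) : ℝ) / ((l i).factorial : ℝ)).det

/-- This is 1/(l − 1 − m)! = (l − m)/(l − m)!, with inverse factorials of negative integers read as
0; the case l = m agrees because of the factor l − m. -/
theorem descFactorial_pred_div (l m : ℕ) (hl : l ≠ 0) :
    ((l - 1).descFactorial m : ℝ) / ((l - 1).factorial : ℝ) =
      ((l : ℝ) - m) * ((l.descFactorial m : ℝ) / (l.factorial : ℝ)) := by
  obtain ⟨k, rfl⟩ := Nat.exists_eq_succ_of_ne_zero hl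
  simp only [Nat.succ_eq_add_one, Nat.add_sub_cancel]
  have h1 : ((k : ℝ) + 1 - m) * ((k + 1).descFactorial m : ℝ) = (k + 1) * (k.descFactorial m) := by
    rcases le_or_gt m (k + 1) with h | h
    · have := Nat.succ_descFactorial k m
      have h2 : ((k + 1 - m : ℕ) : ℝ) = (k : ℝ) + 1 - m := by push_cast [h]; ring
      rw [← h2]
      exact_mod_cast this
    · rw [Nat.descFactorial_of_lt h, Nat.descFactorial_of_lt (by omega)]
      simp
  have h3 : (k.factorial : ℝ) ≠ 0 := by positivity
  have h4 : (k : ℝ) + 1 ≠ 0 := by positivity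
  rw [Nat.factorial_succ]
  push_cast
  field_simp
  linarith

/-- Lowering l i by one multiplies the entries of row i by l i − m j. When l i = 0 the multiplied
row vanishes, whereas truncated subtraction would leave l unchanged; hence the separate case. -/
theorem sum_sub_sum_mul_invFactDet {N : ℕ} (l m : Fin N → ℕ) :
    (∑ i, (l i : ℝ) - ∑ j, (m j : ℝ)) * invFactDet l m =
      ∑ i, if l i = 0 then 0 else invFactDet (Function.update l i (l i - 1)) m := by
  rw [invFactDet, ← sum_det_updateRow]
  refine Finset.sum_congr rfl fun i _ => ?_
  split_ifs with h
  · refine Matrix.det_eq_zero_of_row_eq_zero i fun j => ?_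
    rw [Matrix.updateRow_self, Matrix.of_apply, h]
    rcases Nat.eq_zero_or_pos (m j) with h1 | h1
    · rw [h1]
      simp
    · rw [Nat.descFactorial_of_lt h1]
      simp
  · rw [invFactDet]
    congr 1
    ext r j
    by_cases hr : r = i
    · subst hr
      rw [Matrix.updateRow_self, Matrix.of_apply, Matrix.of_apply, Function.update_self,
        descFactorial_pred_div _ _ h]
    · rw [Matrix.updateRow_ne hr, Matrix.of_apply, Matrix.of_apply, Function.update_of_ne hr]

theorem invFactDet_eq_zero_of_eq {N : ℕ} (l m : Fin N → ℕ) (i j : Fin N) (hij : i ≠ j)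
    (h : l i = l j) : invFactDet l m = 0 := by
  refine Matrix.det_zero_of_row_eq hij ?_
  ext k
  simp only [Matrix.of_apply, h]

theorem invFactDet_self {N : ℕ} (l : Fin N → ℕ) (hl : StrictAnti l) : invFactDet l l = 1 := by
  rw [invFactDet, Matrix.det_of_isUpperTriangular]
  · refine Finset.prod_eq_one fun i _ => ?_
    rw [Matrix.of_apply, Nat.descFactorial_self]
    exact div_self (by positivity)
  · intro i j hij
    have : l i < l j := hl hij
    rw [Matrix.of_apply, Nat.descFactorial_of_lt this]
    simp

/-- A nonzero Leibniz term requires m i ≤ l (σ i) for every i. Equality of the sums makes these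
equalities, monotonicity then forces σ = id, and so l = m. -/
theorem invFactDet_eq_zero_of_sum_eq {N : ℕ} (l m : Fin N → ℕ) (hl : StrictAnti l)
    (hm : StrictAnti m) (hs : ∑ i, l i = ∑ i, m i) (hne : l ≠ m) : invFactDet l m = 0 := by
  rw [invFactDet, Matrix.det_apply]
  refine Finset.sum_eq_zero fun σ _ => ?_
  suffices h : ∏ i, (Matrix.of fun i j => ((l i).descFactorial (m j) : ℝ) /
      ((l i).factorial : ℝ)) (σ i) i = 0 by rw [h, smul_zero]
  rw [Finset.prod_eq_zero_iff]
  by_contra! hcon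
  have h1 : ∀ i, m i ≤ l (σ i) := by
    intro i
    by_contra! hlt
    refine hcon i (Finset.mem_univ _) ?_
    rw [Matrix.of_apply, Nat.descFactorial_of_lt hlt]
    simp
  have h2 : ∑ i, m i = ∑ i, l (σ i) := by rw [Equiv.sum_comp σ l, hs]
  have h3 := (Finset.sum_eq_sum_iff_of_le fun i _ => h1 i).1 h2
  have h4 : StrictMono σ := by
    intro i j hij
    have h5 := hm hij
    rw [h3 i (Finset.mem_univ _), h3 j (Finset.mem_univ _)] at h5
    exact hl.lt_iff_gt.1 h5
  have h5 : ⇑σ = id := by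
    have := Subsingleton.elim (h4.orderIsoOfSurjective σ σ.surjective) (OrderIso.refl _)
    funext i
    exact congrArg (fun e : Fin N ≃o Fin N => e i) this
  apply hne
  funext i
  rw [h3 i (Finset.mem_univ _), h5, id]

/-- The numbers `μ_i + N - i`, `1 ≤ i ≤ N`. -/
def shiftRow (μ : YoungDiagram) (N : ℕ) : Fin N → ℕ := fun i => μ.rowLen i + (N - 1 - i)

theorem shiftRow_strictAnti (μ : YoungDiagram) (N : ℕ) : StrictAnti (shiftRow μ N) := by
  intro i j hij
  have h1 : (i : ℕ) < j := hij
  have h2 := μ.rowLen_anti i j h1.le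
  have h3 := j.2
  simp only [shiftRow]
  omega

theorem sum_shiftRow (μ : YoungDiagram) {N : ℕ} (hN : μ.colLen 0 ≤ N) :
    ∑ i, shiftRow μ N i = μ.card + ∑ i : Fin N, (N - 1 - (i : ℕ)) := by
  rw [card_eq_sum_rowLen μ hN, ← Fin.sum_univ_eq_sum_range, ← Finset.sum_add_distrib]
  rfl

theorem shiftRow_injective {μ ν : YoungDiagram} {N : ℕ} (hμ : μ.colLen 0 ≤ N)
    (hν : ν.colLen 0 ≤ N) (h : shiftRow μ N = shiftRow ν N) : μ = ν := by
  refine rowLen_injective (funext fun i => ?_)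
  by_cases hi : i < N
  · have := congrFun h ⟨i, hi⟩
    simp only [shiftRow] at this
    omega
  · rw [rowLen_eq_zero.2 (hμ.trans (not_lt.1 hi)), rowLen_eq_zero.2 (hν.trans (not_lt.1 hi))]

theorem colLen_mono {μ ν : YoungDiagram} (h : μ ≤ ν) : μ.colLen 0 ≤ ν.colLen 0 := by
  rw [← rowLen_eq_zero]
  have := le_iff_rowLen.1 h (ν.colLen 0)
  rw [rowLen_eq_zero.2 le_rfl] at this
  omega

/-- The rows from which no box can be removed contribute nothing to the recursion: lowering such an
entry makes it equal to the next one, or else it is the last entry and is already 0. -/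
theorem sum_lower_invFactDet {la μ : YoungDiagram} {N : ℕ} (hla : la.colLen 0 ≤ N)
    (hμ : μ.colLen 0 ≤ N) :
    ((la.card : ℝ) - μ.card) * invFactDet (shiftRow la N) (shiftRow μ N) =
      ∑ κ ∈ lower la, invFactDet (shiftRow κ N) (shiftRow μ N) := by
  classical
  have h1 : (la.card : ℝ) - μ.card =
      ∑ i, (shiftRow la N i : ℝ) - ∑ i, (shiftRow μ N i : ℝ) := by
    rw [← Nat.cast_sum, ← Nat.cast_sum, sum_shiftRow la hla, sum_shiftRow μ hμ]
    push_cast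
    ring
  rw [h1, sum_sub_sum_mul_invFactDet, sum_lower la hla, ← Fin.sum_univ_eq_sum_range
    (fun i => if Removable la i then
      invFactDet (shiftRow (removeBox la i) N) (shiftRow μ N) else 0)]
  refine Finset.sum_congr rfl fun i _ => ?_
  by_cases hr : Removable la i
  · have hp : 0 < la.rowLen i := (Nat.zero_le _).trans_lt hr
    have h2 : shiftRow la N i ≠ 0 := by
      simp only [shiftRow]
      omega
    rw [if_pos hr, if_neg h2]
    congr 1
    funext j
    simp only [shiftRow, rowLen_removeBox hr, Function.update_apply, Fin.val_inj]
    split_ifs with h3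
    · subst h3
      omega
    · rfl
  · rw [if_neg hr]
    split_ifs with h2
    · rfl
    · have h3 := la.rowLen_anti i (i + 1) (by omega)
      have hlt := i.2
      have h4 : la.rowLen (i + 1) = la.rowLen i := by
        unfold Removable at hr
        omega
      by_cases hi : (i : ℕ) + 1 < N
      · refine invFactDet_eq_zero_of_eq _ _ i ⟨i + 1, hi⟩ ?_ ?_
        · intro h
          have := congrArg Fin.val h
          simp at this
        · rw [Function.update_self, Function.update_of_ne]
          · simp only [shiftRow]
            omega
          · intro h
            have := congrArg Fin.val h
            simp at this
      · exfalso
        apply h2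
        have h5 : la.rowLen (i + 1) = 0 := rowLen_eq_zero.2 (by omega)
        simp only [shiftRow]
        omega

/-- The number of chains from `μ` to `λ` as a determinant. -/
theorem descFactorial_mul_chains (n : ℕ) {la μ : YoungDiagram} (hn : la.card = n) {N : ℕ}
    (hla : la.colLen 0 ≤ N) (hμ : μ.colLen 0 ≤ N) :
    (n.descFactorial μ.card : ℝ) * chains μ (n - μ.card) la =
      n.factorial * invFactDet (shiftRow la N) (shiftRow μ N) := by
  have hrec := sum_lower_invFactDet hla hμ
  -- For chains of length 0 both sides reduce to the same multiple of a Kronecker delta. Above that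
  -- level both obey the same recursion.
  rcases eq_or_ne n μ.card with h | h
  · subst h
    rw [Nat.sub_self, chains, Nat.descFactorial_self]
    congr 1
    split_ifs with h1
    · rw [h1, invFactDet_self _ (shiftRow_strictAnti μ N)]
    · rw [invFactDet_eq_zero_of_sum_eq _ _ (shiftRow_strictAnti _ N) (shiftRow_strictAnti _ N)]
      · rw [sum_shiftRow la hla, sum_shiftRow μ hμ, hn]
      · exact fun e => h1 (shiftRow_injective hla hμ e)
  have hne : (la.card : ℝ) - μ.card ≠ 0 := by
    rw [hn, sub_ne_zero]
    exact_mod_cast h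
  induction n generalizing la with
  | zero =>
    have h1 : lower la = ∅ := by
      ext κ
      simp only [mem_lower, Finset.notMem_empty, iff_false]
      intro hc
      have := hc.2
      omega
    rw [h1, Finset.sum_empty, mul_eq_zero, or_iff_right hne] at hrec
    rw [hrec, mul_zero, Nat.descFactorial_of_lt (by omega)]
    simp
  | succ n ih =>
    have h1 : ∀ κ ∈ lower la, (n.descFactorial μ.card : ℝ) * chains μ (n - μ.card) κ =
        n.factorial * invFactDet (shiftRow κ N) (shiftRow μ N) := by
      intro κ hκ
      have hc := mem_lower.1 hκ
      have hcard : κ.card = n := by have := hc.2; omega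
      have hcol := (colLen_mono hc.1).trans hla
      rcases eq_or_ne n μ.card with h2 | h2
      · subst h2
        rw [Nat.sub_self, chains, Nat.descFactorial_self]
        congr 1
        split_ifs with h1
        · rw [h1, invFactDet_self _ (shiftRow_strictAnti μ N)]
        · rw [invFactDet_eq_zero_of_sum_eq _ _ (shiftRow_strictAnti _ N) (shiftRow_strictAnti _ N)]
          · rw [sum_shiftRow κ hcol, sum_shiftRow μ hμ, hcard]
          · exact fun e => h1 (shiftRow_injective hcol hμ e)
      · refine ih hcard hcol (sum_lower_invFactDet hcol hμ) h2 ?_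
        rw [hcard, sub_ne_zero]
        exact_mod_cast h2
    have h2 := Finset.sum_congr rfl h1
    rw [← Finset.mul_sum, ← Finset.mul_sum, ← hrec, hn] at h2
    rw [hn] at hne
    -- If λ is smaller than μ, the truncated length is a default value killed by the falling
    -- factorial; on the other side the recursion, with nonzero factor |λ| − |μ|, forces the
    -- determinant to be 0.
    rcases lt_or_gt_of_ne h with h3 | h3
    · rw [Nat.descFactorial_of_lt h3]
      rw [Nat.descFactorial_of_lt (by omega)] at h2
      have h4 : (n.factorial : ℝ) ≠ 0 := by positivity
      simp only [Nat.cast_zero, zero_mul, zero_eq_mul, h4, false_or] at h2 ⊢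
      right
      exact (mul_eq_zero.1 h2).resolve_left hne
    · have h5 : n + 1 - μ.card = (n - μ.card) + 1 := by omega
      rw [sum_lower_chains, ← h5] at h2
      have h6 := Nat.succ_descFactorial n μ.card
      have h7 : (((n + 1 : ℕ) : ℝ) - μ.card) * ((n + 1).descFactorial μ.card : ℝ) =
          (n + 1) * (n.descFactorial μ.card) := by
        rw [← Nat.cast_sub h3.le]
        exact_mod_cast h6
      refine mul_left_cancel₀ hne ?_
      rw [← mul_assoc, h7, mul_assoc, h2, Nat.factorial_succ]
      push_cast
      ring

/-- The ratio `n (n - 1) ⋯ (n - m + 1) dim(μ, λ) / dim λ`, where `n = |λ|` and `m = |μ|`. -/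
def relDim (μ la : YoungDiagram) : ℝ :=
  (la.card.descFactorial μ.card : ℝ) * chains μ (la.card - μ.card) la / fdim la

theorem prod_factorial_mul_invFactDet {N : ℕ} (l m : Fin N → ℕ) :
    (∏ i, ((l i).factorial : ℝ)) * invFactDet l m =
      (Matrix.of fun i j => ((l i).descFactorial (m j) : ℝ)).det := by
  rw [invFactDet, ← Matrix.det_mul_column]
  congr 1
  ext i j
  have : ((l i).factorial : ℝ) ≠ 0 := by positivity
  simp only [Matrix.of_apply]
  field_simp

theorem colLen_bot : (⊥ : YoungDiagram).colLen 0 = 0 := by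
  have := colLen_le_card ⊥
  rw [card_bot] at this
  omega

theorem fdim_eq_invFactDet {la : YoungDiagram} {N : ℕ} (hla : la.colLen 0 ≤ N) :
    fdim la = la.card.factorial * invFactDet (shiftRow la N) (shiftRow ⊥ N) := by
  have h2 := descFactorial_mul_chains la.card rfl hla
    (show (⊥ : YoungDiagram).colLen 0 ≤ N by rw [colLen_bot]; exact Nat.zero_le _)
  rwa [card_bot, Nat.sub_zero, Nat.descFactorial_zero, Nat.cast_one, one_mul] at h2

/-- Up to nonzero factorials this determinant is the positive number dim λ. -/
theorem det_descFactorial_ne_zero {la : YoungDiagram} {N : ℕ} (hla : la.colLen 0 ≤ N) :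
    (Matrix.of fun i j =>
      ((shiftRow la N i).descFactorial (shiftRow ⊥ N j) : ℝ)).det ≠ 0 := by
  rw [← prod_factorial_mul_invFactDet]
  refine mul_ne_zero (Finset.prod_ne_zero_iff.2 fun i _ => by positivity) fun h => ?_
  have h1 := fdim_pos la
  rw [fdim_eq_invFactDet hla, h, mul_zero] at h1
  exact lt_irrefl _ h1

/-- The row factorials cancel in the quotient of the formulas for dim(μ,λ) and dim λ, which exhibits
`relDim` as a ratio of falling-factorial alternants, that is, as a shifted Schur function. -/
theorem relDim_mul_det {la μ : YoungDiagram} {N : ℕ} (hla : la.colLen 0 ≤ N)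
    (hμ : μ.colLen 0 ≤ N) :
    relDim μ la *
        (Matrix.of fun i j => ((shiftRow la N i).descFactorial (shiftRow ⊥ N j) : ℝ)).det =
      (Matrix.of fun i j => ((shiftRow la N i).descFactorial (shiftRow μ N j) : ℝ)).det := by
  have h1 := descFactorial_mul_chains la.card rfl hla hμ
  have h2 := fdim_eq_invFactDet hla
  have hpos := fdim_pos la
  rw [← prod_factorial_mul_invFactDet, ← prod_factorial_mul_invFactDet, relDim, h1]
  rw [div_mul_eq_mul_div, div_eq_iff hpos.ne', h2]
  ring

theorem relDim_ne_zero (μ : YoungDiagram) : relDim μ μ ≠ 0 := by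
  rw [relDim, Nat.sub_self, Nat.descFactorial_self, chains, if_pos rfl]
  have := fdim_pos μ
  positivity

/-- Together with `relDim_ne_zero` this is the triangularity behind linear independence. -/
theorem relDim_eq_zero {μ la : YoungDiagram} (h : la.card ≤ μ.card) (hne : la ≠ μ) :
    relDim μ la = 0 := by
  rw [relDim]
  rcases h.lt_or_eq with h1 | h1
  · rw [Nat.descFactorial_of_lt h1]
    simp
  · rw [h1, Nat.sub_self, chains, if_neg hne]
    simp

/-! ### Products of linear and of geometric series -/

open PowerSeries in
/-- The series `1 - a t`. -/
def linSeries (a : ℝ) : PowerSeries ℝ := 1 - C a * X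

open PowerSeries in
/-- The series `1 / (1 - a t)`. -/
def geomSeries (a : ℝ) : PowerSeries ℝ := PowerSeries.mk fun n => a ^ n

open PowerSeries in
theorem coeff_succ_linSeries_mul (a : ℝ) (p : PowerSeries ℝ) (k : ℕ) :
    coeff (k + 1) (linSeries a * p) = coeff (k + 1) p - a * coeff k p := by
  rw [linSeries, sub_mul, one_mul, map_sub, mul_assoc, coeff_C_mul, coeff_succ_X_mul]

open PowerSeries in
theorem linSeries_mul_geomSeries (a : ℝ) : linSeries a * geomSeries a = 1 := by
  ext k
  cases k with
  | zero => simp [linSeries, geomSeries]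
  | succ k =>
    rw [coeff_succ_linSeries_mul, geomSeries, coeff_mk, coeff_mk, coeff_one, if_neg (by omega)]
    ring

open PowerSeries in
theorem constantCoeff_linSeries (a : ℝ) : constantCoeff (linSeries a) = 1 := by
  simp [linSeries]

open PowerSeries in
theorem constantCoeff_geomSeries (a : ℝ) : constantCoeff (geomSeries a) = 1 := by
  rw [geomSeries, ← coeff_zero_eq_constantCoeff_apply, coeff_mk, pow_zero]

open PowerSeries in
theorem coeff_prod_linSeries_eq_zero {ι : Type*} [DecidableEq ι] (S : Finset ι) (f : ι → ℝ)
    (k : ℕ) (hk : S.card < k) : coeff k (∏ i ∈ S, linSeries (f i)) = 0 := by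
  induction S using Finset.induction_on generalizing k with
  | empty =>
    rw [Finset.prod_empty, coeff_one, if_neg]
    simp only [Finset.card_empty] at hk
    omega
  | insert a S ha ih =>
    rw [Finset.card_insert_of_notMem ha] at hk
    obtain ⟨k, rfl⟩ := Nat.exists_eq_succ_of_ne_zero (show k ≠ 0 by omega)
    rw [Finset.prod_insert ha, coeff_succ_linSeries_mul, ih _ (by omega), ih _ (by omega)]
    ring

-- A product of m linear factors has degree at most m, so division by 1 − x t makes the coefficient
-- of order m + 1 equal to x times that of order m; the next factor 1 − y t then contributes x − y.
open PowerSeries in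
theorem coeff_prod_linSeries_mul_geomSeries (y : ℕ → ℝ) (x : ℝ) (m : ℕ) :
    coeff m ((∏ s ∈ Finset.range m, linSeries (y s)) * geomSeries x) =
      ∏ s ∈ Finset.range m, (x - y s) := by
  induction m with
  | zero => simp [geomSeries]
  | succ m ih =>
    set A := ∏ s ∈ Finset.range m, linSeries (y s) with hA
    have h1 : coeff (m + 1) (A * geomSeries x) = x * coeff m (A * geomSeries x) := by
      have h2 : linSeries x * (A * geomSeries x) = A := by
        rw [mul_left_comm, linSeries_mul_geomSeries, mul_one]
      have h3 := coeff_succ_linSeries_mul x (A * geomSeries x) m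
      rw [h2, hA, coeff_prod_linSeries_eq_zero _ _ _ (by simp), ← hA] at h3
      linarith
    rw [Finset.prod_range_succ, ← hA, mul_assoc, mul_left_comm, coeff_succ_linSeries_mul, h1, ih,
      Finset.prod_range_succ]
    ring

theorem cast_descFactorial_eq_prod (l m : ℕ) :
    (l.descFactorial m : ℝ) = ∏ s ∈ Finset.range m, ((l : ℝ) - s) := by
  induction m with
  | zero => simp
  | succ m ih =>
    rw [Nat.descFactorial_succ, Nat.cast_mul, Finset.prod_range_succ, ← ih]
    rcases le_or_gt m l with h | h
    · push_cast [h]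
      ring
    · rw [Nat.descFactorial_of_lt h]
      simp

open PowerSeries in
theorem coeff_mul_eq_sum_range (P G : PowerSeries ℝ) (N : ℕ) (hP : ∀ a, N ≤ a → coeff a P = 0)
    (m : ℕ) : coeff m (P * G) =
      ∑ a ∈ Finset.range N, coeff a P * if a ≤ m then coeff (m - a) G else 0 := by
  have h1 : ∀ K, N ≤ K →
      ∑ a ∈ Finset.range K, coeff a P * (if a ≤ m then coeff (m - a) G else 0) =
      ∑ a ∈ Finset.range N, coeff a P * if a ≤ m then coeff (m - a) G else 0 := by
    intro K hK
    symm
    refine Finset.sum_subset (Finset.range_subset_range.2 hK) fun a _ ha => ?_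
    rw [hP a (by simpa using ha), zero_mul]
  rw [coeff_mul, Finset.Nat.sum_antidiagonal_eq_sum_range_succ
    (fun a b => coeff a P * coeff b G), ← h1 (max N (m + 1)) (le_max_left _ _)]
  rw [← Finset.sum_subset (Finset.range_subset_range.2 (le_max_right N (m + 1)))]
  · refine Finset.sum_congr rfl fun a ha => ?_
    rw [if_pos (by have := Finset.mem_range.1 ha; omega)]
  · intro a _ ha
    rw [if_neg (by simp only [Finset.mem_range] at ha; omega), mul_zero]

/-- The series `(t w)^{b - a} R(w)` in `t = 1 / w`, where `R(w)` is
`(w - 1/2) (w - 3/2) ⋯` with `a - b` factors or `1 / ((w + 1/2) (w + 3/2) ⋯)` with `b - a`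
factors. -/
def shiftSeries (a b : ℕ) : PowerSeries ℝ :=
  (∏ i ∈ Finset.range (a - b), linSeries ((i : ℝ) + 1 / 2)) *
    ∏ i ∈ Finset.range (b - a), geomSeries (-(i : ℝ) - 1 / 2)

open PowerSeries in
theorem constantCoeff_shiftSeries (a b : ℕ) : constantCoeff (shiftSeries a b) = 1 := by
  rw [shiftSeries, map_mul, map_prod, map_prod]
  simp [constantCoeff_linSeries, constantCoeff_geomSeries]

/-- In reverse order the first N nodes are −i − 1/2. If a > b there are a − b extra nodes i + 1/2;
if a < b the last b − a nodes are missing and are divided out. This isolates a correction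
independent of N. -/
theorem prod_linSeries_eq_shiftSeries_mul (a b N : ℕ) (hb : b ≤ N) :
    ∏ s ∈ Finset.range (a + (N - b)), linSeries ((s : ℝ) - N + 1 / 2) =
      shiftSeries a b * ∏ i ∈ Finset.range N, linSeries (-(i : ℝ) - 1 / 2) := by
  have hrefl : ∀ M d : ℕ, M + d = N →
      ∏ s ∈ Finset.range M, linSeries ((s : ℝ) - N + 1 / 2) =
        ∏ i ∈ Finset.range M, linSeries (-((d + i : ℕ) : ℝ) - 1 / 2) := by
    intro M d hM
    rw [← Finset.prod_range_reflect]
    refine Finset.prod_congr rfl fun i hi => ?_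
    have h1 : 1 + i ≤ M := by have := Finset.mem_range.1 hi; omega
    congr 1
    rw [Nat.sub_sub, Nat.cast_sub h1, ← hM]
    push_cast
    ring
  rcases le_or_gt b a with h | h
  · have h1 : a + (N - b) = N + (a - b) := by omega
    have h2 : b - a = 0 := by omega
    rw [h1, Finset.prod_range_add, shiftSeries, h2, Finset.prod_range_zero, mul_one,
      hrefl N 0 (by omega), mul_comm]
    congr 1
    · refine Finset.prod_congr rfl fun i _ => ?_
      congr 1
      push_cast
      ring
    · simp
  · have h1 : a + (N - b) = N - (b - a) := by omega
    have h2 : a - b = 0 := by omega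
    have h3 : N = (b - a) + (N - (b - a)) := by omega
    have h4 : ∏ i ∈ Finset.range N, linSeries (-(i : ℝ) - 1 / 2) =
        (∏ i ∈ Finset.range (b - a), linSeries (-(i : ℝ) - 1 / 2)) *
        ∏ i ∈ Finset.range (N - (b - a)), linSeries (-((b - a + i : ℕ) : ℝ) - 1 / 2) := by
      conv_lhs => rw [h3]
      rw [Finset.prod_range_add]
    rw [h1, hrefl _ (b - a) (by omega), h4, shiftSeries, h2, Finset.prod_range_zero, one_mul,
      ← mul_assoc, ← Finset.prod_mul_distrib]
    simp only [mul_comm (geomSeries _), linSeries_mul_geomSeries, Finset.prod_const_one, one_mul]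

/-- The generating series of the values of the complete symmetric functions at a diagram. -/
def hSeries (la : YoungDiagram) (N : ℕ) : PowerSeries ℝ :=
  ∏ i ∈ Finset.range N,
    (linSeries (-(i : ℝ) - 1 / 2) * geomSeries ((la.rowLen i : ℝ) - i - 1 / 2))

open PowerSeries in
theorem constantCoeff_hSeries (la : YoungDiagram) (N : ℕ) :
    constantCoeff (hSeries la N) = 1 := by
  rw [hSeries, map_prod]
  simp [constantCoeff_linSeries, constantCoeff_geomSeries]

open PowerSeries in
/-- The entries of the matrix in the Jacobi-Trudi formula for `relDim`. -/
def jtEntry (μ la : YoungDiagram) (N : ℕ) (i j : ℕ) : ℝ :=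
  if i ≤ μ.rowLen i + j then
    coeff (μ.rowLen i + j - i) (shiftSeries (μ.rowLen i) (i + 1) * hSeries la N) else 0

theorem jtEntry_of_colLen_le {μ la : YoungDiagram} {N i : ℕ} (hi : μ.colLen 0 ≤ i) (j : ℕ)
    (hj : j ≤ i) : jtEntry μ la N i j = if j = i then 1 else 0 := by
  rw [jtEntry, rowLen_eq_zero.2 hi, zero_add]
  rcases hj.lt_or_eq with h | h
  · rw [if_neg (by omega), if_neg (by omega)]
  · subst h
    rw [if_pos le_rfl, if_pos rfl, Nat.sub_self, PowerSeries.coeff_zero_eq_constantCoeff_apply,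
      map_mul, constantCoeff_shiftSeries, constantCoeff_hSeries, mul_one]

theorem det_of_succ_eq {R : Type*} [CommRing R] (f : ℕ → ℕ → R) (n : ℕ)
    (h0 : ∀ k < n, f n k = 0) (h1 : f n n = 1) :
    (Matrix.of fun i j : Fin (n + 1) => f i j).det = (Matrix.of fun i j : Fin n => f i j).det := by
  rw [Matrix.det_succ_row _ (Fin.last n), Fin.sum_univ_castSucc, Finset.sum_eq_zero]
  · simp only [Matrix.of_apply, Fin.val_last, h1, zero_add, mul_one]
    rw [← two_mul, pow_mul]
    simp only [even_two, Even.neg_pow, one_pow, one_mul]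
    congr 1
    ext i j
    simp
  · intro k _
    simp only [Matrix.of_apply, Fin.val_last, Fin.val_castSucc, h0 k k.2]
    ring

/-- Below the last row of μ the matrix is unitriangular, so its size is immaterial. This brings μ
and the empty diagram to a common size. -/
theorem det_jtEntry_eq (μ la : YoungDiagram) (M n : ℕ) (h : μ.colLen 0 ≤ n) :
    (Matrix.of fun i j : Fin n => jtEntry μ la M i j).det =
      (Matrix.of fun i j : Fin (μ.colLen 0) => jtEntry μ la M i j).det := by
  induction n, h using Nat.le_induction with
  | base => rfl
  | succ n hn ih =>
    rw [det_of_succ_eq _ n, ih]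
    · intro k hk
      rw [jtEntry_of_colLen_le hn k hk.le, if_neg hk.ne]
    · rw [jtEntry_of_colLen_le hn n le_rfl, if_pos rfl]

-- With x_l = λ_l − l − 1/2, the falling factorial is a coefficient of a product of linear factors
-- over 1 − x_i t. Writing 1/(1 − x_i t) as the product of 1 − x_l t over l ≠ i, divided by the
-- product over all l, separates a factor depending on λ and i from a series depending on λ and μ_j,
-- j. The first has degree below N, so the sum is a matrix product.
open PowerSeries in
theorem descFactorial_eq_sum (la μ : YoungDiagram) (N : ℕ) (i j : Fin N) :
    ((shiftRow la N i).descFactorial (shiftRow μ N j) : ℝ) =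
      ∑ k : Fin N, coeff (N - 1 - k) (∏ l ∈ (Finset.range N).erase i,
        linSeries ((la.rowLen l : ℝ) - l - 1 / 2)) * jtEntry μ la N j k := by
  set x : ℕ → ℝ := fun l => (la.rowLen l : ℝ) - l - 1 / 2 with hx
  set P := ∏ l ∈ (Finset.range N).erase i, linSeries (x l) with hP
  set m := shiftRow μ N j with hm
  have hiN : 1 + (i : ℕ) ≤ N := by have := i.2; omega
  have hN1 : m = μ.rowLen j + (N - (j + 1)) := by
    rw [hm, shiftRow]
    omega
  have h1 : ((shiftRow la N i).descFactorial m : ℝ) =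
      coeff m ((∏ s ∈ Finset.range m, linSeries ((s : ℝ) - N + 1 / 2)) * geomSeries (x i)) := by
    rw [coeff_prod_linSeries_mul_geomSeries, cast_descFactorial_eq_prod]
    refine Finset.prod_congr rfl fun s _ => ?_
    rw [hx, shiftRow, Nat.sub_sub]
    push_cast [hiN]
    ring
  have h2 : geomSeries (x i) = P * ∏ l ∈ Finset.range N, geomSeries (x l) := by
    rw [← Finset.mul_prod_erase _ _ (Finset.mem_range.2 i.2), mul_left_comm, hP,
      ← Finset.prod_mul_distrib]
    simp only [linSeries_mul_geomSeries, Finset.prod_const_one, mul_one]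
  have h3 : (∏ s ∈ Finset.range m, linSeries ((s : ℝ) - N + 1 / 2)) * geomSeries (x i) =
      P * (shiftSeries (μ.rowLen j) (j + 1) * hSeries la N) := by
    rw [hN1, prod_linSeries_eq_shiftSeries_mul _ _ _ j.2, h2, hSeries, Finset.prod_mul_distrib]
    ring
  rw [h1, h3, coeff_mul_eq_sum_range _ _ N, ← Finset.sum_range_reflect,
    ← Fin.sum_univ_eq_sum_range (fun k => coeff (N - 1 - k) P *
      if N - 1 - k ≤ m then
        coeff (m - (N - 1 - k)) (shiftSeries (μ.rowLen j) (j + 1) * hSeries la N) else 0)]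
  · refine Finset.sum_congr rfl fun k _ => ?_
    have hk := k.2
    have hj := j.2
    rw [jtEntry]
    congr 1
    have h4 : N - 1 - (k : ℕ) ≤ m ↔ (j : ℕ) ≤ μ.rowLen j + k := by omega
    simp only [h4]
    split_ifs with h5
    · congr 2
      omega
    · rfl
  · intro a ha
    refine coeff_prod_linSeries_eq_zero _ _ _ ?_
    rw [Finset.card_erase_of_mem (Finset.mem_range.2 i.2), Finset.card_range]
    omega

/-- The Jacobi-Trudi formula for the relative dimension. -/
theorem relDim_eq_det (μ la : YoungDiagram) (N : ℕ) (hla : la.colLen 0 ≤ N)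
    (hμ : μ.colLen 0 ≤ N) :
    relDim μ la = (Matrix.of fun i j : Fin (μ.colLen 0) => jtEntry μ la N i j).det := by
  -- E does not involve μ, so its determinant cancels in the ratio of the alternants of μ and of the
  -- empty diagram.
  set E : Matrix (Fin N) (Fin N) ℝ := Matrix.of fun i k =>
    PowerSeries.coeff (N - 1 - k) (∏ l ∈ (Finset.range N).erase i,
        linSeries ((la.rowLen l : ℝ) - l - 1 / 2)) with hE
  have h1 : ∀ ν : YoungDiagram, ν.colLen 0 ≤ N →
      (Matrix.of fun i j => ((shiftRow la N i).descFactorial (shiftRow ν N j) : ℝ)).det =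
        E.det * (Matrix.of fun i j : Fin (ν.colLen 0) => jtEntry ν la N i j).det := by
    intro ν hν
    rw [← det_jtEntry_eq ν la N N hν, ← Matrix.det_transpose (Matrix.of fun i j : Fin N => jtEntry ν la N i j),
      ← Matrix.det_mul]
    congr 1
    ext i j
    rw [Matrix.of_apply, descFactorial_eq_sum, Matrix.mul_apply]
    rfl
  have h0 : (⊥ : YoungDiagram).colLen 0 ≤ N := by rw [colLen_bot]; exact Nat.zero_le _
  have h2 := h1 ⊥ h0
  have h3 : (Matrix.of fun i j : Fin ((⊥ : YoungDiagram).colLen 0) => jtEntry ⊥ la N i j).det =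
      1 := by
    have : IsEmpty (Fin ((⊥ : YoungDiagram).colLen 0)) := by
      rw [colLen_bot]
      infer_instance
    exact Matrix.det_isEmpty
  rw [h3, mul_one] at h2
  have h4 := det_descFactorial_ne_zero hla
  have h5 := relDim_mul_det hla hμ
  rw [h1 μ hμ, h2, mul_comm] at h5
  rw [h2] at h4
  exact mul_left_cancel₀ h4 h5

/-! ### Power sums of the Frobenius coordinates -/

open PowerSeries in
theorem derivative_linSeries_mul_geomSeries (x y : ℝ) :
    d⁄dX ℝ (linSeries y * geomSeries x) =
      linSeries y * geomSeries x * PowerSeries.mk fun k => x ^ (k + 1) - y ^ (k + 1) := by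
  have hd : ∀ a, d⁄dX ℝ (linSeries a) = -C a := by
    intro a
    rw [linSeries, map_sub, Derivation.leibniz, derivative_X, derivative_C, Derivation.map_one_eq_zero]
    simp
  have h1 : (PowerSeries.mk fun k => x ^ (k + 1) - y ^ (k + 1)) =
      C x * geomSeries x - C y * geomSeries y := by
    ext k
    rw [map_sub, coeff_C_mul, coeff_C_mul, geomSeries, geomSeries, coeff_mk, coeff_mk, coeff_mk]
    ring
  have h2 : d⁄dX ℝ (geomSeries x) = C x * geomSeries x * geomSeries x := by
    have h3 := congrArg (d⁄dX ℝ) (linSeries_mul_geomSeries x)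
    rw [Derivation.leibniz, hd, Derivation.map_one_eq_zero] at h3
    simp only [smul_eq_mul] at h3
    have h4 := linSeries_mul_geomSeries x
    linear_combination geomSeries x * h3 - (d⁄dX ℝ (geomSeries x)) * h4
  rw [h1, Derivation.leibniz, hd, h2]
  simp only [smul_eq_mul]
  have h5 := linSeries_mul_geomSeries y
  linear_combination (geomSeries x * C y) * h5

/-- The power sums of the modified Frobenius coordinates of a diagram. -/
def frobSum (la : YoungDiagram) (N k : ℕ) : ℝ :=
  ∑ i ∈ Finset.range N, (((la.rowLen i : ℝ) - i - 1 / 2) ^ k - (-(i : ℝ) - 1 / 2) ^ k)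

-- Each factor has logarithmic derivative Σ (x^{k+1} − y^{k+1}) t^k, and these add up to the power
-- sums.
open PowerSeries in
theorem derivative_hSeries (la : YoungDiagram) (N : ℕ) :
    d⁄dX ℝ (hSeries la N) = hSeries la N * PowerSeries.mk fun k => frobSum la N (k + 1) := by
  induction N with
  | zero =>
    have : (PowerSeries.mk fun k => frobSum la 0 (k + 1)) = 0 := by
      ext k
      simp [frobSum]
    rw [this, hSeries, Finset.prod_range_zero, mul_zero, Derivation.map_one_eq_zero]
  | succ N ih =>
    have h1 : hSeries la (N + 1) = hSeries la N *
        (linSeries (-(N : ℝ) - 1 / 2) * geomSeries ((la.rowLen N : ℝ) - N - 1 / 2)) := by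
      rw [hSeries, Finset.prod_range_succ, hSeries]
    have h2 : (PowerSeries.mk fun k => frobSum la (N + 1) (k + 1)) =
        (PowerSeries.mk fun k => frobSum la N (k + 1)) + PowerSeries.mk fun k =>
          ((la.rowLen N : ℝ) - N - 1 / 2) ^ (k + 1) - (-(N : ℝ) - 1 / 2) ^ (k + 1) := by
      ext k
      simp only [frobSum, map_add, coeff_mk, Finset.sum_range_succ]
    rw [h1, Derivation.leibniz, derivative_linSeries_mul_geomSeries, ih, h2]
    simp only [smul_eq_mul]
    ring

-- This is Newton's identity, the recursion that defines `hsym`.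
open PowerSeries in
theorem succ_mul_coeff_hSeries (la : YoungDiagram) (N n : ℕ) :
    ((n : ℝ) + 1) * coeff (n + 1) (hSeries la N) =
      ∑ k : Fin (n + 1), frobSum la N (k + 1) * coeff (n - k) (hSeries la N) := by
  have h := congrArg (coeff n) (derivative_hSeries la N)
  rw [coeff_derivative, mul_comm (hSeries la N), coeff_mul,
    Finset.Nat.sum_antidiagonal_eq_sum_range_succ (fun a b => coeff a _ * coeff b _)] at h
  rw [mul_comm, h, ← Fin.sum_univ_eq_sum_range (fun k =>
    coeff k (PowerSeries.mk fun k => frobSum la N (k + 1)) * coeff (n - k) (hSeries la N))]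
  simp only [coeff_mk]

/-- A morphism given on the power sums by `frobSum` is given on the complete symmetric functions
by `hSeries`. -/
theorem map_hsym (la : YoungDiagram) (N : ℕ) (s : ℝ) (e : Sym →ₐ[ℝ] ℝ)
    (he : ∀ k : ℕ+, e (psum k) = s ^ (k : ℕ) * frobSum la N k) (n : ℕ) :
    e (hsym n) = s ^ n * PowerSeries.coeff n (hSeries la N) := by
  induction n using Nat.strong_induction_on with
  | _ n ih =>
    cases n with
    | zero =>
      rw [hsym, map_one, PowerSeries.coeff_zero_eq_constantCoeff_apply, constantCoeff_hSeries]
      simp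
    | succ n =>
      rw [hsym, map_smul, map_sum]
      have h1 : ∀ k : Fin (n + 1), e (psum ⟨k.1 + 1, Nat.succ_pos _⟩ * hsym (n - k.1)) =
          s ^ (n + 1) * (frobSum la N (k + 1) * PowerSeries.coeff (n - k) (hSeries la N)) := by
        intro k
        have hk := k.2
        rw [map_mul]
        refine (congrArg₂ (· * ·) (he ⟨k.1 + 1, Nat.succ_pos _⟩) (ih _ (by omega))).trans ?_
        change s ^ (k.1 + 1) * frobSum la N (k + 1) *
          (s ^ (n - k.1) * PowerSeries.coeff (n - k.1) (hSeries la N)) = _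
        have h2 : s ^ (n + 1) = s ^ (k.1 + 1) * s ^ (n - k.1) := by
          rw [← pow_add]
          congr 1
          omega
        rw [h2]
        ring
      rw [Finset.sum_congr rfl fun k _ => h1 k, ← Finset.mul_sum, ← succ_mul_coeff_hSeries,
        smul_eq_mul]
      have : (n : ℝ) + 1 ≠ 0 := by positivity
      field_simp

/-- Contents increase by 1 along a row, so each row telescopes. -/
theorem sum_cells_content (la : YoungDiagram) {N : ℕ} (hN : la.colLen 0 ≤ N) (g : ℝ → ℝ) :
    ∑ c ∈ la.cells, (g ((c.2 : ℝ) - c.1 + 1 / 2) - g ((c.2 : ℝ) - c.1 - 1 / 2)) =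
      ∑ i ∈ Finset.range N, (g ((la.rowLen i : ℝ) - i - 1 / 2) - g (-(i : ℝ) - 1 / 2)) := by
  rw [sum_cells la hN]
  refine Finset.sum_congr rfl fun i _ => ?_
  have h := Finset.sum_range_sub (fun j : ℕ => g ((j : ℝ) - i - 1 / 2)) (la.rowLen i)
  simp only [Nat.cast_zero, zero_sub] at h
  rw [← h]
  refine Finset.sum_congr rfl fun j _ => ?_
  congr 2
  push_cast
  ring

theorem filter_min_eq (la : YoungDiagram) (r : ℕ) :
    la.cells.filter (fun c => min c.1 c.2 = r) =
      ({r} ×ˢ Finset.Ico r (la.rowLen r)) ∪ (Finset.Ico (r + 1) (la.colLen r) ×ˢ {r}) := by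
  ext ⟨a, b⟩
  simp only [Finset.mem_filter, Finset.mem_union, Finset.mem_product, Finset.mem_singleton,
    Finset.mem_Ico, YoungDiagram.mem_cells]
  constructor
  · rintro ⟨h1, h2⟩
    have h3 := YoungDiagram.mem_iff_lt_rowLen.1 h1
    have h4 := YoungDiagram.mem_iff_lt_colLen.1 h1
    rcases le_or_gt a b with h | h
    · have : a = r := by omega
      subst this
      exact Or.inl ⟨rfl, h, h3⟩
    · have : b = r := by omega
      subst this
      exact Or.inr ⟨⟨h, h4⟩, rfl⟩
  · rintro (⟨rfl, h1, h2⟩ | ⟨⟨h1, h2⟩, rfl⟩)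
    · exact ⟨YoungDiagram.mem_iff_lt_rowLen.2 h2, by omega⟩
    · exact ⟨YoungDiagram.mem_iff_lt_colLen.2 h2, by omega⟩

/-- The contents in a diagonal hook are consecutive integers, so the sum telescopes from the foot of
the hook to the end of its arm. -/
theorem sum_hook_content (la : YoungDiagram) (r : ℕ) (g : ℝ → ℝ) :
    ∑ c ∈ la.cells.filter (fun c => min c.1 c.2 = r),
        (g ((c.2 : ℝ) - c.1 + 1 / 2) - g ((c.2 : ℝ) - c.1 - 1 / 2)) =
      g (frobA la r) - g (-frobB la r) := by
  have hdisj : Disjoint ({r} ×ˢ Finset.Ico r (la.rowLen r))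
      (Finset.Ico (r + 1) (la.colLen r) ×ˢ {r}) := by
    rw [Finset.disjoint_left]
    rintro ⟨a, b⟩ h1 h2
    simp only [Finset.mem_product, Finset.mem_singleton, Finset.mem_Ico] at h1 h2
    omega
  rw [filter_min_eq, Finset.sum_union hdisj, Finset.sum_product, Finset.sum_product,
    Finset.sum_singleton]
  simp only [Finset.sum_singleton]
  by_cases h : (r, r) ∈ la
  · have hr : r ≤ la.rowLen r := (YoungDiagram.mem_iff_lt_rowLen.1 h).le
    have hc : r + 1 ≤ la.colLen r := YoungDiagram.mem_iff_lt_colLen.1 h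
    rw [Finset.sum_Ico_eq_sum_range, Finset.sum_Ico_eq_sum_range]
    have h1 := Finset.sum_range_sub (fun j : ℕ => g ((j : ℝ) - 1 / 2)) (la.rowLen r - r)
    have h2 := Finset.sum_range_sub (fun j : ℕ => - g (-(j : ℝ) - 1 / 2)) (la.colLen r - (r + 1))
    have h3 : ∑ k ∈ Finset.range (la.rowLen r - r),
        (g (((r + k : ℕ) : ℝ) - r + 1 / 2) - g (((r + k : ℕ) : ℝ) - r - 1 / 2)) =
        g (frobA la r) - g (-1 / 2) := by
      have e : frobA la r = ((la.rowLen r - r : ℕ) : ℝ) - 1 / 2 := by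
        rw [frobA, if_pos h]
        push_cast [hr]
        ring
      rw [e]
      convert h1 using 1
      · refine Finset.sum_congr rfl fun k _ => ?_
        congr 2 <;> push_cast <;> ring
      · congr 2
        norm_num
    have h4 : ∑ k ∈ Finset.range (la.colLen r - (r + 1)),
        (g ((r : ℝ) - ((r + 1 + k : ℕ) : ℝ) + 1 / 2) -
          g ((r : ℝ) - ((r + 1 + k : ℕ) : ℝ) - 1 / 2)) =
        g (-1 / 2) - g (-frobB la r) := by
      have e : -frobB la r = -((la.colLen r - (r + 1) : ℕ) : ℝ) - 1 / 2 := by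
        rw [frobB, if_pos h]
        push_cast [hc]
        ring
      rw [e]
      convert h2 using 1
      · refine Finset.sum_congr rfl fun k _ => ?_
        rw [neg_sub_neg]
        congr 2 <;> push_cast <;> ring
      · rw [neg_sub_neg]
        congr 2
        norm_num
    rw [h3, h4]
    ring
  · have hr : la.rowLen r ≤ r := by
      by_contra! h1
      exact h (YoungDiagram.mem_iff_lt_rowLen.2 h1)
    have hc : la.colLen r ≤ r + 1 := by
      by_contra! h1
      exact h (YoungDiagram.mem_iff_lt_colLen.2 (by omega))
    rw [Finset.Ico_eq_empty_of_le hr, Finset.Ico_eq_empty_of_le hc, frobA, frobB, if_neg h,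
      if_neg h]
    simp

/-- Both sides are the same content sum, grouped by diagonal hooks and by rows. For g a power it
converts Frobenius coordinates into shifted row lengths. -/
theorem sum_frob_eq (la : YoungDiagram) {N : ℕ} (hN : la.colLen 0 ≤ N) (g : ℝ → ℝ) :
    ∑ i ∈ Finset.range N, (g (frobA la i) - g (-frobB la i)) =
      ∑ i ∈ Finset.range N, (g ((la.rowLen i : ℝ) - i - 1 / 2) - g (-(i : ℝ) - 1 / 2)) := by
  rw [← sum_cells_content la hN, ← Finset.sum_fiberwise_of_maps_to
    (s := la.cells) (t := Finset.range N) (g := fun c => min c.1 c.2)]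
  · exact Finset.sum_congr rfl fun r _ => (sum_hook_content la r g).symm
  · rintro ⟨a, b⟩ h
    have h1 : (a, 0) ∈ la := la.up_left_mem le_rfl (Nat.zero_le _) h
    have h2 := YoungDiagram.mem_iff_lt_colLen.1 h1
    simp only [Finset.mem_range]
    omega

theorem psumFun_iota (n : ℕ) (hn : n ≠ 0) (la : Y n) {N : ℕ} (hN : la.1.colLen 0 ≤ N) (k : ℕ+) :
    psumFun k (iota n la) = (1 / (n : ℝ)) ^ (k : ℕ) * frobSum la.1 N k := by
  have hn' : (n : ℝ) ≠ 0 := by exact_mod_cast hn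
  by_cases hk : k = 1
  · subst hk
    -- For k = 1 the function on Ω is 1 by definition; it agrees with the power sum on `Y n` because
    -- the content sum with g = id counts the boxes.
    have h1 : frobSum la.1 N ((1 : ℕ+) : ℕ) = n := by
      have h2 := sum_cells_content la.1 hN id
      simp only [id] at h2
      simp only [frobSum, PNat.one_coe, pow_one]
      rw [← h2, Finset.sum_congr rfl fun c _ => show
        (c.2 : ℝ) - c.1 + 1 / 2 - ((c.2 : ℝ) - c.1 - 1 / 2) = 1 by ring]
      rw [Finset.sum_const, nsmul_eq_mul, mul_one]
      exact_mod_cast la.2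
    rw [h1]
    simp [psumFun, hn']
  · have hnm : ∀ i, i ∉ Finset.range N → (i, i) ∉ la.1 := by
      intro i hi h
      have h1 : (i, 0) ∈ la.1 := la.1.up_left_mem le_rfl (Nat.zero_le _) h
      have h2 := YoungDiagram.mem_iff_lt_colLen.1 h1
      simp only [Finset.mem_range] at hi
      omega
    have hk0 : (k : ℕ) ≠ 0 := k.ne_zero
    have hk1 : (-1 : ℝ) ^ (k : ℕ) = -(-1) ^ ((k : ℕ) - 1) := by
      obtain ⟨j, hj⟩ := Nat.exists_eq_succ_of_ne_zero hk0
      rw [hj, Nat.succ_eq_add_one, Nat.add_sub_cancel, pow_succ]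
      ring
    change (if k = 1 then (1 : ℝ) else
      ∑' i, (frobA la.1 i / n) ^ (k : ℕ) +
        (-1) ^ ((k : ℕ) - 1) * ∑' i, (frobB la.1 i / n) ^ (k : ℕ)) = _
    rw [if_neg hk, tsum_eq_sum (s := Finset.range N), tsum_eq_sum (s := Finset.range N), frobSum,
      ← sum_frob_eq la.1 hN fun x => x ^ (k : ℕ), Finset.mul_sum, Finset.mul_sum,
      ← Finset.sum_add_distrib]
    · refine Finset.sum_congr rfl fun i _ => ?_
      rw [neg_pow (frobB la.1 i), hk1, div_pow, div_pow, div_pow, one_pow]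
      ring
    · intro i hi
      rw [frobB, if_neg (hnm i hi), zero_div, zero_pow hk0]
    · intro i hi
      rw [frobA, if_neg (hnm i hi), zero_div, zero_pow hk0]

/-! ### Deformations of Schur functions -/

/-- The weight of a monomial in the power sums. -/
abbrev wt (d : ℕ+ →₀ ℕ) : ℕ := Finsupp.weight (fun k : ℕ+ => (k : ℕ)) d

/-- A polynomial over the algebra of symmetric functions is homogeneous of degree `m`, its
variable having degree `1`. -/
def IsBihomogeneous (W : Polynomial Sym) (m : ℕ) : Prop :=
  ∀ i d, MvPolynomial.coeff d (W.coeff i) ≠ 0 → wt d + i = m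

theorem IsBihomogeneous.zero (m : ℕ) : IsBihomogeneous 0 m := by
  intro i d h
  simp at h

theorem IsBihomogeneous.one : IsBihomogeneous 1 0 := by
  classical
  intro i d h
  rw [Polynomial.coeff_one] at h
  split_ifs at h with h1
  · rw [MvPolynomial.coeff_one] at h
    have hd : d = 0 := by
      by_contra hne
      exact h (if_neg fun e => hne e.symm)
    rw [hd, h1, wt, map_zero]
  · simp at h

theorem IsBihomogeneous.mul {W V : Polynomial Sym} {m k : ℕ} (hW : IsBihomogeneous W m)
    (hV : IsBihomogeneous V k) : IsBihomogeneous (W * V) (m + k) := by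
  classical
  intro i d h
  rw [Polynomial.coeff_mul, MvPolynomial.coeff_sum] at h
  obtain ⟨p, hp, h1⟩ := Finset.exists_ne_zero_of_sum_ne_zero h
  rw [MvPolynomial.coeff_mul] at h1
  obtain ⟨q, hq, h2⟩ := Finset.exists_ne_zero_of_sum_ne_zero h1
  have h3 := hW p.1 q.1 (left_ne_zero_of_mul h2)
  have h4 := hV p.2 q.2 (right_ne_zero_of_mul h2)
  rw [← (Finset.HasAntidiagonal.mem_antidiagonal.1 hq), ← (Finset.HasAntidiagonal.mem_antidiagonal.1 hp), wt, map_add]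
  simp only [wt] at h3 h4
  omega

theorem IsBihomogeneous.sum {ι : Type*} (S : Finset ι) (W : ι → Polynomial Sym) (m : ℕ)
    (h : ∀ i ∈ S, IsBihomogeneous (W i) m) : IsBihomogeneous (∑ i ∈ S, W i) m := by
  intro i d hd
  rw [Polynomial.finsetSum_coeff, MvPolynomial.coeff_sum] at hd
  obtain ⟨p, hp, h1⟩ := Finset.exists_ne_zero_of_sum_ne_zero hd
  exact h p hp i d h1

theorem IsBihomogeneous.prod {ι : Type*} (S : Finset ι) (W : ι → Polynomial Sym) (m : ι → ℕ)
    (h : ∀ i ∈ S, IsBihomogeneous (W i) (m i)) :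
    IsBihomogeneous (∏ i ∈ S, W i) (∑ i ∈ S, m i) := by
  classical
  induction S using Finset.induction_on with
  | empty => simpa using IsBihomogeneous.one
  | insert a S ha ih =>
    rw [Finset.prod_insert ha, Finset.sum_insert ha]
    exact (h a (Finset.mem_insert_self a S)).mul
      (ih fun i hi => h i (Finset.mem_insert_of_mem hi))

theorem IsBihomogeneous.units_smul {W : Polynomial Sym} {m : ℕ} (h : IsBihomogeneous W m)
    (u : ℤˣ) : IsBihomogeneous (u • W) m := by
  rcases Int.units_eq_one_or u with rfl | rfl
  · simpa using h
  · intro i d hd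
    refine h i d fun h0 => hd ?_
    simp [h0]

theorem hsym_isWeightedHomogeneous (n : ℕ) :
    MvPolynomial.IsWeightedHomogeneous (fun k : ℕ+ => (k : ℕ)) (hsym n) n := by
  induction n using Nat.strong_induction_on with
  | _ n ih =>
    cases n with
    | zero =>
      rw [hsym]
      exact MvPolynomial.isWeightedHomogeneous_one ℝ _
    | succ n =>
      rw [hsym, ← MvPolynomial.C_mul']
      refine MvPolynomial.IsWeightedHomogeneous.C_mul ?_ _
      refine MvPolynomial.IsWeightedHomogeneous.sum _ _ _ fun k _ => ?_
      have hk := k.2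
      have h1 := (MvPolynomial.isWeightedHomogeneous_X ℝ (fun k : ℕ+ => (k : ℕ))
        ⟨k.1 + 1, Nat.succ_pos _⟩).mul (ih (n - k.1) (by omega))
      have h2 : k.1 + 1 + (n - k.1) = n + 1 := by omega
      exact (congrArg (MvPolynomial.IsWeightedHomogeneous _ _) h2).mp h1

/-- The entries of the matrix defining `schurPoly`. -/
def schurPolyEntry (μ : YoungDiagram) (i j : ℕ) : Polynomial Sym :=
  if i ≤ μ.rowLen i + j then
    ∑ p ∈ Finset.HasAntidiagonal.antidiagonal (μ.rowLen i + j - i),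
      Polynomial.monomial p.1
        (PowerSeries.coeff p.1 (shiftSeries (μ.rowLen i) (i + 1)) • hsym p.2)
  else 0

/-- A one-parameter deformation of the Schur function `s_μ`. Its value at the parameter `1` is the
Frobenius-Schur function. -/
def schurPoly (μ : YoungDiagram) : Polynomial Sym :=
  Matrix.det (Matrix.of fun i j : Fin (μ.colLen 0) => schurPolyEntry μ i j)

theorem schurPolyEntry_isBihomogeneous (μ : YoungDiagram) (i j : ℕ) :
    IsBihomogeneous (schurPolyEntry μ i j) (μ.rowLen i + j - i) := by
  rw [schurPolyEntry]
  split_ifs with h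
  · refine IsBihomogeneous.sum _ _ _ fun p hp => ?_
    intro k d hd
    rw [Polynomial.coeff_monomial] at hd
    split_ifs at hd with h1
    · rw [MvPolynomial.coeff_smul] at hd
      have h2 := hsym_isWeightedHomogeneous p.2 (right_ne_zero_of_mul hd)
      have h3 := Finset.HasAntidiagonal.mem_antidiagonal.1 hp
      simp only [wt]
      omega
    · simp at hd
  · exact IsBihomogeneous.zero _

/-- In a Leibniz term the degrees μ_{σ i} + i − σ i add up to |μ|; whenever one of these
subtractions would be truncated, that entry is 0. -/
theorem schurPoly_isBihomogeneous (μ : YoungDiagram) :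
    IsBihomogeneous (schurPoly μ) μ.card := by
  rw [schurPoly, Matrix.det_apply]
  refine IsBihomogeneous.sum _ _ _ fun σ _ => IsBihomogeneous.units_smul ?_ _
  by_cases h : ∀ i : Fin (μ.colLen 0), (σ i : ℕ) ≤ μ.rowLen (σ i) + i
  · have h1 : μ.card = ∑ i : Fin (μ.colLen 0), (μ.rowLen (σ i) + i - σ i) := by
      have h2 : ∑ i : Fin (μ.colLen 0), (μ.rowLen (σ i) + i - σ i) +
          ∑ i : Fin (μ.colLen 0), (σ i : ℕ) =
          ∑ i : Fin (μ.colLen 0), μ.rowLen (σ i) + ∑ i : Fin (μ.colLen 0), (i : ℕ) := by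
        rw [← Finset.sum_add_distrib, ← Finset.sum_add_distrib]
        exact Finset.sum_congr rfl fun i _ => Nat.sub_add_cancel (h i)
      rw [Equiv.sum_comp σ fun i => (i : ℕ), Equiv.sum_comp σ fun i => μ.rowLen (i : ℕ),
        Fin.sum_univ_eq_sum_range μ.rowLen, ← card_eq_sum_rowLen μ le_rfl] at h2
      omega
    rw [h1]
    exact IsBihomogeneous.prod _ _ _ fun i _ => schurPolyEntry_isBihomogeneous μ _ _
  · push Not at h
    obtain ⟨i, hi⟩ := h
    rw [Finset.prod_eq_zero (Finset.mem_univ i)]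
    · exact IsBihomogeneous.zero _
    · rw [Matrix.of_apply, schurPolyEntry, if_neg (by omega)]

theorem coeff_zero_schurPoly (μ : YoungDiagram) : (schurPoly μ).coeff 0 = schur μ := by
  rw [← Polynomial.constantCoeff_apply, schurPoly, RingHom.map_det, schur]
  congr 1
  ext1 i j
  rw [RingHom.mapMatrix_apply, Matrix.map_apply, Matrix.of_apply, Matrix.of_apply,
    schurPolyEntry]
  split_ifs with h
  · rw [Polynomial.constantCoeff_apply, Polynomial.finsetSum_coeff,
      Finset.sum_eq_single (0, μ.rowLen i + j - i)]
    · rw [Polynomial.coeff_monomial_same, PowerSeries.coeff_zero_eq_constantCoeff_apply,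
        constantCoeff_shiftSeries, one_smul]
    · intro p hp hne
      rw [Polynomial.coeff_monomial, if_neg]
      intro h0
      apply hne
      have := Finset.HasAntidiagonal.mem_antidiagonal.1 hp
      ext
      · exact h0
      · simp only
        omega
    · intro hn
      exact absurd (Finset.HasAntidiagonal.mem_antidiagonal.2 (zero_add _)) hn
  · simp

/-- Power sums of the Frobenius coordinates, with all rows taken into account. -/
theorem frobSum_eq (la : YoungDiagram) {N : ℕ} (hN : la.colLen 0 ≤ N) (k : ℕ) :
    frobSum la N k = frobSum la (la.colLen 0) k := by
  rw [frobSum, frobSum]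
  symm
  refine Finset.sum_subset (Finset.range_subset_range.2 hN) fun i _ hi => ?_
  rw [rowLen_eq_zero.2 (by simpa using hi)]
  simp

theorem map_schurPoly (μ la : YoungDiagram) (s : ℝ) (e : Sym →ₐ[ℝ] ℝ)
    (he : ∀ k : ℕ+, e (psum k) = s ^ (k : ℕ) * frobSum la (la.colLen 0) k) (hs : s ≠ 0) :
    e ((schurPoly μ).eval (MvPolynomial.C s)) = s ^ μ.card * relDim μ la := by
  set N := max (la.colLen 0) (μ.colLen 0) with hN
  have hla : la.colLen 0 ≤ N := le_max_left _ _
  have hμ : μ.colLen 0 ≤ N := le_max_right _ _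
  have he' : ∀ k : ℕ+, e (psum k) = s ^ (k : ℕ) * frobSum la N k := by
    intro k
    rw [he, frobSum_eq la hla]
  have heC : e (MvPolynomial.C s) = s := e.commutes s
  have h1 : e ((schurPoly μ).eval (MvPolynomial.C s)) =
      (Matrix.of fun i j : Fin (μ.colLen 0) =>
        s ^ (μ.rowLen i + j - i) * jtEntry μ la N i j).det := by
    have h2 : e ((schurPoly μ).eval (MvPolynomial.C s)) =
        ((e : Sym →+* ℝ).comp (Polynomial.evalRingHom (MvPolynomial.C s))) (schurPoly μ) := rfl
    rw [h2, schurPoly, RingHom.map_det]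
    congr 1
    ext1 i j
    rw [RingHom.mapMatrix_apply, Matrix.map_apply, Matrix.of_apply, Matrix.of_apply,
      schurPolyEntry, jtEntry]
    split_ifs with h
    · rw [map_sum, PowerSeries.coeff_mul, Finset.mul_sum]
      refine Finset.sum_congr rfl fun p hp => ?_
      rw [RingHom.comp_apply, Polynomial.coe_evalRingHom, Polynomial.eval_monomial]
      change e _ = _
      rw [map_mul, map_pow, heC, map_smul, map_hsym la N s e he', smul_eq_mul,
        ← Finset.HasAntidiagonal.mem_antidiagonal.1 hp, pow_add]
      ring
    · rw [map_zero, mul_zero]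
  -- The powers of s come out of rows and columns; multiplying by s^i beforehand avoids the negative
  -- exponent −i.
  have h3 : (∏ i : Fin (μ.colLen 0), s ^ (i : ℕ)) * e ((schurPoly μ).eval (MvPolynomial.C s)) =
      (∏ i : Fin (μ.colLen 0), s ^ (i : ℕ)) * (s ^ μ.card * relDim μ la) := by
    rw [h1, relDim_eq_det μ la N hla hμ, ← Matrix.det_mul_column,
      card_eq_sum_rowLen μ le_rfl, ← Fin.sum_univ_eq_sum_range, ← Finset.prod_pow_eq_pow_sum,
      ← Matrix.det_mul_column, ← Matrix.det_mul_row]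
    congr 1
    ext1 i j
    simp only [Matrix.of_apply]
    by_cases h : (i : ℕ) ≤ μ.rowLen i + j
    · have h4 : s ^ (i : ℕ) * s ^ (μ.rowLen i + j - i) = s ^ (j : ℕ) * s ^ (μ.rowLen i) := by
        rw [← pow_add, ← pow_add]
        congr 1
        omega
      rw [← mul_assoc, ← mul_assoc, h4]
    · rw [jtEntry, if_neg h]
      ring
  refine mul_left_cancel₀ ?_ h3
  exact Finset.prod_ne_zero_iff.2 fun i _ => pow_ne_zero _ hs

/-- The evaluation of symmetric functions at the Frobenius coordinates of a diagram. -/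
def evalFrob (la : YoungDiagram) : Sym →ₐ[ℝ] ℝ :=
  MvPolynomial.aeval fun k : ℕ+ => frobSum la (la.colLen 0) k

theorem evalFrob_schurPoly (μ la : YoungDiagram) :
    evalFrob la ((schurPoly μ).eval 1) = relDim μ la := by
  have h := map_schurPoly μ la 1 (evalFrob la) (fun k => by
    rw [evalFrob, psum, MvPolynomial.aeval_X, one_pow, one_mul]) one_ne_zero
  rwa [one_pow, one_mul, MvPolynomial.C_1] at h

/-! ### The filtration -/

theorem mem_symFilt {f : Sym} {m : ℕ} :
    f ∈ symFilt m ↔ ∀ d, MvPolynomial.coeff d f ≠ 0 → wt d ≤ m := by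
  rw [symFilt, MvPolynomial.mem_restrictSupport_iff]
  constructor
  · intro h d hd
    exact h (MvPolynomial.mem_support_iff.2 hd)
  · intro h d hd
    exact h d (MvPolynomial.mem_support_iff.1 hd)

theorem coeff_schurPoly_mem (μ : YoungDiagram) (i : ℕ) :
    (schurPoly μ).coeff i ∈ symFilt (μ.card - i) := by
  rw [mem_symFilt]
  intro d hd
  have := schurPoly_isBihomogeneous μ i d hd
  omega

theorem coeff_schurPoly_eq_zero (μ : YoungDiagram) (i : ℕ) (hi : μ.card < i) :
    (schurPoly μ).coeff i = 0 := by
  ext d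
  by_contra h
  have := schurPoly_isBihomogeneous μ i d h
  omega

theorem eval_schurPoly (μ : YoungDiagram) (s : ℝ) :
    (schurPoly μ).eval (MvPolynomial.C s) =
      ∑ i ∈ Finset.range (μ.card + 1), s ^ i • (schurPoly μ).coeff i := by
  rw [Polynomial.eval_eq_sum_range' (n := μ.card + 1)]
  · refine Finset.sum_congr rfl fun i _ => ?_
    rw [← map_pow, mul_comm, MvPolynomial.C_mul']
  · refine Nat.lt_succ_of_le (Polynomial.natDegree_le_iff_coeff_eq_zero.2 fun i hi => ?_)
    exact coeff_schurPoly_eq_zero μ i (by exact_mod_cast hi)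

theorem symFilt_mono {m k : ℕ} (h : m ≤ k) : symFilt m ≤ symFilt k := by
  intro f hf
  rw [mem_symFilt] at hf ⊢
  exact fun d hd => (hf d hd).trans h

theorem eval_schurPoly_mem (μ : YoungDiagram) (s : ℝ) :
    (schurPoly μ).eval (MvPolynomial.C s) ∈ symFilt μ.card := by
  rw [eval_schurPoly]
  exact Submodule.sum_mem _ fun i _ => Submodule.smul_mem _ _
    (symFilt_mono (Nat.sub_le _ _) (coeff_schurPoly_mem μ i))

/-- The finite set of diagrams with at most `m` boxes. -/
abbrev YLe (m : ℕ) : Type := {μ : YoungDiagram // μ.card ≤ m}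

instance finite_YLe (m : ℕ) : Finite (YLe m) := by
  refine Finite.of_injective (β := Σ k : Fin (m + 1), Y k)
    (fun μ => ⟨⟨μ.1.card, Nat.lt_succ_of_le μ.2⟩, ⟨μ.1, rfl⟩⟩) ?_
  intro μ ν h
  have h1 : (⟨⟨μ.1.card, Nat.lt_succ_of_le μ.2⟩, ⟨μ.1, rfl⟩⟩ : Σ k : Fin (m + 1), Y k).2.1 =
    (⟨⟨ν.1.card, Nat.lt_succ_of_le ν.2⟩, ⟨ν.1, rfl⟩⟩ : Σ k : Fin (m + 1), Y k).2.1 := by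
    exact congrArg (fun x : Σ k : Fin (m + 1), Y k => x.2.1) h
  exact Subtype.ext h1

instance fintype_YLe (m : ℕ) : Fintype (YLe m) := Fintype.ofFinite _

/-- Evaluate a relation at a smallest diagram occurring in it: by the vanishing of `relDim` only its
own term remains. -/
theorem linearIndependent_schurPoly (m : ℕ) :
    LinearIndependent ℝ fun μ : YLe m => (schurPoly μ.1).eval 1 := by
  classical
  rw [Fintype.linearIndependent_iff]
  intro c hc
  by_contra! hne
  obtain ⟨μ1, hμ1⟩ := hne
  obtain ⟨μ, hμ, hmin⟩ := Finset.exists_min_image (Finset.univ.filter fun μ : YLe m => c μ ≠ 0)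
    (fun μ => μ.1.card) ⟨μ1, Finset.mem_filter.2 ⟨Finset.mem_univ _, hμ1⟩⟩
  have h1 := congrArg (evalFrob μ.1) hc
  rw [map_sum, map_zero, Finset.sum_eq_single μ] at h1
  · rw [map_smul, evalFrob_schurPoly, smul_eq_mul] at h1
    exact mul_ne_zero (Finset.mem_filter.1 hμ).2 (relDim_ne_zero μ.1) h1
  · intro ν _ hν
    rw [map_smul, evalFrob_schurPoly, smul_eq_mul]
    by_cases h2 : c ν = 0
    · rw [h2, zero_mul]
    · have h3 := hmin ν (Finset.mem_filter.2 ⟨Finset.mem_univ _, h2⟩)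
      rw [relDim_eq_zero h3 fun e => hν (Subtype.ext e.symm), mul_zero]
  · intro h
    exact absurd (Finset.mem_univ _) h

/-- The number of parts exceeding `j`, the part `k` being taken `d k` times. -/
def partCount (d : ℕ+ →₀ ℕ) (j : ℕ) : ℕ := ∑ k ∈ d.support, if j < (k : ℕ) then d k else 0

theorem partCount_antitone (d : ℕ+ →₀ ℕ) : Antitone (partCount d) := by
  intro i j hij
  refine Finset.sum_le_sum fun k _ => ?_
  split_ifs <;> omega

theorem partCount_sup (d : ℕ+ →₀ ℕ) : partCount d (d.support.sup fun k : ℕ+ => (k : ℕ)) = 0 := by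
  refine Finset.sum_eq_zero fun k hk => if_neg ?_
  exact not_lt.2 (Finset.le_sup (f := fun k : ℕ+ => (k : ℕ)) hk)

/-- The diagram whose columns have the lengths given by the parts of `d`, the part `k` being taken
`d k` times. -/
def diagramOfParts (d : ℕ+ →₀ ℕ) : YoungDiagram :=
  ofFun (partCount d) (partCount_antitone d) _ (partCount_sup d)

theorem rowLen_diagramOfParts (d : ℕ+ →₀ ℕ) : (diagramOfParts d).rowLen = partCount d := by
  rw [diagramOfParts, rowLen_ofFun]

theorem card_diagramOfParts (d : ℕ+ →₀ ℕ) : (diagramOfParts d).card = wt d := by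
  set N := max ((diagramOfParts d).colLen 0) (d.support.sup fun k : ℕ+ => (k : ℕ)) with hN
  rw [card_eq_sum_rowLen _ (le_max_left ((diagramOfParts d).colLen 0)
    (d.support.sup fun k : ℕ+ => (k : ℕ))), ← hN]
  simp only [rowLen_diagramOfParts, partCount]
  rw [Finset.sum_comm, wt, Finsupp.weight_apply, Finsupp.sum]
  refine Finset.sum_congr rfl fun k hk => ?_
  have h1 : (k : ℕ) ≤ N :=
    (Finset.le_sup (f := fun k : ℕ+ => (k : ℕ)) hk).trans (le_max_right _ _)
  rw [← Finset.sum_filter, Finset.sum_const]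
  have h2 : (Finset.range N).filter (fun j => j < (k : ℕ)) = Finset.range k := by
    ext j
    simp only [Finset.mem_filter, Finset.mem_range]
    omega
  rw [h2, Finset.card_range, smul_eq_mul, smul_eq_mul, mul_comm]

/-- The multiplicity of the part k is the difference of two consecutive row lengths. -/
theorem diagramOfParts_injective : Function.Injective diagramOfParts := by
  have key : ∀ (d : ℕ+ →₀ ℕ) (k : ℕ+), partCount d ((k : ℕ) - 1) = partCount d k + d k := by
    intro d k
    have h1 : d k = ∑ l ∈ d.support, if l = k then d l else 0 := by
      rw [Finset.sum_ite_eq']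
      split_ifs with h
      · rfl
      · exact Finsupp.notMem_support_iff.1 h
    rw [partCount, partCount, h1, ← Finset.sum_add_distrib]
    refine Finset.sum_congr rfl fun l _ => ?_
    have h2 : l = k ↔ (l : ℕ) = k := PNat.coe_inj.symm
    have h3 := k.pos
    simp only [h2]
    split_ifs <;> omega
  intro d d' h
  have h0 : partCount d = partCount d' := by
    rw [← rowLen_diagramOfParts, ← rowLen_diagramOfParts, h]
  ext k
  have h1 := key d k
  have h2 := key d' k
  rw [h0] at h1
  omega

/-- A dimension count: there are at most as many monomials of weight ≤ m as diagrams with ≤ m boxes,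
and the elements attached to the latter are independent. -/
theorem span_schurPoly (m : ℕ) :
    Submodule.span ℝ (Set.range fun μ : YLe m => (schurPoly μ.1).eval 1) = symFilt m := by
  set D : Set (ℕ+ →₀ ℕ) := {d | Finsupp.weight (fun k : ℕ+ => (k : ℕ)) d ≤ m} with hD
  let F : D → YLe m := fun d => ⟨diagramOfParts d.1, by
    rw [card_diagramOfParts]
    exact d.2⟩
  have hF : Function.Injective F := by
    intro d d' h
    exact Subtype.ext (diagramOfParts_injective (congrArg Subtype.val h))
  have hfin : Finite D := Finite.of_injective F hF
  have : Fintype D := Fintype.ofFinite _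
  let b : Module.Basis D ℝ (symFilt m) := MvPolynomial.basisRestrictSupport ℝ D
  have : Module.Finite ℝ (symFilt m) := Module.Finite.of_basis b
  refine Submodule.eq_of_le_of_finrank_le ?_ ?_
  · rw [Submodule.span_le]
    rintro _ ⟨μ, rfl⟩
    have h := symFilt_mono μ.2 (eval_schurPoly_mem μ.1 1)
    rwa [MvPolynomial.C_1] at h
  · rw [Module.finrank_eq_card_basis b, finrank_span_eq_card (linearIndependent_schurPoly m)]
    exact Fintype.card_le_of_injective F hF

/-- Homogeneous symmetric functions of degree `m` are linear combinations of Schur functions. -/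
theorem mem_span_schur (m : ℕ) (f : Sym)
    (hf : MvPolynomial.IsWeightedHomogeneous (fun k : ℕ+ => (k : ℕ)) f m) :
    f ∈ Submodule.span ℝ (Set.range fun μ : Y m => schur μ.1) := by
  set L := MvPolynomial.weightedHomogeneousComponent (R := ℝ) (fun k : ℕ+ => (k : ℕ)) m with hL
  have h1 : f ∈ symFilt m := mem_symFilt.2 fun d hd => (hf hd).le
  have h2 : f = L f := (hf.weightedHomogeneousComponent_same).symm
  rw [← span_schurPoly] at h1
  have h3 := Submodule.mem_map_of_mem (f := L) h1
  rw [← h2, Submodule.map_span, ← Set.range_comp] at h3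
  refine Submodule.span_le.2 ?_ h3
  rintro _ ⟨μ, rfl⟩
  have h4 : (schurPoly μ.1).eval 1 =
      ∑ i ∈ Finset.range (μ.1.card + 1), (schurPoly μ.1).coeff i := by
    have h := eval_schurPoly μ.1 1
    rw [MvPolynomial.C_1] at h
    rw [h]
    simp
  -- The i-th coefficient is homogeneous of degree |μ| − i with |μ| ≤ m, so degree m occurs only for
  -- |μ| = m and i = 0, where the coefficient is the Schur function.
  have h5 : ∀ i ∈ Finset.range (μ.1.card + 1), L ((schurPoly μ.1).coeff i) =
      if μ.1.card = m ∧ i = 0 then schur μ.1 else 0 := by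
    intro i _
    ext d
    rw [hL, MvPolynomial.coeff_weightedHomogeneousComponent]
    have h6 := schurPoly_isBihomogeneous μ.1 i d
    have hle := μ.2
    by_cases hc : μ.1.card = m ∧ i = 0
    · rw [if_pos hc]
      rw [hc.2, coeff_zero_schurPoly] at h6 ⊢
      split_ifs with h7
      · rfl
      · symm
        by_contra h8
        have := h6 h8
        exact h7 (by simp only [wt] at this; omega)
    · rw [if_neg hc, MvPolynomial.coeff_zero]
      split_ifs with h7
      · by_contra h8
        have := h6 h8
        simp only [wt] at this
        exact hc (by omega)
      · rfl
  rw [Function.comp_apply, h4, map_sum, Finset.sum_congr rfl h5]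
  refine Submodule.sum_mem _ fun i _ => ?_
  split_ifs with hc
  · exact Submodule.subset_span ⟨⟨μ.1, hc.1⟩, rfl⟩
  · exact Submodule.zero_mem _

/-- The projection of symmetric functions to the quotient algebra. -/
abbrev mkQ : Sym →ₐ[ℝ] SymQ := Ideal.Quotient.mkₐ ℝ (Ideal.span {psum 1 - 1})

theorem mkQ_psum_one : mkQ (psum 1) = 1 := by
  have h : mkQ (psum 1 - 1) = 0 :=
    Ideal.Quotient.eq_zero_iff_mem.2 (Ideal.subset_span rfl)
  rwa [map_sub, map_one, sub_eq_zero] at h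

theorem mkQ_mem_filt {f : Sym} {m : ℕ} (h : f ∈ symFilt m) : mkQ f ∈ filt m :=
  Submodule.mem_map_of_mem h

theorem filt_mono {m k : ℕ} (h : m ≤ k) : filt m ≤ filt k := Submodule.map_mono (symFilt_mono h)

theorem exists_mem_filt (f : SymQ) : ∃ m, f ∈ filt m := by
  obtain ⟨g, rfl⟩ := Ideal.Quotient.mk_surjective f
  refine ⟨g.support.sup wt, mkQ_mem_filt (mem_symFilt.2 fun d hd => ?_)⟩
  exact Finset.le_sup (MvPolynomial.mem_support_iff.2 hd)

theorem schurQ_mem_filt (μ : YoungDiagram) : schurQ μ ∈ filt μ.card := by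
  have h := coeff_schurPoly_mem μ 0
  rw [coeff_zero_schurPoly] at h
  exact mkQ_mem_filt h

theorem span_schurQ (m : ℕ) :
    Submodule.span ℝ (Set.range fun μ : Y m => schurQ μ.1) = filt m := by
  refine le_antisymm ?_ ?_
  · rw [Submodule.span_le]
    rintro _ ⟨μ, rfl⟩
    have h := schurQ_mem_filt μ.1
    rwa [μ.2] at h
  · rintro _ ⟨f, hf, rfl⟩
    have h1 := mem_symFilt.1 hf
    change mkQ f ∈ _
    rw [MvPolynomial.as_sum f, map_sum]
    refine Submodule.sum_mem _ fun d hd => ?_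
    have hw := h1 d (MvPolynomial.mem_support_iff.1 hd)
    -- Since p_1 = 1 in the quotient, a monomial can be raised to degree exactly m without changing
    -- its image; hence diagrams with exactly m boxes suffice.
    set g : Sym := MvPolynomial.monomial d (MvPolynomial.coeff d f) * psum 1 ^ (m - wt d) with hg
    have h2 : mkQ (MvPolynomial.monomial d (MvPolynomial.coeff d f)) = mkQ g := by
      rw [hg, map_mul, map_pow, mkQ_psum_one, one_pow, mul_one]
    have h3 : MvPolynomial.IsWeightedHomogeneous (fun k : ℕ+ => (k : ℕ)) g m := by
      have h4 := (MvPolynomial.isWeightedHomogeneous_monomial (fun k : ℕ+ => (k : ℕ)) d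
        (MvPolynomial.coeff d f) rfl).mul
        ((MvPolynomial.isWeightedHomogeneous_X ℝ (fun k : ℕ+ => (k : ℕ)) 1).pow (m - wt d))
      have h6 : wt d + (m - wt d) • ((1 : ℕ+) : ℕ) = m := by
        rw [PNat.one_coe, smul_eq_mul, mul_one]
        exact Nat.add_sub_of_le hw
      exact (congrArg (MvPolynomial.IsWeightedHomogeneous _ g) h6).mp h4
    rw [h2]
    have h5 := Submodule.mem_map_of_mem (f := mkQ.toLinearMap) (mem_span_schur m g h3)
    rw [Submodule.map_span, ← Set.range_comp] at h5
    exact h5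

/-! ### Restriction to the diagrams with `n` boxes -/

/-- The elements of `Λ°` whose restrictions to `Y n` are proportional to relative dimensions. -/
def schurDeform (μ : YoungDiagram) (n : ℕ) : SymQ :=
  mkQ ((schurPoly μ).eval (MvPolynomial.C (1 / (n : ℝ))))

theorem evalQ_mkQ_apply (f : Sym) (ω : Omega) :
    evalQ (mkQ f) ω = MvPolynomial.aeval (R := ℝ) (fun k => psumFun k ω) f := by
  have h1 : evalQ (mkQ f) = MvPolynomial.aeval (R := ℝ) psumFun f := rfl
  have h2 := MvPolynomial.comp_aeval_apply (R := ℝ) (f := psumFun)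
    (ContinuousMap.evalAlgHom (S := ℝ) ℝ ω) f
  rw [h1]
  exact h2

theorem proj_schurDeform (μ : YoungDiagram) (n : ℕ) (hn : n ≠ 0) (la : Y n) :
    proj n (evalQ (schurDeform μ n)) la = (1 / (n : ℝ)) ^ μ.card * relDim μ la.1 := by
  change evalQ (schurDeform μ n) (iota n la) = _
  rw [schurDeform, evalQ_mkQ_apply]
  refine map_schurPoly μ la.1 (1 / (n : ℝ)) _ (fun k => ?_) ?_
  · rw [psum, MvPolynomial.aeval_X, psumFun_iota n hn la le_rfl]
  · have : (n : ℝ) ≠ 0 := by exact_mod_cast hn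
    positivity

theorem schurDeform_mem_filt (μ : YoungDiagram) (n : ℕ) : schurDeform μ n ∈ filt μ.card :=
  mkQ_mem_filt (eval_schurPoly_mem μ _)

theorem schurDeform_eq (μ : YoungDiagram) (n : ℕ) :
    schurDeform μ n = schurQ μ + ∑ i ∈ Finset.range μ.card,
      (1 / (n : ℝ)) ^ (i + 1) • mkQ ((schurPoly μ).coeff (i + 1)) := by
  rw [schurDeform, eval_schurPoly, map_sum, Finset.sum_range_succ', add_comm]
  congr 1
  · rw [pow_zero, one_smul, coeff_zero_schurPoly]
    rfl

/-- At each diagram the restrictions are numbers of chains times a nonzero factor common to all μ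
with m boxes, so `chains_linearIndependent` applies. -/
theorem linearIndependent_proj_schurDeform (m n : ℕ) (hmn : m ≤ n) (hn : n ≠ 0) :
    LinearIndependent ℝ fun μ : Y m => proj n (evalQ (schurDeform μ.1 n)) := by
  rw [Fintype.linearIndependent_iff]
  intro c hc
  have hn' : (n : ℝ) ≠ 0 := by exact_mod_cast hn
  refine fun μ => congrFun (chains_linearIndependent m (n - m) c fun ν hν => ?_) μ
  have hνn : ν.card = n := by omega
  have h1 := congrFun hc ⟨ν, hνn⟩
  rw [Finset.sum_apply] at h1
  have h2 : ∀ μ : Y m, (c μ • proj n (evalQ (schurDeform μ.1 n))) ⟨ν, hνn⟩ =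
      ((1 / (n : ℝ)) ^ m * (n.descFactorial m : ℝ) / fdim ν) * (c μ * chains μ.1 (n - m) ν) := by
    intro μ
    rw [Pi.smul_apply, proj_schurDeform _ _ hn, smul_eq_mul, relDim, μ.2, hνn]
    ring
  rw [Finset.sum_congr rfl fun μ _ => h2 μ, ← Finset.mul_sum, Pi.zero_apply, mul_eq_zero] at h1
  refine h1.resolve_left ?_
  have h3 := fdim_pos ν
  have h4 : (n.descFactorial m : ℝ) ≠ 0 := by
    exact_mod_cast (Nat.descFactorial_pos.2 hmn).ne'
  positivity

instance finite_filt (m : ℕ) : Module.Finite ℝ (filt m) := by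
  rw [← span_schurQ]
  exact Module.Finite.span_of_finite ℝ (Set.finite_range _)

/-- The composition of `evalQ` and `proj`. -/
def restr (n : ℕ) : SymQ →ₗ[ℝ] (Y n → ℝ) := proj n ∘ₗ evalQ.toLinearMap

/-- F^m is spanned by as many elements s°_μ as there are independent deformed ones. -/
theorem span_schurDeform (m n : ℕ) (hmn : m ≤ n) (hn : n ≠ 0) :
    Submodule.span ℝ (Set.range fun μ : Y m => schurDeform μ.1 n) = filt m := by
  refine Submodule.eq_of_le_of_finrank_le ?_ ?_
  · rw [Submodule.span_le]
    rintro _ ⟨μ, rfl⟩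
    have h := schurDeform_mem_filt μ.1 n
    rwa [μ.2] at h
  · have h1 : LinearIndependent ℝ fun μ : Y m => schurDeform μ.1 n :=
      LinearIndependent.of_comp (restr n) (linearIndependent_proj_schurDeform m n hmn hn)
    rw [finrank_span_eq_card h1, ← span_schurQ]
    exact finrank_range_le_card _

theorem restr_injOn (m n : ℕ) (hmn : m ≤ n) (hn : n ≠ 0) (f : SymQ) (hf : f ∈ filt m)
    (h : restr n f = 0) : f = 0 := by
  rw [← span_schurDeform m n hmn hn, Submodule.mem_span_range_iff_exists_fun] at hf
  obtain ⟨c, rfl⟩ := hf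
  have h1 := Fintype.linearIndependent_iff.1 (linearIndependent_proj_schurDeform m n hmn hn) c (by
    rw [map_sum] at h
    simp only [map_smul] at h
    exact h)
  simp [h1]

/-! ### z-measures -/

/-- The number `(z)_S (z')_S` for a finite set `S` of boxes, as a real number. -/
def zWeight (z z' : ℂ) (S : Finset (ℕ × ℕ)) : ℝ := (poch z S * poch z' S).re

theorem ofReal_zWeight {z z' : ℂ} (h : Admissible z z') (S : Finset (ℕ × ℕ)) :
    ((zWeight z z' S : ℝ) : ℂ) = poch z S * poch z' S :=
  Complex.ext rfl (by rw [poch_mul_poch_im h, Complex.ofReal_im])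

theorem ofReal_mul_re {z z' : ℂ} (h : Admissible z z') : (((z * z').re : ℝ) : ℂ) = z * z' :=
  Complex.ext rfl (by rw [mul_im h, Complex.ofReal_im])

theorem Admissible.mul_re_pos {z z' : ℂ} (h : Admissible z z') : 0 < (z * z').re := by
  rcases h with ⟨h1, rfl⟩ | ⟨h1, h2, N, h3, h4, h5, h6⟩
  · rw [Complex.mul_conj, Complex.ofReal_re, Complex.normSq_pos]
    rintro rfl
    exact h1 rfl
  · rw [Complex.mul_re, h1, zero_mul, sub_zero]
    rcases le_or_gt 0 N with hN | hN
    · have : (0 : ℝ) ≤ N := by exact_mod_cast hN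
      exact mul_pos (by linarith) (by linarith)
    · have : (N : ℝ) + 1 ≤ 0 := by exact_mod_cast hN
      exact mul_pos_of_neg_of_neg (by linarith) (by linarith)

theorem Admissible.add_int {z z' : ℂ} (h : Admissible z z') (c : ℤ) :
    Admissible (z + c) (z' + c) := by
  rcases h with ⟨h1, rfl⟩ | ⟨h1, h2, N, h3, h4, h5, h6⟩
  · left
    refine ⟨by simpa using h1, by simp⟩
  · right
    refine ⟨by simpa using h1, by simpa using h2, N + c, ?_⟩
    simp only [Complex.add_re, Complex.intCast_re, Int.cast_add]
    refine ⟨?_, ?_, ?_, ?_⟩ <;> linarith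

theorem zWeight_singleton (z z' : ℂ) (i j : ℕ) :
    zWeight z z' {(i, j)} = ((z + ((j : ℤ) - i : ℤ)) * (z' + ((j : ℤ) - i : ℤ))).re := by
  rw [zWeight, poch, poch, Finset.prod_singleton, Finset.prod_singleton]
  push_cast
  rw [add_sub_assoc, add_sub_assoc]

theorem zWeight_union {z z' : ℂ} (h : Admissible z z') {S S' : Finset (ℕ × ℕ)}
    (hd : Disjoint S S') : zWeight z z' (S ∪ S') = zWeight z z' S * zWeight z z' S' := by
  apply Complex.ofReal_injective
  rw [Complex.ofReal_mul, ofReal_zWeight h, ofReal_zWeight h, ofReal_zWeight h, poch, poch,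
    Finset.prod_union hd, Finset.prod_union hd]
  simp only [poch]
  ring

/-- Admissibility is preserved by integer shifts, so each factor (z + c)(z' + c) is positive. -/
theorem zWeight_pos {z z' : ℂ} (h : Admissible z z') (S : Finset (ℕ × ℕ)) :
    0 < zWeight z z' S := by
  classical
  induction S using Finset.induction_on with
  | empty => simp [zWeight, poch]
  | insert a S ha ih =>
    rw [Finset.insert_eq, zWeight_union h (Finset.disjoint_singleton_left.2 ha)]
    exact mul_pos (by rw [zWeight_singleton]; exact (h.add_int _).mul_re_pos) ih

/-- The weight is quadratic in the content, so its row differences are linear in the row lengths;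
the terms depending on z + z' and on the number of rows cancel. -/
theorem sum_upper_zWeight_sub (z z' : ℂ) (μ : YoungDiagram) :
    ∑ ν ∈ upper μ, zWeight z z' (ν.cells \ μ.cells) -
      ∑ κ ∈ lower μ, zWeight z z' (μ.cells \ κ.cells) = (z * z').re + 2 * μ.card := by
  have hφ : ∀ c : ℤ, ((z + c) * (z' + c)).re = (z * z').re + c * (z.re + z'.re) + c ^ 2 := by
    intro c
    simp only [Complex.mul_re, Complex.add_re, Complex.add_im, Complex.intCast_re,
      Complex.intCast_im]
    ring
  rw [sum_upper_sub_sum_lower μ le_rfl (zWeight z z') (fun c => ((z + c) * (z' + c)).re)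
    (zWeight_singleton z z')]
  have h1 : ∀ N : ℕ, ∑ i ∈ Finset.range N,
      (((z + ((μ.rowLen i : ℤ) - i : ℤ)) * (z' + ((μ.rowLen i : ℤ) - i : ℤ))).re -
        ((z + ((μ.rowLen i : ℤ) - i - 1 : ℤ)) * (z' + ((μ.rowLen i : ℤ) - i - 1 : ℤ))).re) =
      N * (z.re + z'.re) + 2 * ∑ i ∈ Finset.range N, (μ.rowLen i : ℝ) - (N : ℝ) ^ 2 := by
    intro N
    induction N with
    | zero => simp
    | succ N ih =>
      rw [Finset.sum_range_succ, ih, Finset.sum_range_succ, hφ, hφ]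
      push_cast
      ring
  rw [h1, hφ, card_eq_sum_rowLen μ le_rfl]
  push_cast
  ring

theorem zMeasure_eq {z z' : ℂ} (h : Admissible z z') (n : ℕ) (μ : Y n) :
    zMeasure z z' n μ = zWeight z z' μ.1.cells /
      (∏ k ∈ Finset.range n, ((z * z').re + k)) * (fdim μ.1 ^ 2 / n.factorial) := by
  rw [zMeasure, ← ofReal_zWeight h, ← ofReal_mul_re h, ← dim_eq_fdim]
  rw [← Complex.ofReal_re (zWeight z z' μ.1.cells / _ * _)]
  push_cast
  rfl

theorem pUp_eq {z z' : ℂ} (h : Admissible z z') (n : ℕ) (la : Y n) (ν : Y (n + 1))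
    (hc : Covers la.1 ν.1) :
    pUp z z' n la ν = zWeight z z' (ν.1.cells \ la.1.cells) * (fdim ν.1 / fdim la.1) /
      (((z * z').re + n) * (n + 1)) := by
  have ht := h.mul_re_pos
  have h1 := fdim_pos la.1
  have h2 := fdim_pos ν.1
  have h3 : zWeight z z' ν.1.cells =
      zWeight z z' la.1.cells * zWeight z z' (ν.1.cells \ la.1.cells) := by
    rw [← zWeight_union h Finset.disjoint_sdiff,
      Finset.union_sdiff_of_subset (YoungDiagram.cells_subset_iff.2 hc.1)]
  have h4 := zWeight_pos h la.1.cells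
  have h5 : 0 < ∏ k ∈ Finset.range n, ((z * z').re + k) :=
    Finset.prod_pos fun k _ => by positivity
  have h6 : 0 < (z * z').re + n := by positivity
  rw [pUp, Matrix.of_apply, pDown, Matrix.of_apply, if_pos hc, zMeasure_eq h, zMeasure_eq h, h3,
    Finset.prod_range_succ, Nat.factorial_succ, dim_eq_fdim, dim_eq_fdim]
  push_cast
  field_simp

theorem pUp_eq_zero (z z' : ℂ) (n : ℕ) (la : Y n) (ν : Y (n + 1))
    (hc : ¬ Covers la.1 ν.1) : pUp z z' n la ν = 0 := by
  rw [pUp, Matrix.of_apply, pDown, Matrix.of_apply, if_neg hc, mul_zero]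

theorem T_apply (z z' : ℂ) (n : ℕ) (F : Y n → ℝ) (la : Y n) :
    T z z' n F la = ∑ ν, pUp z z' n la ν * ∑ κ, pDown n ν κ * F κ := by
  rw [T, Matrix.mulVecLin_apply, ← Matrix.mulVec_mulVec]
  rfl

/-- The action of the up-down chain on relative numbers of chains. -/
theorem T_chains {z z' : ℂ} (h : Admissible z z') (n k : ℕ) (μ : YoungDiagram) (la : Y n) :
    T z z' n (fun κ => chains μ k κ.1 / fdim κ.1) la =
      ((k + 1) * ((z * z').re + 2 * n - k) * chains μ k la.1 +
        ∑ η ∈ lower μ, boxWeight z z' η μ * chains η (k + 1) la.1) /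
      (fdim la.1 * (((z * z').re + n) * (n + 1))) := by
  classical
  have h1 : ∀ ν : Y (n + 1), ∑ κ : Y n, pDown n ν κ * (chains μ k κ.1 / fdim κ.1) =
      chains μ (k + 1) ν.1 / fdim ν.1 := by
    intro ν
    rw [← sum_lower_chains, ← sum_Y_eq_sum_lower n ν.1 ν.2, Finset.sum_div]
    refine Finset.sum_congr rfl fun κ _ => ?_
    rw [pDown, Matrix.of_apply, dim_eq_fdim, dim_eq_fdim]
    have h2 := fdim_pos κ.1
    have h3 := fdim_pos ν.1
    split_ifs
    · field_simp
    · simp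
  rw [T_apply, Finset.sum_congr rfl fun ν _ => by rw [h1 ν]]
  have h2 : ∀ ν : Y (n + 1), pUp z z' n la ν * (chains μ (k + 1) ν.1 / fdim ν.1) =
      if Covers la.1 ν.1 then zWeight z z' (ν.1.cells \ la.1.cells) * chains μ (k + 1) ν.1 /
        (fdim la.1 * (((z * z').re + n) * (n + 1))) else 0 := by
    intro ν
    have h3 := fdim_pos ν.1
    split_ifs with hc
    · have h4 := fdim_pos la.1
      rw [pUp_eq h n la ν hc]
      field_simp
    · rw [pUp_eq_zero z z' n la ν hc, zero_mul]
  rw [Finset.sum_congr rfl fun ν _ => h2 ν, sum_Y_eq_sum_upper n la.1 la.2 fun ν =>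
    zWeight z z' (ν.cells \ la.1.cells) * chains μ (k + 1) ν /
        (fdim la.1 * (((z * z').re + n) * (n + 1))), ← Finset.sum_div,
    sum_upper_chains (zWeight z z') (z * z').re (sum_upper_zWeight_sub z z'), la.2]
  rfl

/-- The image of `schurDeform μ n` under the up-down chain. -/
def schurDeformStep (z z' : ℂ) (μ : YoungDiagram) (n : ℕ) : SymQ :=
  schurDeform μ n + (1 / (((z * z').re + n) * (n + 1))) •
    (-((μ.card : ℝ) * ((μ.card : ℝ) - 1 + (z * z').re)) • schurDeform μ n +
      (((n : ℝ) - μ.card + 1) / n) •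
        ∑ η ∈ lower μ, boxWeight z z' η μ • schurDeform η n)

theorem restr_schurDeform (μ : YoungDiagram) (n : ℕ) (hn : n ≠ 0) :
    restr n (schurDeform μ n) = ((1 / (n : ℝ)) ^ μ.card * (n.descFactorial μ.card : ℝ)) •
      fun κ : Y n => chains μ (n - μ.card) κ.1 / fdim κ.1 := by
  funext la
  have h := proj_schurDeform μ n hn la
  rw [relDim, la.2] at h
  rw [Pi.smul_apply, smul_eq_mul, mul_assoc, ← mul_div_assoc]
  exact h

/-- This is `T_chains` with k = n − m, m = |μ|. The factor (n − m + 1)/n comes from comparing the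
normalizations n^{-m} n(n−1)⋯(n−m+1) for m and m − 1. -/
theorem T_restr_schurDeform {z z' : ℂ} (h : Admissible z z') (μ : YoungDiagram) (n : ℕ)
    (hn : n ≠ 0) (hmn : μ.card ≤ n) :
    T z z' n (restr n (schurDeform μ n)) = restr n (schurDeformStep z z' μ n) := by
  have ht := h.mul_re_pos
  have hn' : (n : ℝ) ≠ 0 := by exact_mod_cast hn
  funext la
  have hd := fdim_pos la.1
  have h6 : 0 < (z * z').re + n := by positivity
  have h1 : ∀ η ∈ lower μ, restr n (schurDeform η n) la =
      (1 / (n : ℝ)) ^ (μ.card - 1) * (n.descFactorial (μ.card - 1) : ℝ) *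
        (chains η (n - μ.card + 1) la.1 / fdim la.1) := by
    intro η hη
    have hc := (mem_lower.1 hη).2
    rw [restr_schurDeform η n hn, Pi.smul_apply, smul_eq_mul,
      show η.card = μ.card - 1 by omega, show n - (μ.card - 1) = n - μ.card + 1 by omega]
  have h2 : ((1 / (n : ℝ)) ^ μ.card * (n.descFactorial μ.card : ℝ)) *
      ∑ η ∈ lower μ, boxWeight z z' η μ * chains η (n - μ.card + 1) la.1 =
      (((n : ℝ) - μ.card + 1) / n) * fdim la.1 *
        ∑ η ∈ lower μ, boxWeight z z' η μ * restr n (schurDeform η n) la := by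
    rw [Finset.mul_sum, Finset.mul_sum]
    refine Finset.sum_congr rfl fun η hη => ?_
    have hc := (mem_lower.1 hη).2
    rw [h1 η hη]
    have h3 : μ.card = (μ.card - 1) + 1 := by omega
    have h4 : (n.descFactorial μ.card : ℝ) =
        ((n : ℝ) - μ.card + 1) * n.descFactorial (μ.card - 1) := by
      conv_lhs => rw [h3]
      rw [Nat.descFactorial_succ, Nat.cast_mul, Nat.cast_sub (by omega), Nat.cast_sub (by omega)]
      push_cast
      ring
    have h5 : (1 / (n : ℝ)) ^ μ.card = (1 / (n : ℝ)) ^ (μ.card - 1) * (1 / (n : ℝ)) := by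
      conv_lhs => rw [h3, pow_succ]
    rw [h4, h5]
    field_simp
  have h3 : restr n (schurDeformStep z z' μ n) la = restr n (schurDeform μ n) la +
      (1 / (((z * z').re + n) * (n + 1))) *
      (-((μ.card : ℝ) * ((μ.card : ℝ) - 1 + (z * z').re)) * restr n (schurDeform μ n) la +
        (((n : ℝ) - μ.card + 1) / n) *
        ∑ η ∈ lower μ, boxWeight z z' η μ * restr n (schurDeform η n) la) := by
    rw [schurDeformStep]
    simp only [map_add, map_smul, map_sum, Pi.add_apply, Pi.smul_apply, Finset.sum_apply,
      smul_eq_mul]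
  rw [h3]
  have h4 : T z z' n (restr n (schurDeform μ n)) la =
      (((1 / (n : ℝ)) ^ μ.card * (n.descFactorial μ.card : ℝ)) *
        (((n - μ.card : ℕ) + 1) * ((z * z').re + 2 * n - (n - μ.card : ℕ)) *
          chains μ (n - μ.card) la.1) +
        ((1 / (n : ℝ)) ^ μ.card * (n.descFactorial μ.card : ℝ)) *
          ∑ η ∈ lower μ, boxWeight z z' η μ * chains η (n - μ.card + 1) la.1) /
      (fdim la.1 * (((z * z').re + n) * (n + 1))) := by
    rw [restr_schurDeform μ n hn, map_smul, Pi.smul_apply, T_chains h, smul_eq_mul]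
    ring
  rw [h4, h2, restr_schurDeform μ n hn, Pi.smul_apply, smul_eq_mul, Nat.cast_sub hmn]
  generalize ∑ η ∈ lower μ, boxWeight z z' η μ * restr n (schurDeform η n) la = S
  generalize (1 / (n : ℝ)) ^ μ.card * (n.descFactorial μ.card : ℝ) = K
  generalize chains μ (n - μ.card) la.1 = c
  have h7 : (n : ℝ) + 1 ≠ 0 := by positivity
  have h8 := h6.ne'
  have h9 := hd.ne'
  -- With t = zz' the identity is (n − m + 1)(t + n + m) = (t + n)(n + 1) − m(m − 1 + t).
  field_simp
  ring

/-! ### The limit operator -/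

theorem sum_lower_mem_filt {z z' : ℂ} (μ : YoungDiagram) (e : YoungDiagram → SymQ)
    (he : ∀ η, e η ∈ filt η.card) :
    ∑ η ∈ lower μ, boxWeight z z' η μ • e η ∈ filt μ.card := by
  refine Submodule.sum_mem _ fun η hη => Submodule.smul_mem _ _ (filt_mono ?_ (he η))
  have := (mem_lower.1 hη).2
  omega

theorem schurDeformStep_mem_filt (z z' : ℂ) (μ : YoungDiagram) (n : ℕ) :
    schurDeformStep z z' μ n ∈ filt μ.card := by
  have h1 := schurDeform_mem_filt μ n
  have h2 := sum_lower_mem_filt (z := z) (z' := z') μ _ (fun η => schurDeform_mem_filt η n)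
  exact Submodule.add_mem _ h1 (Submodule.smul_mem _ _
    (Submodule.add_mem _ (Submodule.smul_mem _ _ h1) (Submodule.smul_mem _ _ h2)))

theorem tendsto_one_div_pow (k : ℕ) :
    Tendsto (fun n : ℕ => (1 / (n : ℝ)) ^ (k + 1)) atTop (𝓝 0) := by
  have h := (tendsto_one_div_atTop_nhds_zero_nat (𝕜 := ℝ)).pow (k + 1)
  simpa using h

theorem tendsto_evalQ_schurDeform (μ : YoungDiagram) :
    Tendsto (fun n : ℕ => evalQ (schurDeform μ n)) atTop (𝓝 (evalQ (schurQ μ))) := by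
  have h1 : ∀ n : ℕ, evalQ (schurDeform μ n) = evalQ (schurQ μ) +
      ∑ i ∈ Finset.range μ.card,
        (1 / (n : ℝ)) ^ (i + 1) • evalQ (mkQ ((schurPoly μ).coeff (i + 1))) := by
    intro n
    rw [schurDeform_eq, map_add, map_sum]
    simp only [map_smul]
  simp only [h1]
  have h2 : Tendsto (fun n : ℕ => ∑ i ∈ Finset.range μ.card,
      (1 / (n : ℝ)) ^ (i + 1) • evalQ (mkQ ((schurPoly μ).coeff (i + 1)))) atTop
      (𝓝 (∑ i ∈ Finset.range μ.card,
        (0 : ℝ) • evalQ (mkQ ((schurPoly μ).coeff (i + 1))))) :=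
    tendsto_finsetSum _ fun i _ => (tendsto_one_div_pow i).smul_const _
  simp only [zero_smul, Finset.sum_const_zero] at h2
  simpa using h2.const_add (evalQ (schurQ μ))

theorem tendsto_scale (t : ℝ) :
    Tendsto (fun n : ℕ => (n : ℝ) ^ 2 * (1 / ((t + n) * (n + 1)))) atTop (𝓝 1) := by
  have h0 := tendsto_one_div_atTop_nhds_zero_nat (𝕜 := ℝ)
  have h1 : Tendsto (fun n : ℕ => 1 / ((t * (1 / (n : ℝ)) + 1) * (1 + 1 / (n : ℝ)))) atTop
      (𝓝 (1 / ((t * 0 + 1) * (1 + 0)))) := by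
    refine Tendsto.div tendsto_const_nhds ?_ (by norm_num)
    exact ((h0.const_mul t).add_const 1).mul (h0.const_add 1)
  norm_num at h1
  refine Tendsto.congr' ?_ h1
  filter_upwards [eventually_ne_atTop 0] with n hn
  have hn' : (n : ℝ) ≠ 0 := by exact_mod_cast hn
  have h2 : (t * (n : ℝ)⁻¹ + 1) = (t + n) / n := by field_simp
  have h3 : (1 + (n : ℝ)⁻¹) = (n + 1) / n := by field_simp
  rw [h2, h3]
  simp only [one_div, div_mul_div_comm, inv_div, mul_inv]
  field_simp

theorem tendsto_ratio (m : ℝ) :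
    Tendsto (fun n : ℕ => ((n : ℝ) - m + 1) / n) atTop (𝓝 1) := by
  have h0 := tendsto_one_div_atTop_nhds_zero_nat (𝕜 := ℝ)
  have h1 : Tendsto (fun n : ℕ => 1 + (1 - m) * (1 / (n : ℝ))) atTop
      (𝓝 (1 + (1 - m) * 0)) := (h0.const_mul _).const_add 1
  rw [mul_zero, add_zero] at h1
  refine Tendsto.congr' ?_ h1
  filter_upwards [eventually_ne_atTop 0] with n hn
  have hn' : (n : ℝ) ≠ 0 := by exact_mod_cast hn
  field_simp
  ring

/-- The value of the limit operator at a Schur function. -/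
def genSchur (z z' : ℂ) (μ : YoungDiagram) : SymQ :=
  -((μ.card : ℝ) * ((μ.card : ℝ) - 1 + (z * z').re)) • schurQ μ +
    ∑ ν ∈ lower μ, boxWeight z z' ν μ • schurQ ν

theorem genSchur_mem_filt (z z' : ℂ) (μ : YoungDiagram) : genSchur z z' μ ∈ filt μ.card :=
  Submodule.add_mem _ (Submodule.smul_mem _ _ (schurQ_mem_filt μ))
    (sum_lower_mem_filt μ _ schurQ_mem_filt)

theorem tendsto_evalQ_schurDeformStep (z z' : ℂ) (μ : YoungDiagram) :
    Tendsto (fun n : ℕ => evalQ ((n : ℝ) ^ 2 • (schurDeformStep z z' μ n - schurDeform μ n)))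
      atTop (𝓝 (evalQ (genSchur z z' μ))) := by
  have h1 : ∀ n : ℕ, evalQ ((n : ℝ) ^ 2 • (schurDeformStep z z' μ n - schurDeform μ n)) =
      ((n : ℝ) ^ 2 * (1 / (((z * z').re + n) * (n + 1)))) •
        (-((μ.card : ℝ) * ((μ.card : ℝ) - 1 + (z * z').re)) • evalQ (schurDeform μ n) +
      (((n : ℝ) - μ.card + 1) / n) •
        ∑ η ∈ lower μ, boxWeight z z' η μ • evalQ (schurDeform η n)) := by
    intro n
    rw [schurDeformStep, add_sub_cancel_left, smul_smul]
    simp only [map_add, map_smul, map_sum]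
  simp only [h1]
  have h2 : evalQ (genSchur z z' μ) = (1 : ℝ) •
      (-((μ.card : ℝ) * ((μ.card : ℝ) - 1 + (z * z').re)) • evalQ (schurQ μ) +
        (1 : ℝ) • ∑ η ∈ lower μ, boxWeight z z' η μ • evalQ (schurQ η)) := by
    rw [genSchur]
    simp only [map_add, map_smul, map_sum, one_smul]
  rw [h2]
  refine (tendsto_scale _).smul (((tendsto_evalQ_schurDeform μ).const_smul _).add
    ((tendsto_ratio _).smul (tendsto_finsetSum _ fun η _ =>
      (tendsto_evalQ_schurDeform η).const_smul _)))

/-- The element `a` of `F^m` is the limit of `n^2 (T_n - 1) f`, where `f` is in `F^m`. -/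
def IsLimitValue (z z' : ℂ) (m : ℕ) (f a : SymQ) : Prop :=
  f ∈ filt m ∧ a ∈ filt m ∧ ∃ g : ℕ → SymQ, (∀ n, g n ∈ filt m) ∧
    (∀ᶠ n in atTop, restr n (g n) = T z z' n (restr n f)) ∧
    Tendsto (fun n : ℕ => evalQ ((n : ℝ) ^ 2 • (g n - f))) atTop (𝓝 (evalQ a))

theorem IsLimitValue.mono {z z' : ℂ} {m k : ℕ} {f a : SymQ} (h : IsLimitValue z z' m f a)
    (hmk : m ≤ k) : IsLimitValue z z' k f a := by
  obtain ⟨hf, ha, g, hg, h1, h2⟩ := h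
  exact ⟨filt_mono hmk hf, filt_mono hmk ha, g, fun n => filt_mono hmk (hg n), h1, h2⟩

theorem IsLimitValue.zero (z z' : ℂ) (m : ℕ) : IsLimitValue z z' m 0 0 := by
  refine ⟨Submodule.zero_mem _, Submodule.zero_mem _, fun _ => 0, fun _ => Submodule.zero_mem _,
    Eventually.of_forall fun n => by simp, ?_⟩
  simp

theorem IsLimitValue.add {z z' : ℂ} {m : ℕ} {f a f' a' : SymQ} (h : IsLimitValue z z' m f a)
    (h' : IsLimitValue z z' m f' a') : IsLimitValue z z' m (f + f') (a + a') := by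
  obtain ⟨hf, ha, g, hg, h1, h2⟩ := h
  obtain ⟨hf', ha', g', hg', h1', h2'⟩ := h'
  refine ⟨Submodule.add_mem _ hf hf', Submodule.add_mem _ ha ha', fun n => g n + g' n,
    fun n => Submodule.add_mem _ (hg n) (hg' n), ?_, ?_⟩
  · filter_upwards [h1, h1'] with n e e'
    rw [map_add, map_add, map_add, e, e']
  · rw [map_add]
    refine (h2.add h2').congr fun n => ?_
    rw [← map_add, ← smul_add]
    congr 2
    exact (add_sub_add_comm _ _ _ _).symm

theorem IsLimitValue.smul {z z' : ℂ} {m : ℕ} {f a : SymQ} (c : ℝ)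
    (h : IsLimitValue z z' m f a) : IsLimitValue z z' m (c • f) (c • a) := by
  obtain ⟨hf, ha, g, hg, h1, h2⟩ := h
  refine ⟨Submodule.smul_mem _ _ hf, Submodule.smul_mem _ _ ha, fun n => c • g n,
    fun n => Submodule.smul_mem _ _ (hg n), ?_, ?_⟩
  · filter_upwards [h1] with n e
    rw [map_smul, map_smul, map_smul, e]
  · rw [map_smul]
    refine (h2.const_smul c).congr fun n => ?_
    rw [← map_smul, smul_comm, smul_sub c]

/-! ### Existence and uniqueness of limit values -/

theorem eventually_restr_inj (m : ℕ) : ∀ᶠ n in atTop, ∀ f ∈ filt m, ∀ f' ∈ filt m,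
    restr n f = restr n f' → f = f' := by
  filter_upwards [eventually_ge_atTop (m + 1)] with n hn f hf f' hf' h
  rw [← sub_eq_zero]
  refine restr_injOn m n (by omega) (by omega) _ (Submodule.sub_mem _ hf hf') ?_
  rw [map_sub, h, sub_self]

/-- Two elements lie in a common F^m, where values at the points of a single large `Y n` already
separate them. -/
theorem evalQ_injective : Function.Injective evalQ := by
  intro f f' h
  obtain ⟨m, hm⟩ := exists_mem_filt f
  obtain ⟨m', hm'⟩ := exists_mem_filt f'
  obtain ⟨n, hn⟩ := (eventually_restr_inj (max m m')).exists
  exact hn f (filt_mono (le_max_left _ _) hm) f' (filt_mono (le_max_right _ _) hm')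
    (congrArg (proj n) h)

theorem IsLimitValue.unique {z z' : ℂ} {m m' : ℕ} {f a a' : SymQ}
    (h : IsLimitValue z z' m f a) (h' : IsLimitValue z z' m' f a') : a = a' := by
  obtain ⟨hf, ha, g, hg, h1, h2⟩ := h.mono (le_max_left m m')
  obtain ⟨hf', ha', g', hg', h1', h2'⟩ := h'.mono (le_max_right m m')
  refine evalQ_injective (tendsto_nhds_unique h2 (h2'.congr' ?_))
  filter_upwards [h1, h1', eventually_restr_inj (max m m')] with n e e' hn
  rw [hn (g n) (hg n) (g' n) (hg' n) (e.trans e'.symm)]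

/-- For the deformed element the limit is known. The corrections lie in lower filtration, where
n²(T_n − 1) converges by assumption; their coefficients n^{-(i+1)} make them disappear. -/
theorem isLimitValue_schurQ_of_lt {z z' : ℂ} (h : Admissible z z') (μ : YoungDiagram)
    (ih : ∀ k < μ.card, ∀ f ∈ filt k, ∃ a, IsLimitValue z z' k f a) :
    IsLimitValue z z' μ.card (schurQ μ) (genSchur z z' μ) := by
  have hc : ∀ i : ℕ, ∃ a, i < μ.card →
      IsLimitValue z z' μ.card (mkQ ((schurPoly μ).coeff (i + 1))) a := by
    intro i
    by_cases hi : i < μ.card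
    · obtain ⟨a, ha⟩ := ih (μ.card - (i + 1)) (by omega) _
        (mkQ_mem_filt (coeff_schurPoly_mem μ (i + 1)))
      exact ⟨a, fun _ => ha.mono (Nat.sub_le _ _)⟩
    · exact ⟨0, fun h' => absurd h' hi⟩
  choose a ha using hc
  have hg : ∀ i : ℕ, ∃ g : ℕ → SymQ, i < μ.card → (∀ n, g n ∈ filt μ.card) ∧
      (∀ᶠ n in atTop, restr n (g n) =
        T z z' n (restr n (mkQ ((schurPoly μ).coeff (i + 1))))) ∧
      Tendsto (fun n : ℕ => evalQ ((n : ℝ) ^ 2 • (g n - mkQ ((schurPoly μ).coeff (i + 1)))))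
        atTop (𝓝 (evalQ (a i))) := by
    intro i
    by_cases hi : i < μ.card
    · obtain ⟨_, _, g, hg⟩ := ha i hi
      exact ⟨g, fun _ => hg⟩
    · exact ⟨fun _ => 0, fun h' => absurd h' hi⟩
  choose g hg using hg
  refine ⟨schurQ_mem_filt μ, genSchur_mem_filt z z' μ,
    fun n => schurDeformStep z z' μ n -
      ∑ i ∈ Finset.range μ.card, (1 / (n : ℝ)) ^ (i + 1) • g i n, ?_, ?_, ?_⟩
  · intro n
    refine Submodule.sub_mem _ (schurDeformStep_mem_filt z z' μ n)
      (Submodule.sum_mem _ fun i hi => Submodule.smul_mem _ _ ?_)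
    exact (hg i (Finset.mem_range.1 hi)).1 n
  · have h1 : ∀ᶠ n in atTop, ∀ i ∈ Finset.range μ.card, restr n (g i n) =
        T z z' n (restr n (mkQ ((schurPoly μ).coeff (i + 1)))) :=
      (Finset.eventually_all _).2 fun i hi => (hg i (Finset.mem_range.1 hi)).2.1
    filter_upwards [h1, eventually_ge_atTop (μ.card + 1)] with n h2 hn
    have h3 : schurQ μ = schurDeform μ n - ∑ i ∈ Finset.range μ.card,
        (1 / (n : ℝ)) ^ (i + 1) • mkQ ((schurPoly μ).coeff (i + 1)) := by
      rw [schurDeform_eq, add_sub_cancel_right]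
    rw [h3, map_sub, map_sub, map_sub, T_restr_schurDeform h μ n (by omega) (by omega)]
    simp only [map_sum, map_smul]
    congr 1
    exact Finset.sum_congr rfl fun i hi => by rw [h2 i hi]
  · have h1 : Tendsto (fun n : ℕ => ∑ i ∈ Finset.range μ.card, (1 / (n : ℝ)) ^ (i + 1) •
        evalQ ((n : ℝ) ^ 2 • (g i n - mkQ ((schurPoly μ).coeff (i + 1))))) atTop
        (𝓝 (∑ i ∈ Finset.range μ.card, (0 : ℝ) • evalQ (a i))) :=
      tendsto_finsetSum _ fun i hi =>
        (tendsto_one_div_pow i).smul (hg i (Finset.mem_range.1 hi)).2.2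
    simp only [zero_smul, Finset.sum_const_zero] at h1
    have h2 := (tendsto_evalQ_schurDeformStep z z' μ).sub h1
    rw [sub_zero] at h2
    refine h2.congr fun n => ?_
    simp only [← map_smul, ← map_sum, ← map_sub]
    congr 1
    rw [schurDeform_eq]
    simp only [smul_sub, smul_add, Finset.sum_sub_distrib, Finset.smul_sum,
      smul_comm ((n : ℝ) ^ 2)]
    abel

theorem exists_isLimitValue {z z' : ℂ} (h : Admissible z z') (m : ℕ) :
    ∀ f ∈ filt m, ∃ a, IsLimitValue z z' m f a := by
  induction m using Nat.strong_induction_on with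
  | _ m ih =>
    intro f hf
    rw [← span_schurQ] at hf
    induction hf using Submodule.span_induction with
    | mem x hx =>
      obtain ⟨μ, rfl⟩ := hx
      have h1 := isLimitValue_schurQ_of_lt h μ.1 (by rw [μ.2]; exact ih)
      rw [μ.2] at h1
      exact ⟨_, h1⟩
    | zero => exact ⟨0, IsLimitValue.zero z z' m⟩
    | add x y _ _ hx hy =>
      obtain ⟨a, ha⟩ := hx
      obtain ⟨b, hb⟩ := hy
      exact ⟨_, ha.add hb⟩
    | smul c x _ hx =>
      obtain ⟨a, ha⟩ := hx
      exact ⟨_, ha.smul c⟩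

theorem isLimitValue_schurQ {z z' : ℂ} (h : Admissible z z') (μ : YoungDiagram) :
    IsLimitValue z z' μ.card (schurQ μ) (genSchur z z' μ) :=
  isLimitValue_schurQ_of_lt h μ fun k _ => exists_isLimitValue h k

/-- The limit operator. -/
theorem exists_limit_operator {z z' : ℂ} (h : Admissible z z') :
    ∃ A : SymQ →ₗ[ℝ] SymQ, ∀ m, ∀ f ∈ filt m, IsLimitValue z z' m f (A f) := by
  have h1 : ∀ f : SymQ, ∃ a, ∃ m, IsLimitValue z z' m f a := by
    intro f
    obtain ⟨m, hm⟩ := exists_mem_filt f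
    obtain ⟨a, ha⟩ := exists_isLimitValue h m f hm
    exact ⟨a, m, ha⟩
  choose A hA using h1
  refine ⟨{ toFun := A, map_add' := ?_, map_smul' := ?_ }, ?_⟩
  · intro f f'
    obtain ⟨m, hm⟩ := hA f
    obtain ⟨m', hm'⟩ := hA f'
    obtain ⟨k, hk⟩ := hA (f + f')
    exact hk.unique ((hm.mono (le_max_left m m')).add (hm'.mono (le_max_right m m')))
  · intro c f
    obtain ⟨m, hm⟩ := hA f
    obtain ⟨k, hk⟩ := hA (c • f)
    exact hk.unique (hm.smul c)
  · intro m f hf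
    obtain ⟨a, ha⟩ := exists_isLimitValue h m f hf
    obtain ⟨k, hk⟩ := hA f
    have : A f = a := hk.unique ha
    change IsLimitValue z z' m f (A f)
    rwa [this]

/-- It is enough to treat the spanning elements `schurDeform`, whose images are explicit elements of
F^m. -/
theorem exists_restr_eq_T {z z' : ℂ} (h : Admissible z z') (m n : ℕ) (hmn : m < n)
    (f : SymQ) (hf : f ∈ filt m) : ∃ g ∈ filt m, restr n g = T z z' n (restr n f) := by
  rw [← span_schurDeform m n hmn.le (by omega)] at hf
  induction hf using Submodule.span_induction with
  | mem x hx =>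
    obtain ⟨μ, rfl⟩ := hx
    have h1 := schurDeformStep_mem_filt z z' μ.1 n
    rw [μ.2] at h1
    refine ⟨_, h1, (T_restr_schurDeform h μ.1 n (by omega) ?_).symm⟩
    rw [μ.2]
    exact hmn.le
  | zero => exact ⟨0, Submodule.zero_mem _, by simp⟩
  | add x y _ _ hx hy =>
    obtain ⟨a, ha, ha'⟩ := hx
    obtain ⟨b, hb, hb'⟩ := hy
    exact ⟨a + b, Submodule.add_mem _ ha hb, by simp only [map_add, ha', hb']⟩
  | smul c x _ hx =>
    obtain ⟨a, ha, ha'⟩ := hx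
    exact ⟨c • a, Submodule.smul_mem _ _ ha, by simp only [map_smul, ha']⟩

/-- For large `n` the operator `T_n` induces an operator on `F^m`. -/
theorem exists_operator_filt {z z' : ℂ} (h : Admissible z z') (m n : ℕ) (hmn : m < n) :
    ∃ S : filt m →ₗ[ℝ] filt m, ∀ f : filt m, restr n (S f) = T z z' n (restr n f) := by
  set R : filt m →ₗ[ℝ] (Y n → ℝ) := (restr n).domRestrict (filt m) with hR
  have hker : LinearMap.ker R = ⊥ := by
    rw [LinearMap.ker_eq_bot']
    intro f hf
    exact Subtype.ext (restr_injOn m n hmn.le (by omega) f.1 f.2 hf)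
  obtain ⟨L, hL⟩ := LinearMap.exists_leftInverse_of_injective R hker
  refine ⟨L ∘ₗ T z z' n ∘ₗ R, fun f => ?_⟩
  obtain ⟨g, hg, hg'⟩ := exists_restr_eq_T h m n hmn f.1 f.2
  have h1 : (L ∘ₗ T z z' n ∘ₗ R) f = ⟨g, hg⟩ := by
    have h2 : T z z' n (R f) = R ⟨g, hg⟩ := hg'.symm
    rw [LinearMap.comp_apply, LinearMap.comp_apply, h2]
    exact LinearMap.congr_fun hL _
  rw [h1]
  exact hg'

end ZMeasures

end

theorem lemma5p4 (z z' : ℂ) (hz : ZMeasures.Admissible z z') :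
    ∃ A : ZMeasures.SymQ →ₗ[ℝ] ZMeasures.SymQ,
      (∀ m : ℕ,
        (∀ f ∈ ZMeasures.filt m, A f ∈ ZMeasures.filt m) ∧
        ∃ S : ℕ → (ZMeasures.filt m →ₗ[ℝ] ZMeasures.filt m),
          (∀ᶠ n : ℕ in Filter.atTop,
            Set.InjOn (fun f => ZMeasures.proj n (ZMeasures.evalQ f)) (ZMeasures.filt m) ∧
            ∀ f : ZMeasures.filt m,
              ZMeasures.proj n (ZMeasures.evalQ (S n f)) =
                ZMeasures.T z z' n (ZMeasures.proj n (ZMeasures.evalQ f))) ∧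
          ∀ f : ZMeasures.filt m,
            Filter.Tendsto
              (fun n : ℕ => ZMeasures.evalQ (((n : ℝ) ^ 2 • (S n f - f) : ZMeasures.filt m)))
              Filter.atTop (nhds (ZMeasures.evalQ (A f)))) ∧
      ∀ μ : YoungDiagram,
        A (ZMeasures.schurQ μ) =
          -((μ.card : ℝ) * ((μ.card : ℝ) - 1 + (z * z').re)) • ZMeasures.schurQ μ +
            ∑ ν ∈ ZMeasures.lower μ,
              ZMeasures.boxWeight z z' ν μ • ZMeasures.schurQ ν := by
  obtain ⟨A, hA⟩ := ZMeasures.exists_limit_operator hz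
  refine ⟨A, fun m => ⟨fun f hf => (hA m f hf).2.1, ?_⟩, fun μ => ?_⟩
  · have hS : ∀ n : ℕ, ∃ S : ZMeasures.filt m →ₗ[ℝ] ZMeasures.filt m, m < n →
        ∀ f : ZMeasures.filt m,
          ZMeasures.restr n (S f) = ZMeasures.T z z' n (ZMeasures.restr n f) := by
      intro n
      by_cases hn : m < n
      · obtain ⟨S, hS⟩ := ZMeasures.exists_operator_filt hz m n hn
        exact ⟨S, fun _ => hS⟩
      -- Only large n matter, so any operator serves as a default for n ≤ m.
      · exact ⟨0, fun h => absurd h hn⟩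
    choose S hS using hS
    refine ⟨S, ?_, fun f => ?_⟩
    · filter_upwards [ZMeasures.eventually_restr_inj m, eventually_gt_atTop m] with n h1 h2
      exact ⟨fun f hf f' hf' h => h1 f hf f' hf' h, hS n h2⟩
    · obtain ⟨_, _, g, hg, h1, h2⟩ := hA m f.1 f.2
      refine h2.congr' ?_
      filter_upwards [h1, ZMeasures.eventually_restr_inj m, eventually_gt_atTop m] with n e hn hm
      rw [hn (g n) (hg n) (S n f) (S n f).2 (e.trans (hS n hm f).symm)]
      rfl
  -- The operator was obtained by choice; uniqueness of limits identifies its value with the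
  -- computed one.
  · exact (hA μ.card _ (ZMeasures.schurQ_mem_filt μ)).unique
      (ZMeasures.isLimitValue_schurQ hz μ)
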